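/- **Setting.** Let $m\ge1$ agents hold local losses $F_i(\mathbf x,\mathbf y;\mathbf z)$, $\mathbf x\in\mathbb R^{d_1}$, $\mathbf y\in\mathbb R^{d_2}$ ($d_2\ge1$), and data distributions $D_i$. Put $f_i(\mathbf x,\mathbf y)=\mathbb E_{\mathbf z\sim D_i}F_i(\mathbf x,\mathbf y;\mathbf z)$, $f=\frac1m\sum_{i=1}^m f_i$, $\Phi(\mathbf x)=\max_{\mathbf y\in\mathbb R^{d_2}}f(\mathbf x,\mathbf y)$. Let $L,\mu>0$, $\sigma\in\mathbb R$, $\kappa=L/\mu$, and assume: 1. each $F_i(\cdot,\cdot;\mathbf z)$ is differentiable and $\|\nabla F_i(\mathbf x,\mathbf y;\mathbf z)-\nabla F_i(\mathbf x',\mathbf y';\mathbf z)\|^2\le L^2(\|\mathbf x-\mathbf x'\|^2+\|\mathbf y-\mathbf y'\|^2)$; 2. $\mathbb E_{\mathbf z\sim D_i}\nabla F_i(\mathbf x,\mathbf y;\mathbf z)=\nabla f_i(\mathbf x,\mathbf y)$ and $\mathbb E_{\mathbf z\sim D_i}\|\nabla F_i(\mathbf x,\mathbf y;\mathbf z)-\nabla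 f_i(\mathbf x,\mathbf y)\|^2\le\sigma^2$; 3. $\Phi^*=\inf_{\mathbf x}\Phi(\mathbf x)>-\infty$; 4. $\mathbf W=(w_{ij})\in\mathbb R^{m\times m}$ is symmetric and doubly stochastic with $\|\mathbf W-\frac1m\mathbf 1\mathbf 1^\top\|_2=\lambda<1$; 5. each $f_i$ is $\mu$-strongly concave in $\mathbf y$: $f_i(\mathbf x,\mathbf y)\le f_i(\mathbf x,\mathbf y')+\langle\nabla_{\mathbf y}f_i(\mathbf x,\mathbf y'),\mathbf y-\mathbf y'\rangle-\frac\mu2\|\mathbf y-\mathbf y'\|^2$. **Algorithm (DPMixSGD).** Start from $\mathbf x_0^{(i)}=\mathbf x_0$, $\mathbf y_0^{(i)}=\mathbf y_0$, $\mathbf v^{(i)}_{-1}=\mathbf g^{(i)*}_{-1}=\mathbf 0$, $\mathbf u^{(i)}_{-1}=\mathbf h^{(i)*}_{-1}=\mathbf 0$, and let $\mathbf g_0^{(i)}=\nabla_{\mathbf x}F_i(\mathbf x_0,\mathbf y_0;\mathbf z_0^{(i)})$, $\mathbf h_0^{(i)}=\nabla_{\mathbf y}F_i(\mathbf x_0,\mathbf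 y_0;\mathbf z_0^{(i)})$ be averages over a batch $\mathbf z_0^{(i)}$ of $b_0$ samples from $D_i$. For $t\ge1$, with a fresh batch $\mathbf z_t^{(i)}$ of $b\ge1$ samples from $D_i$, $$\mathbf g_t^{(i)}=(1-\beta_{\mathbf x})\bigl(\mathbf g_{t-1}^{(i)}-\nabla_{\mathbf x}F_i(\mathbf x_{t-1}^{(i)},\mathbf y_{t-1}^{(i)};\mathbf z_t^{(i)})\bigr)+\nabla_{\mathbf x}F_i(\mathbf x_t^{(i)},\mathbf y_t^{(i)};\mathbf z_t^{(i)}),$$ and $\mathbf h_t^{(i)}$ likewise with $\beta_{\mathbf y}$ and $\nabla_{\mathbf y}$. For every $t\ge0$: $\mathbf g_t^{(i)*}=\mathbf g_t^{(i)}+n_{\mathbf x,t}^{(i)}$, $\mathbf h_t^{(i)*}=\mathbf h_t^{(i)}+n_{\mathbf y,t}^{(i)}$ with $n_{\mathbf x,t}^{(i)}\sim\mathcal N(0,\sigma_{\mathbf x}^2I_{d_1})$, $n_{\mathbf y,t}^{(i)}\sim\mathcal N(0,\sigma_{\mathbf y}^2I_{d_2})$, and $$\mathbf v_t^{(i)}=\sum_j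 w_{ij}(\mathbf v_{t-1}^{(j)}+\mathbf g_t^{(j)*}-\mathbf g_{t-1}^{(j)*}),\qquad \mathbf u_t^{(i)}=\sum_j w_{ij}(\mathbf u_{t-1}^{(j)}+\mathbf h_t^{(j)*}-\mathbf h_{t-1}^{(j)*}),$$ $$\mathbf x_{t+1}^{(i)}=\sum_j w_{ij}(\mathbf x_t^{(j)}-\eta_{\mathbf x}\mathbf v_t^{(j)}),\qquad \mathbf y_{t+1}^{(i)}=\sum_j w_{ij}(\mathbf y_t^{(j)}+\eta_{\mathbf y}\mathbf u_t^{(j)}).$$ All samples and noises are mutually independent. Let $\bar{\mathbf x}_t=\frac1m\sum_i\mathbf x_t^{(i)}$. **Theorem.** Under 1–5, $\Phi$ is differentiable, the expectations below are finite, and the following bounds hold. The constants hidden in $\mathcal O(\cdot)$ depend only on $L$, $\mu$, $\sigma$ and on upper bounds for $\Phi(\mathbf x_0)-\Phi^*$, $\|\arg\max_{\mathbf y}f(\mathbf x_0,\mathbf y)-\mathbf y_0\|^2$ and $\frac1m\sum_i\|\nabla f_i(\mathbf x_0,\mathbf y_0)\|^2$ (so not on $m$, $\lambda$, $d_1$,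 $d_2$, $\sigma_{\mathbf x}$, $\sigma_{\mathbf y}$, $b$, $\epsilon$, $T_0$, $T$). In both parts let $$\beta_{\mathbf y}=\frac{\beta_{\mathbf x}}{25\kappa^2},\quad \eta_{\mathbf x}=\frac{(1-\lambda)^2\beta_{\mathbf x}}{750\kappa^3L\epsilon},\quad \eta_{\mathbf y}=\frac{(1-\lambda)^2\beta_{\mathbf x}}{75\kappa L\epsilon},\quad b_0=\Bigl\lceil\frac{20\kappa\epsilon}{\beta_{\mathbf x}}\Bigr\rceil .$$ (a) If $0<\epsilon\le1$, $\beta_{\mathbf x}=\frac{\epsilon\min\{1,m\epsilon\}}{20}$ and $T=\bigl\lceil\frac{1500\kappa^3}{(1-\lambda)^2\epsilon\beta_{\mathbf x}}\bigr\rceil$, then $$\frac1T\sum_{t=0}^{T-1}\mathbb E\|\nabla\Phi(\bar{\mathbf x}_t)\|^2=\mathcal O(\epsilon^2)+\mathcal O(m\epsilon^2)+\mathcal O(\sigma_{\mathbf x}^2d_1+\sigma_{\mathbf y}^2d_2).$$ (b) If $T_0\ge10m^2$, $\epsilon=(mT_0)^{-1/3}$, $\beta_{\mathbf x}=\frac{m^{1/3}}{20T_0^{2/3}}$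 and $T=\bigl\lceil\frac{30000\kappa^3T_0}{(1-\lambda)^2}\bigr\rceil$, then $$\frac1T\sum_{t=0}^{T-1}\mathbb E\|\nabla\Phi(\bar{\mathbf x}_t)\|^2=\mathcal O\Bigl(\frac1{(mT_0)^{2/3}}\Bigr)+\mathcal O\Bigl(\frac1{T_0}\Bigr)+\mathcal O\Bigl(\frac{m^{1/3}}{T_0^{2/3}}\Bigr)+\mathcal O(\sigma_{\mathbf x}^2d_1+\sigma_{\mathbf y}^2d_2).$$ -/

import Mathlib

open MeasureTheory ProbabilityTheory

noncomputable section

namespace DPMix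

/-- Euclidean space `ℝ^d`. -/
abbrev Vec (d : ℕ) := EuclideanSpace ℝ (Fin d)

/-- A decentralized stochastic min-max problem with `m` agents: the local losses
`F_i(x, y; z)` and the local data distributions `D_i`. -/
structure Problem (m d₁ d₂ : ℕ) (Z : Type*) [MeasurableSpace Z] where
  /-- local loss of each agent at a data point -/
  F : Fin m → Vec d₁ → Vec d₂ → Z → ℝ
  /-- local data distribution of each agent -/
  D : Fin m → Measure Z

section Problem

variable {m d₁ d₂ : ℕ} {Z : Type*} [MeasurableSpace Z] (Q : Problem m d₁ d₂ Z)

/-- `∇ₓ F_i(x, y; z)`. -/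
def Problem.gradX (i : Fin m) (x : Vec d₁) (y : Vec d₂) (z : Z) : Vec d₁ :=
  gradient (fun x' => Q.F i x' y z) x

/-- `∇_y F_i(x, y; z)`. -/
def Problem.gradY (i : Fin m) (x : Vec d₁) (y : Vec d₂) (z : Z) : Vec d₂ :=
  gradient (fun y' => Q.F i x y' z) y

/-- `f_i(x, y) = E_{z ∼ D_i} F_i(x, y; z)`. -/
def Problem.f (i : Fin m) (x : Vec d₁) (y : Vec d₂) : ℝ := ∫ z, Q.F i x y z ∂(Q.D i)

/-- `∇ₓ f_i(x, y)`. -/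
def Problem.fgradX (i : Fin m) (x : Vec d₁) (y : Vec d₂) : Vec d₁ :=
  gradient (fun x' => Q.f i x' y) x

/-- `∇_y f_i(x, y)`. -/
def Problem.fgradY (i : Fin m) (x : Vec d₁) (y : Vec d₂) : Vec d₂ :=
  gradient (fun y' => Q.f i x y') y

/-- The global objective `f(x, y) = (1/m) ∑ f_i(x, y)`. -/
def Problem.fbar (x : Vec d₁) (y : Vec d₂) : ℝ := (1 / (m : ℝ)) * ∑ i, Q.f i x y

/-- `Φ(x) = max_y f(x, y)`. -/
def Problem.Phi (x : Vec d₁) : ℝ := ⨆ y, Q.fbar x y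

/-- The data distributions are probability measures for which the expectations `f_i` make sense. -/
structure Problem.WellPosed : Prop where
  prob : ∀ i, IsProbabilityMeasure (Q.D i)
  meas : ∀ i x y, Measurable (Q.F i x y)
  int : ∀ i x y, Integrable (Q.F i x y) (Q.D i)

/-- Every local loss is differentiable with jointly `L`-Lipschitz gradient. -/
structure Problem.Smooth (L : ℝ) : Prop where
  diff : ∀ i z, Differentiable ℝ (fun p : Vec d₁ × Vec d₂ => Q.F i p.1 p.2 z)
  lip : ∀ i z x y x' y',
    ‖Q.gradX i x y z - Q.gradX i x' y' z‖ ^ 2 + ‖Q.gradY i x y z - Q.gradY i x' y' z‖ ^ 2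
      ≤ L ^ 2 * (‖x - x'‖ ^ 2 + ‖y - y'‖ ^ 2)

/-- The stochastic gradients are unbiased and have variance at most `σ²`. -/
structure Problem.BoundedVariance (σ : ℝ) : Prop where
  unbiasedX : ∀ i x y, ∫ z, Q.gradX i x y z ∂(Q.D i) = Q.fgradX i x y
  unbiasedY : ∀ i x y, ∫ z, Q.gradY i x y z ∂(Q.D i) = Q.fgradY i x y
  int : ∀ i x y, Integrable (fun z =>
    ‖Q.gradX i x y z - Q.fgradX i x y‖ ^ 2 + ‖Q.gradY i x y z - Q.fgradY i x y‖ ^ 2) (Q.D i)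
  var : ∀ i x y,
    ∫ z, (‖Q.gradX i x y z - Q.fgradX i x y‖ ^ 2 + ‖Q.gradY i x y z - Q.fgradY i x y‖ ^ 2)
      ∂(Q.D i) ≤ σ ^ 2

/-- Each `f_i(x, ·)` is `μ`-strongly concave. -/
def Problem.StronglyConcave (μ : ℝ) : Prop :=
  ∀ i x y y', Q.f i x y ≤ Q.f i x y' + inner ℝ (Q.fgradY i x y') (y - y')
    - μ / 2 * ‖y - y'‖ ^ 2

end Problem

/-- `W` is a symmetric doubly stochastic matrix with `‖W - 𝟏𝟏ᵀ/m‖₂ = lam` and `lam < 1`. -/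
structure IsMixing {m : ℕ} (W : Matrix (Fin m) (Fin m) ℝ) (lam : ℝ) : Prop where
  symm : W.IsSymm
  stoch : W ∈ doublyStochastic ℝ (Fin m)
  gap : ‖Matrix.toEuclideanCLM (n := Fin m) (𝕜 := ℝ) (W - Matrix.of fun _ _ => 1 / (m : ℝ))‖ = lam
  lt_one : lam < 1

/-- Inputs of the algorithm. -/
structure Params (m d₁ d₂ : ℕ) where
  /-- mixing matrix -/
  W : Matrix (Fin m) (Fin m) ℝ
  /-- common initial point -/
  x₀ : Vec d₁
  /-- common initial point -/
  y₀ : Vec d₂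
  /-- step sizes -/
  ηx : ℝ
  /-- step sizes -/
  ηy : ℝ
  /-- momentum weights -/
  βx : ℝ
  /-- momentum weights -/
  βy : ℝ
  /-- batch size of the initial iteration -/
  b₀ : ℕ
  /-- batch size of all later iterations (`1` for single samples) -/
  b : ℕ

/-- The variables held by the `m` agents at one iteration; `gs`, `hs` are the perturbed
gradient estimators that are shared with the neighbours. -/
structure State (m d₁ d₂ : ℕ) where
  x : Fin m → Vec d₁
  y : Fin m → Vec d₂
  g : Fin m → Vec d₁
  h : Fin m → Vec d₂
  gs : Fin m → Vec d₁
  hs : Fin m → Vec d₂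
  v : Fin m → Vec d₁
  u : Fin m → Vec d₂

section Algorithm

variable {m d₁ d₂ : ℕ} {Z : Type*} [MeasurableSpace Z] (Q : Problem m d₁ d₂ Z)
  (A : Params m d₁ d₂)

/-- Mini-batch gradient in `x` over the first `n` samples of `z`. -/
def batchX (n : ℕ) (z : ℕ → Z) (i : Fin m) (x : Vec d₁) (y : Vec d₂) : Vec d₁ :=
  (1 / (n : ℝ)) • ∑ k ∈ Finset.range n, Q.gradX i x y (z k)

/-- Mini-batch gradient in `y` over the first `n` samples of `z`. -/
def batchY (n : ℕ) (z : ℕ → Z) (i : Fin m) (x : Vec d₁) (y : Vec d₂) : Vec d₂ :=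
  (1 / (n : ℝ)) • ∑ k ∈ Finset.range n, Q.gradY i x y (z k)

/-- Iteration `0`: a batch of size `b₀` at the common starting point, and one round of
communication with `v_{-1} = g*_{-1} = 0` and `u_{-1} = h*_{-1} = 0`. -/
def initState (z : Fin m → ℕ → Z) (nx : Fin m → Vec d₁) (ny : Fin m → Vec d₂) :
    State m d₁ d₂ :=
  let g : Fin m → Vec d₁ := fun i => batchX Q A.b₀ (z i) i A.x₀ A.y₀
  let h : Fin m → Vec d₂ := fun i => batchY Q A.b₀ (z i) i A.x₀ A.y₀
  let gs : Fin m → Vec d₁ := fun i => g i + nx i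
  let hs : Fin m → Vec d₂ := fun i => h i + ny i
  { x := fun _ => A.x₀
    y := fun _ => A.y₀
    g := g
    h := h
    gs := gs
    hs := hs
    v := fun i => ∑ j, A.W i j • gs j
    u := fun i => ∑ j, A.W i j • hs j }

/-- One iteration: move the iterates, update the STORM estimators with a fresh batch, add
fresh noise, and perform gradient tracking. -/
def nextState (z : Fin m → ℕ → Z) (nx : Fin m → Vec d₁) (ny : Fin m → Vec d₂)
    (s : State m d₁ d₂) : State m d₁ d₂ :=
  let x : Fin m → Vec d₁ := fun i => ∑ j, A.W i j • (s.x j - A.ηx • s.v j)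
  let y : Fin m → Vec d₂ := fun i => ∑ j, A.W i j • (s.y j + A.ηy • s.u j)
  let g : Fin m → Vec d₁ := fun i =>
    (1 - A.βx) • (s.g i - batchX Q A.b (z i) i (s.x i) (s.y i)) + batchX Q A.b (z i) i (x i) (y i)
  let h : Fin m → Vec d₂ := fun i =>
    (1 - A.βy) • (s.h i - batchY Q A.b (z i) i (s.x i) (s.y i)) + batchY Q A.b (z i) i (x i) (y i)
  let gs : Fin m → Vec d₁ := fun i => g i + nx i
  let hs : Fin m → Vec d₂ := fun i => h i + ny i
  { x := x
    y := y
    g := g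
    h := h
    gs := gs
    hs := hs
    v := fun i => ∑ j, A.W i j • (s.v j + gs j - s.gs j)
    u := fun i => ∑ j, A.W i j • (s.u j + hs j - s.hs j) }

/-- The run of the algorithm on given samples `z t i k` (the `k`-th sample of agent `i` at
iteration `t`) and noises `nx t i`, `ny t i`. -/
def run (z : ℕ → Fin m → ℕ → Z) (nx : ℕ → Fin m → Vec d₁) (ny : ℕ → Fin m → Vec d₂) :
    ℕ → State m d₁ d₂
  | 0 => initState Q A (z 0) (nx 0) (ny 0)
  | t + 1 => nextState Q A (z (t + 1)) (nx (t + 1)) (ny (t + 1)) (run z nx ny t)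

/-- The average iterate `x̄_t`. -/
def xbar (z : ℕ → Fin m → ℕ → Z) (nx : ℕ → Fin m → Vec d₁) (ny : ℕ → Fin m → Vec d₂)
    (t : ℕ) : Vec d₁ :=
  (1 / (m : ℝ)) • ∑ i, (run Q A z nx ny t).x i

end Algorithm

section Randomness

variable {m d₁ d₂ : ℕ} {Z : Type*} [MeasurableSpace Z] {Ω : Type*} [MeasurableSpace Ω]

/-- The σ-algebras generated by the individual samples and noises. -/
@[reducible]
def inputSigma (z : ℕ → Fin m → ℕ → Ω → Z) (nx : ℕ → Fin m → Ω → Vec d₁)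
    (ny : ℕ → Fin m → Ω → Vec d₂) :
    (ℕ × Fin m × ℕ) ⊕ ((ℕ × Fin m) ⊕ (ℕ × Fin m)) → MeasurableSpace Ω
  | Sum.inl (t, i, k) => MeasurableSpace.comap (z t i k) inferInstance
  | Sum.inr (Sum.inl (t, i)) => MeasurableSpace.comap (nx t i) inferInstance
  | Sum.inr (Sum.inr (t, i)) => MeasurableSpace.comap (ny t i) inferInstance

/-- The samples of agent `i` have law `D_i`, the noises have laws `N(0, σx² I)` and
`N(0, σy² I)`, and all of them are mutually independent. -/
structure IsRandomInput (Q : Problem m d₁ d₂ Z) (σx σy : ℝ) (P : Measure Ω)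
    (z : ℕ → Fin m → ℕ → Ω → Z) (nx : ℕ → Fin m → Ω → Vec d₁)
    (ny : ℕ → Fin m → Ω → Vec d₂) : Prop where
  measZ : ∀ t i k, Measurable (z t i k)
  measX : ∀ t i, Measurable (nx t i)
  measY : ∀ t i, Measurable (ny t i)
  lawZ : ∀ t i k, P.map (z t i k) = Q.D i
  lawX : ∀ t i, P.map (nx t i) = multivariateGaussian 0 (σx ^ 2 • (1 : Matrix (Fin d₁) (Fin d₁) ℝ))
  lawY : ∀ t i, P.map (ny t i) = multivariateGaussian 0 (σy ^ 2 • (1 : Matrix (Fin d₂) (Fin d₂) ℝ))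
  indep : iIndep (inputSigma z nx ny) P

/-- `Φ` is differentiable, the second moments of `∇Φ(x̄_t)`, `t < T`, are finite, and
`(1/T) ∑_{t<T} E‖∇Φ(x̄_t)‖² ≤ R`. -/
def AvgGradBound (Q : Problem m d₁ d₂ Z) (A : Params m d₁ d₂) (P : Measure Ω)
    (z : ℕ → Fin m → ℕ → Ω → Z) (nx : ℕ → Fin m → Ω → Vec d₁)
    (ny : ℕ → Fin m → Ω → Vec d₂) (T : ℕ) (R : ℝ) : Prop :=
  Differentiable ℝ Q.Phi ∧
  (∀ t < T, Integrable (fun ω => ‖gradient Q.Phi (xbar Q A (fun s i k => z s i k ω)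
    (fun s i => nx s i ω) (fun s i => ny s i ω) t)‖ ^ 2) P) ∧
  (1 / (T : ℝ)) * ∑ t ∈ Finset.range T,
    ∫ ω, ‖gradient Q.Phi (xbar Q A (fun s i k => z s i k ω)
      (fun s i => nx s i ω) (fun s i => ny s i ω) t)‖ ^ 2 ∂P ≤ R

end Randomness

end DPMix

end

/-! Averaged over the agents, the algorithm is inexact gradient descent ascent: a doubly stochastic
matrix preserves averages, and gradient tracking keeps the averages of `v`, `u` equal to those of
the perturbed estimators `gs`, `hs` (`IsTracking.avg_v`, `IsTracking.avg_x`). For such a dynamics, Φ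
has a quadratic expansion with constant at most κL, so it decreases up to a multiple of the gap
Φ(x̄) − f(x̄, ȳ); the gap contracts by the Polyak–Łojasiewicz inequality, at a price for the x-steps
that is small because ηy = 10κ²ηx. Weighting the two inequalities so that the gap cancels gives
`SmoothConcave.sum_gradient_sq_le`: Σ‖∇Φ(x̄)‖² plus positive multiples of the squared average steps
V and U is at most initial terms plus gradient errors. The spare V and U on the left later pay for
the motion of the iterates.

The gradient error at the average consists of disagreement between agents, estimator error and
privacy noise. The noise is controlled only through its second moment, hence the additive σx²d₁ +
σy²d₂. The estimator error satisfies e' = (1 − β)e + innovation, the innovation being orthogonal to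
the past and to the innovations of other agents. So the squares add up without cross terms, and the
averaged error gains a factor 1/m (`integral_momentum_step`, `errX_recursion`). The mean square
innovation is at most 6L² times the displacement plus 3β²σ². Disagreement passes through two
cascaded contractions of rate λ, so its sum is at most η²/(1 − λ)⁴ times the initial size and
squared variation of the estimators (`IsTracking.sum_dev_le`), which is again displacement, β² times
errors, and noise.

In expectation this is a closed system of linear inequalities (`expected_bounds`). Since ηy is
proportional to (1 − λ)², its feedback coefficient L²ηy²/(1 − λ)⁴ equals ρ² with ρ = βx/(75κε),
which is tiny and free of λ. Displacement reaches the averaged estimator error with coefficient of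
order ρ²/(mβx), bounded because βx ≤ mε²/20; here the factor 1/m is essential.
`gradient_sum_le_of_system` solves the system and `average_le_of_sum_le` inserts T and b₀. Part (b)
is part (a) with ε = (mT₀)^(-1/3), for which T₀ ≥ 10m² gives min(1, mε) = mε. -/

namespace DPMix

/-! ### First-order expansions with quadratic remainder -/

section Smooth

variable {E : Type*} [NormedAddCommGroup E] [InnerProductSpace ℝ E] [CompleteSpace E]

/-- Along the segment the remainder has derivative at most L t ‖h‖² in absolute value, so it stays
below the parabola L t² ‖h‖² / 2; the gradient is never integrated. -/
theorem abs_sub_sub_inner_le_of_lipschitz_gradient {f : E → ℝ} {g : E → E} {L : ℝ}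
    (hf : ∀ x, HasGradientAt f (g x) x) (hg : ∀ x x', ‖g x - g x'‖ ≤ L * ‖x - x'‖) (x x' : E) :
    |f x' - f x - inner ℝ (g x) (x' - x)| ≤ L / 2 * ‖x' - x‖ ^ 2 := by
  set h := x' - x with hh
  have hφ : ∀ t : ℝ, HasDerivAt (fun t : ℝ => f (x + t • h) - f x - t * inner ℝ (g x) h)
      (inner ℝ (g (x + t • h) - g x) h) t := by
    intro t
    have h1 : HasDerivAt (fun t : ℝ => x + t • h) h t := by
      simpa using ((hasDerivAt_id t).smul_const h).const_add x
    have h2 := (hasGradientAt_iff_hasFDerivAt.1 (hf (x + t • h))).comp_hasDerivAt t h1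
    have h3 := (h2.sub_const (f x)).sub ((hasDerivAt_id t).mul_const (inner ℝ (g x) h))
    rw [inner_sub_left]
    refine HasDerivAt.congr_deriv (f := fun t : ℝ => f (x + t • h) - f x - t * inner ℝ (g x) h) h3 ?_
    simp
  have key := image_norm_le_of_norm_deriv_right_le_deriv_boundary (a := 0) (b := 1)
    (f := fun t : ℝ => f (x + t • h) - f x - t * inner ℝ (g x) h)
    (f' := fun t => inner ℝ (g (x + t • h) - g x) h)
    (B := fun t => L / 2 * ‖h‖ ^ 2 * t ^ 2) (B' := fun t => L * ‖h‖ ^ 2 * t)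
    (fun t _ => (hφ t).continuousAt.continuousWithinAt)
    (fun t _ => (hφ t).hasDerivWithinAt) (by simp)
    (fun t => by
      have := (hasDerivAt_pow 2 t).const_mul (L / 2 * ‖h‖ ^ 2)
      refine this.congr_deriv ?_
      push_cast
      ring)
    (fun t ht => by
      calc ‖inner ℝ (g (x + t • h) - g x) h‖ ≤ ‖g (x + t • h) - g x‖ * ‖h‖ := norm_inner_le_norm _ _
        _ ≤ (L * ‖x + t • h - x‖) * ‖h‖ := by gcongr; exact hg _ _
        _ = L * ‖h‖ ^ 2 * t := by
          rw [add_sub_cancel_left, norm_smul, Real.norm_of_nonneg ht.1]; ring)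
    (x := 1) (by simp)
  simpa [hh, Real.norm_eq_abs] using key

/-- A quadratic remainder is little-o of the distance. Differentiability of Φ is obtained this way.
-/
theorem hasGradientAt_of_abs_sub_sub_inner_le {f : E → ℝ} {g x : E} {c : ℝ}
    (h : ∀ x', |f x' - f x - inner ℝ g (x' - x)| ≤ c * ‖x' - x‖ ^ 2) : HasGradientAt f g x := by
  rw [hasGradientAt_iff_isLittleO]
  refine Asymptotics.IsBigO.trans_isLittleO (g := fun x' => ‖x' - x‖ ^ 2) ?_ ?_
  · refine Asymptotics.IsBigO.of_bound c (Filter.Eventually.of_forall fun x' => ?_)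
    simpa using h x'
  · have h0 : Filter.Tendsto (fun x' => x' - x) (nhds x) (nhds 0) := by
      have : Continuous (fun x' => x' - x) := by fun_prop
      simpa using this.tendsto x
    exact (Asymptotics.isLittleO_norm_pow_id (E' := E) one_lt_two).comp_tendsto h0

end Smooth

/-! ### Elementary norm inequalities -/

section Inner

variable {E : Type*} [NormedAddCommGroup E]

theorem norm_add_sq_le_two (a b : E) : ‖a + b‖ ^ 2 ≤ 2 * (‖a‖ ^ 2 + ‖b‖ ^ 2) := by
  nlinarith [sq_nonneg (‖a‖ - ‖b‖), norm_add_le a b, norm_nonneg (a + b), norm_nonneg a,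
    norm_nonneg b, mul_self_le_mul_self (norm_nonneg (a + b)) (norm_add_le a b)]

theorem norm_sum_sq_le {ι : Type*} (s : Finset ι) (a : ι → E) :
    ‖∑ i ∈ s, a i‖ ^ 2 ≤ s.card * ∑ i ∈ s, ‖a i‖ ^ 2 :=
  (pow_le_pow_left₀ (norm_nonneg _) (norm_sum_le _ _) 2).trans sq_sum_le_card_mul_sum_sq

end Inner

/-! ### Losses depending on a random parameter -/

section Parametric

variable {Z : Type*} [MeasurableSpace Z] {d : ℕ}

/-- Each coordinate of the gradient is a limit of difference quotients with steps 1/(n+1), and these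
are measurable in the sample. -/
theorem measurable_of_hasGradientAt {f : Vec d → Z → ℝ} {g : Z → Vec d} {x : Vec d}
    (hf : ∀ x, Measurable (f x)) (hg : ∀ z, HasGradientAt (fun x => f x z) (g z) x) :
    Measurable g := by
  have hcoord : ∀ k : Fin d, Measurable (fun z => g z k) := by
    intro k
    set e : Vec d := EuclideanSpace.single k (1 : ℝ)
    have hlim : ∀ z, Filter.Tendsto
        (fun n : ℕ => ((1 / ((n : ℝ) + 1))⁻¹ • (f (x + (0 + 1 / ((n : ℝ) + 1)) • e) z
          - f (x + (0 : ℝ) • e) z))) Filter.atTop (nhds (g z k)) := by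
      intro z
      have h1 : HasDerivAt (fun t : ℝ => x + t • e) e 0 := by
        simpa using ((hasDerivAt_id (0 : ℝ)).smul_const e).const_add x
      have h0 : HasFDerivAt (fun x => f x z) (InnerProductSpace.toDual ℝ _ (g z))
          (x + (0 : ℝ) • e) := by
        simpa using hasGradientAt_iff_hasFDerivAt.1 (hg z)
      have h2 : HasDerivAt (fun t : ℝ => f (x + t • e) z) (g z k) 0 := by
        refine (h0.comp_hasDerivAt (0 : ℝ) h1).congr_deriv ?_
        simp [e, EuclideanSpace.inner_single_right]
      refine h2.tendsto_slope_zero.comp ?_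
      rw [tendsto_nhdsWithin_iff]
      exact ⟨tendsto_one_div_add_atTop_nhds_zero_nat,
        Filter.Eventually.of_forall fun n => (Nat.one_div_pos_of_nat (α := ℝ)).ne'⟩
    refine measurable_of_tendsto_metrizable (f := fun (n : ℕ) z =>
      ((1 / ((n : ℝ) + 1))⁻¹ • (f (x + (0 + 1 / ((n : ℝ) + 1)) • e) z
          - f (x + (0 : ℝ) • e) z))) (fun n => ?_) (tendsto_pi_nhds.2 hlim)
    exact Measurable.const_smul (M := ℝ) ((hf _).sub (hf _)) _
  exact (MeasurableEquiv.toLp 2 (Fin d → ℝ)).measurable.comp (measurable_pi_iff.2 hcoord)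

variable {ν : Measure Z} [IsProbabilityMeasure ν]

/-- Jensen's inequality, read off from the nonnegativity of the variance of ‖u‖. -/
theorem norm_integral_sq_le {E : Type*} [NormedAddCommGroup E] [NormedSpace ℝ E] {u : Z → E}
    (hu : MemLp u 2 ν) : ‖∫ z, u z ∂ν‖ ^ 2 ≤ ∫ z, ‖u z‖ ^ 2 ∂ν := by
  have h1 : (∫ z, ‖u z‖ ∂ν) ^ 2 ≤ ∫ z, ‖u z‖ ^ 2 ∂ν := by
    have h := variance_nonneg (fun z => ‖u z‖) ν
    rw [variance_eq_sub hu.norm] at h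
    simpa using h
  exact (pow_le_pow_left₀ (norm_nonneg _) (norm_integral_le_integral_norm _) 2).trans h1

/-- The expansion with quadratic remainder holds for each sample uniformly, so it can be integrated;
differentiation under the integral sign is avoided. -/
theorem abs_integral_sub_sub_inner_le {f : Vec d → Z → ℝ} {g : Vec d → Z → Vec d} {L : ℝ}
    (hint : ∀ x, Integrable (f x) ν) (hg : ∀ x z, HasGradientAt (fun x => f x z) (g x z) x)
    (hlip : ∀ x x' z, ‖g x z - g x' z‖ ≤ L * ‖x - x'‖) (hgint : ∀ x, Integrable (g x) ν)
    (x x' : Vec d) :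
    |∫ z, f x' z ∂ν - ∫ z, f x z ∂ν - inner ℝ (∫ z, g x z ∂ν) (x' - x)|
      ≤ L / 2 * ‖x' - x‖ ^ 2 := by
  have e1 : inner ℝ (∫ z, g x z ∂ν) (x' - x) = ∫ z, inner ℝ (g x z) (x' - x) ∂ν := by
    rw [real_inner_comm, ← integral_inner (hgint x)]
    simp_rw [real_inner_comm]
  rw [e1, ← integral_sub (hint _) (hint _), ← integral_sub (f := fun z => f x' z - f x z)
    ((hint _).sub (hint _)) ((hgint x).inner_const _)]
  have := norm_integral_le_of_norm_le_const (μ := ν) (C := L / 2 * ‖x' - x‖ ^ 2)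
    (f := fun z => f x' z - f x z - inner ℝ (g x z) (x' - x))
    (Filter.Eventually.of_forall fun z => by
      rw [Real.norm_eq_abs]
      exact abs_sub_sub_inner_le_of_lipschitz_gradient (f := fun x => f x z) (g := fun x => g x z)
        (fun x => hg x z) (fun x x' => hlip x x' z) x x')
  simpa using this

end Parametric

/-! ### Regularity of the stochastic gradients and of the local objectives -/

section Problem

variable {m d₁ d₂ : ℕ} {Z : Type*} [MeasurableSpace Z] {Q : Problem m d₁ d₂ Z} {L σ : ℝ}

theorem Problem.Smooth.hasGradientAt_x (hS : Q.Smooth L) (i : Fin m) (x : Vec d₁) (y : Vec d₂)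
    (z : Z) : HasGradientAt (fun x' => Q.F i x' y z) (Q.gradX i x y z) x := by
  have h : DifferentiableAt ℝ (fun x' => Q.F i x' y z) x :=
    (hS.diff i z (x, y)).comp (f := fun x' => (x', y)) x (by fun_prop)
  exact h.hasGradientAt

theorem Problem.Smooth.hasGradientAt_y (hS : Q.Smooth L) (i : Fin m) (x : Vec d₁) (y : Vec d₂)
    (z : Z) : HasGradientAt (fun y' => Q.F i x y' z) (Q.gradY i x y z) y := by
  have h : DifferentiableAt ℝ (fun y' => Q.F i x y' z) y :=
    (hS.diff i z (x, y)).comp (f := fun y' => (x, y')) y (by fun_prop)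
  exact h.hasGradientAt

theorem Problem.Smooth.lip_x (hS : Q.Smooth L) (hL : 0 < L) (i : Fin m) (x x' : Vec d₁)
    (y y' : Vec d₂) (z : Z) :
    ‖Q.gradX i x y z - Q.gradX i x' y' z‖ ≤ L * (‖x - x'‖ + ‖y - y'‖) := by
  have h := hS.lip i z x y x' y'
  have h0 := mul_nonneg (norm_nonneg (x - x')) (norm_nonneg (y - y'))
  refine abs_le_of_sq_le_sq' ?_ (by positivity) |>.2
  nlinarith [sq_nonneg ‖Q.gradY i x y z - Q.gradY i x' y' z‖, mul_nonneg (sq_nonneg L) h0]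

theorem Problem.Smooth.lip_y (hS : Q.Smooth L) (hL : 0 < L) (i : Fin m) (x x' : Vec d₁)
    (y y' : Vec d₂) (z : Z) :
    ‖Q.gradY i x y z - Q.gradY i x' y' z‖ ≤ L * (‖x - x'‖ + ‖y - y'‖) := by
  have h := hS.lip i z x y x' y'
  have h0 := mul_nonneg (norm_nonneg (x - x')) (norm_nonneg (y - y'))
  refine abs_le_of_sq_le_sq' ?_ (by positivity) |>.2
  nlinarith [sq_nonneg ‖Q.gradX i x y z - Q.gradX i x' y' z‖, mul_nonneg (sq_nonneg L) h0]

theorem Problem.measurable_gradX (hW : Q.WellPosed) (hS : Q.Smooth L) (i : Fin m) (x : Vec d₁)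
    (y : Vec d₂) : Measurable (Q.gradX i x y) :=
  measurable_of_hasGradientAt (f := fun x z => Q.F i x y z) (fun x => hW.meas i x y)
    (fun z => hS.hasGradientAt_x i x y z)

theorem Problem.measurable_gradY (hW : Q.WellPosed) (hS : Q.Smooth L) (i : Fin m) (x : Vec d₁)
    (y : Vec d₂) : Measurable (Q.gradY i x y) :=
  measurable_of_hasGradientAt (f := fun y z => Q.F i x y z) (fun y => hW.meas i x y)
    (fun z => hS.hasGradientAt_y i x y z)

theorem continuous_of_norm_sub_le {E F : Type*} [NormedAddCommGroup E] [NormedAddCommGroup F]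
    {G : Type*} [NormedAddCommGroup G] {g : E × F → G} {L : ℝ} (hL : 0 < L)
    (h : ∀ p q : E × F, ‖g p - g q‖ ≤ L * (‖p.1 - q.1‖ + ‖p.2 - q.2‖)) : Continuous g := by
  refine (LipschitzWith.of_dist_le_mul (K := ⟨2 * L, by positivity⟩) fun p q => ?_).continuous
  have h1 : ‖p.1 - q.1‖ ≤ ‖p - q‖ := norm_fst_le (p - q)
  have h2 : ‖p.2 - q.2‖ ≤ ‖p - q‖ := norm_snd_le (p - q)
  rw [dist_eq_norm, dist_eq_norm]
  refine (h p q).trans ?_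
  change _ ≤ 2 * L * ‖p - q‖
  nlinarith

/-- Carathéodory argument: continuous in the point, measurable in the sample. Joint measurability is
needed because gradients are evaluated at random iterates. -/
theorem Problem.measurable_gradX_uncurry (hW : Q.WellPosed) (hS : Q.Smooth L) (hL : 0 < L)
    (i : Fin m) : Measurable (fun p : (Vec d₁ × Vec d₂) × Z => Q.gradX i p.1.1 p.1.2 p.2) :=
  measurable_uncurry_of_continuous_of_measurable
    (u := fun (p : Vec d₁ × Vec d₂) z => Q.gradX i p.1 p.2 z)
    (fun z => continuous_of_norm_sub_le hL fun _ _ => hS.lip_x hL i _ _ _ _ z)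
    (fun p => Q.measurable_gradX hW hS i p.1 p.2)

theorem Problem.measurable_gradY_uncurry (hW : Q.WellPosed) (hS : Q.Smooth L) (hL : 0 < L)
    (i : Fin m) : Measurable (fun p : (Vec d₁ × Vec d₂) × Z => Q.gradY i p.1.1 p.1.2 p.2) :=
  measurable_uncurry_of_continuous_of_measurable
    (u := fun (p : Vec d₁ × Vec d₂) z => Q.gradY i p.1 p.2 z)
    (fun z => continuous_of_norm_sub_le hL fun _ _ => hS.lip_y hL i _ _ _ _ z)
    (fun p => Q.measurable_gradY hW hS i p.1 p.2)

theorem memLp_two_of_sq_le {Z E : Type*} [MeasurableSpace Z] {ν : Measure Z}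
    [NormedAddCommGroup E] {u : Z → E} {φ : Z → ℝ} (hu : AEStronglyMeasurable u ν)
    (hφ : Integrable φ ν) (h : ∀ z, ‖u z‖ ^ 2 ≤ φ z) : MemLp u 2 ν := by
  rw [memLp_two_iff_integrable_sq_norm hu]
  exact hφ.mono' (hu.norm.pow 2) (Filter.Eventually.of_forall fun z => by
    simpa using h z)

theorem Problem.memLp_gradX_sub (hW : Q.WellPosed) (hS : Q.Smooth L)
    (hV : Q.BoundedVariance σ) (i : Fin m) (x : Vec d₁) (y : Vec d₂) :
    MemLp (fun z => Q.gradX i x y z - Q.fgradX i x y) 2 (Q.D i) :=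
  memLp_two_of_sq_le ((Q.measurable_gradX hW hS i x y).sub_const _).aestronglyMeasurable
    (hV.int i x y) fun _ => le_add_of_nonneg_right (sq_nonneg _)

theorem Problem.memLp_gradY_sub (hW : Q.WellPosed) (hS : Q.Smooth L)
    (hV : Q.BoundedVariance σ) (i : Fin m) (x : Vec d₁) (y : Vec d₂) :
    MemLp (fun z => Q.gradY i x y z - Q.fgradY i x y) 2 (Q.D i) :=
  memLp_two_of_sq_le ((Q.measurable_gradY hW hS i x y).sub_const _).aestronglyMeasurable
    (hV.int i x y) fun _ => le_add_of_nonneg_left (sq_nonneg _)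

theorem Problem.memLp_gradX (hW : Q.WellPosed) (hS : Q.Smooth L)
    (hV : Q.BoundedVariance σ) (i : Fin m) (x : Vec d₁) (y : Vec d₂) :
    MemLp (Q.gradX i x y) 2 (Q.D i) := by
  have := hW.prob i
  have h := (Q.memLp_gradX_sub hW hS hV i x y).add (memLp_const (Q.fgradX i x y))
  refine h.ae_eq (Filter.Eventually.of_forall fun z => ?_)
  simp

theorem Problem.memLp_gradY (hW : Q.WellPosed) (hS : Q.Smooth L)
    (hV : Q.BoundedVariance σ) (i : Fin m) (x : Vec d₁) (y : Vec d₂) :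
    MemLp (Q.gradY i x y) 2 (Q.D i) := by
  have := hW.prob i
  have h := (Q.memLp_gradY_sub hW hS hV i x y).add (memLp_const (Q.fgradY i x y))
  refine h.ae_eq (Filter.Eventually.of_forall fun z => ?_)
  simp

/-- Unbiasedness identifies ∇ₓ f_i with the mean sample gradient, so the expansion of the sample
losses passes to f_i. -/
theorem Problem.abs_f_sub_x_le (hW : Q.WellPosed) (hS : Q.Smooth L) (hL : 0 < L)
    (hV : Q.BoundedVariance σ) (i : Fin m) (x x' : Vec d₁) (y : Vec d₂) :
    |Q.f i x' y - Q.f i x y - inner ℝ (Q.fgradX i x y) (x' - x)| ≤ L / 2 * ‖x' - x‖ ^ 2 := by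
  have := hW.prob i
  rw [← hV.unbiasedX]
  exact abs_integral_sub_sub_inner_le (f := fun x z => Q.F i x y z)
    (g := fun x z => Q.gradX i x y z) (fun x => hW.int i x y)
    (fun x z => hS.hasGradientAt_x i x y z)
    (fun x x' z => by simpa using hS.lip_x hL i x x' y y z)
    (fun x => (Q.memLp_gradX hW hS hV i x y).integrable one_le_two) x x'

theorem Problem.abs_f_sub_y_le (hW : Q.WellPosed) (hS : Q.Smooth L) (hL : 0 < L)
    (hV : Q.BoundedVariance σ) (i : Fin m) (x : Vec d₁) (y y' : Vec d₂) :
    |Q.f i x y' - Q.f i x y - inner ℝ (Q.fgradY i x y) (y' - y)| ≤ L / 2 * ‖y' - y‖ ^ 2 := by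
  have := hW.prob i
  rw [← hV.unbiasedY]
  exact abs_integral_sub_sub_inner_le (f := fun y z => Q.F i x y z)
    (g := fun y z => Q.gradY i x y z) (fun y => hW.int i x y)
    (fun y z => hS.hasGradientAt_y i x y z)
    (fun y y' z => by simpa using hS.lip_y hL i x x y y' z)
    (fun y => (Q.memLp_gradY hW hS hV i x y).integrable one_le_two) y y'

/-- Jensen's inequality for the difference of sample gradients at the two points. -/
theorem Problem.fgrad_lip (hW : Q.WellPosed) (hS : Q.Smooth L)
    (hV : Q.BoundedVariance σ) (i : Fin m) (x x' : Vec d₁) (y y' : Vec d₂) :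
    ‖Q.fgradX i x y - Q.fgradX i x' y'‖ ^ 2 + ‖Q.fgradY i x y - Q.fgradY i x' y'‖ ^ 2
      ≤ L ^ 2 * (‖x - x'‖ ^ 2 + ‖y - y'‖ ^ 2) := by
  have := hW.prob i
  have hx := fun x y => Q.memLp_gradX hW hS hV i x y
  have hy := fun x y => Q.memLp_gradY hW hS hV i x y
  have hdx := (hx x y).sub (hx x' y')
  have hdy := (hy x y).sub (hy x' y')
  simp only [← hV.unbiasedX, ← hV.unbiasedY]
  rw [← integral_sub ((hx x y).integrable one_le_two) ((hx x' y').integrable one_le_two),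
    ← integral_sub ((hy x y).integrable one_le_two) ((hy x' y').integrable one_le_two)]
  refine (add_le_add (norm_integral_sq_le hdx) (norm_integral_sq_le hdy)).trans ?_
  rw [← integral_add hdx.integrable_norm_pow' hdy.integrable_norm_pow']
  calc _ ≤ ∫ _, L ^ 2 * (‖x - x'‖ ^ 2 + ‖y - y'‖ ^ 2) ∂(Q.D i) :=
        integral_mono (hdx.integrable_norm_pow'.add hdy.integrable_norm_pow')
          (integrable_const _) fun z => hS.lip i z x y x' y'
    _ = _ := by simp

end Problem


/-! ### Descent ascent for a smooth function that is strongly concave in its second argument -/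

section Minimax

variable {d₁ d₂ : ℕ}

/-- `gx`, `gy` are the partial gradients of `f`, they are jointly `L`-Lipschitz, and `f` is
`μ`-strongly concave in its second argument. -/
structure SmoothConcave (f : Vec d₁ → Vec d₂ → ℝ) (gx : Vec d₁ → Vec d₂ → Vec d₁)
    (gy : Vec d₁ → Vec d₂ → Vec d₂) (L μ : ℝ) : Prop where
  pos_L : 0 < L
  pos_μ : 0 < μ
  quad_x : ∀ x x' y, |f x' y - f x y - inner ℝ (gx x y) (x' - x)| ≤ L / 2 * ‖x' - x‖ ^ 2
  quad_y : ∀ x y y', |f x y' - f x y - inner ℝ (gy x y) (y' - y)| ≤ L / 2 * ‖y' - y‖ ^ 2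
  lip : ∀ x x' y y', ‖gx x y - gx x' y'‖ ^ 2 + ‖gy x y - gy x' y'‖ ^ 2
    ≤ L ^ 2 * (‖x - x'‖ ^ 2 + ‖y - y'‖ ^ 2)
  conc : ∀ x y y', f x y ≤ f x y' + inner ℝ (gy x y') (y - y') - μ / 2 * ‖y - y'‖ ^ 2

namespace SmoothConcave

variable {f : Vec d₁ → Vec d₂ → ℝ} {gx : Vec d₁ → Vec d₂ → Vec d₁}
  {gy : Vec d₁ → Vec d₂ → Vec d₂} {L μ : ℝ}

/-- Along a unit vector, strong concavity forces the function below its tangent by μ/2, while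
smoothness allows at most L/2. Such a vector exists only if d₂ ≥ 1, and κ ≥ 1 is the only use of
that assumption. -/
theorem mu_le (h : SmoothConcave f gx gy L μ) (hd : 0 < d₂) : μ ≤ L := by
  have h1 := (abs_le.1 (h.quad_y 0 0 (EuclideanSpace.single ⟨0, hd⟩ 1))).1
  have h2 := h.conc 0 (EuclideanSpace.single ⟨0, hd⟩ 1) 0
  simp at h1 h2
  linarith

theorem exists_isMax (h : SmoothConcave f gx gy L μ) (x : Vec d₁) :
    ∃ ys, ∀ y, f x y ≤ f x ys := by
  have hcont : Continuous (f x) := by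
    rw [continuous_iff_continuousAt]
    intro y
    exact (hasGradientAt_of_abs_sub_sub_inner_le (h.quad_y x y)).differentiableAt.continuousAt
  have hμ := h.pos_μ
  have hbound : ∀ y, f x y ≤ f x 0 + ‖gy x 0‖ * ‖y‖ - μ / 2 * ‖y‖ ^ 2 := fun y => by
    have := h.conc x y 0
    have h2 := real_inner_le_norm (gy x 0) y
    simp only [sub_zero] at this
    linarith
  obtain ⟨ys, hys⟩ := hcont.exists_forall_ge' (x₀ := (0 : Vec d₂)) (by
    -- Beyond this radius the term −μ‖y‖²/2 outweighs the linear term, so the maximum may be sought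
    -- in a compact set.
    have : ∀ᶠ y : Vec d₂ in Filter.cocompact _, 2 * ‖gy x 0‖ / μ ≤ ‖y‖ :=
      tendsto_norm_cocompact_atTop.eventually_ge_atTop _
    filter_upwards [this] with y hy
    rw [div_le_iff₀ hμ] at hy
    have := hbound y
    nlinarith [norm_nonneg y])
  exact ⟨ys, hys⟩

/-- The maximiser of `f x`. -/
noncomputable def argmax (h : SmoothConcave f gx gy L μ) (x : Vec d₁) : Vec d₂ :=
  (h.exists_isMax x).choose

theorem le_argmax (h : SmoothConcave f gx gy L μ) (x : Vec d₁) (y : Vec d₂) :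
    f x y ≤ f x (h.argmax x) := (h.exists_isMax x).choose_spec y

theorem iSup_eq (h : SmoothConcave f gx gy L μ) (x : Vec d₁) :
    ⨆ y, f x y = f x (h.argmax x) :=
  le_antisymm (ciSup_le (h.le_argmax x))
    (le_ciSup (f := f x) ⟨_, Set.forall_mem_range.2 (h.le_argmax x)⟩ (h.argmax x))

/-- Otherwise a gradient step of size 1/L would increase f by at least ‖∇_y f‖² / (2L). -/
theorem gy_eq_zero_of_isMax (h : SmoothConcave f gx gy L μ) {x : Vec d₁} {ys : Vec d₂}
    (hmax : ∀ y, f x y ≤ f x ys) : gy x ys = 0 := by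
  have hL := h.pos_L
  have h1 := (abs_le.1 (h.quad_y x ys (ys + (1 / L) • gy x ys))).1
  have h2 := hmax (ys + (1 / L) • gy x ys)
  rw [add_sub_cancel_left, inner_smul_right, real_inner_self_eq_norm_sq, norm_smul,
    Real.norm_of_nonneg (by positivity)] at h1
  have h3 : 1 / L * ‖gy x ys‖ ^ 2 ≤ L / 2 * (1 / L * ‖gy x ys‖) ^ 2 := by linarith
  have h4 : L / 2 * (1 / L * ‖gy x ys‖) ^ 2 = 1 / L * ‖gy x ys‖ ^ 2 / 2 := by
    field_simp
  have h5 : 1 / L * ‖gy x ys‖ ^ 2 ≤ 0 := by linarith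
  have h6 : ‖gy x ys‖ ^ 2 ≤ 0 := by
    have h7 : 0 < 1 / L := by positivity
    by_contra hc
    push Not at hc
    nlinarith [mul_pos h7 hc]
  exact norm_eq_zero.1 (pow_eq_zero_iff two_ne_zero |>.1 (le_antisymm h6 (sq_nonneg _)))

theorem gy_argmax (h : SmoothConcave f gx gy L μ) (x : Vec d₁) : gy x (h.argmax x) = 0 :=
  h.gy_eq_zero_of_isMax (h.le_argmax x)

theorem dist_argmax_le (h : SmoothConcave f gx gy L μ) (x : Vec d₁) (y : Vec d₂) :
    μ / 2 * ‖y - h.argmax x‖ ^ 2 ≤ f x (h.argmax x) - f x y := by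
  have := h.conc x y (h.argmax x)
  rw [h.gy_argmax, inner_zero_left] at this
  linarith

/-- The initial distance in the main theorem is measured to an arbitrary maximiser; working with any
`ys` avoids proving uniqueness. -/
theorem gap_le_of_isMax (h : SmoothConcave f gx gy L μ) {x : Vec d₁} {ys : Vec d₂}
    (hmax : ∀ y, f x y ≤ f x ys) (y : Vec d₂) :
    f x (h.argmax x) - f x y ≤ L / 2 * ‖ys - y‖ ^ 2 := by
  have h1 := (abs_le.1 (h.quad_y x ys y)).1
  rw [h.gy_eq_zero_of_isMax hmax, inner_zero_left, norm_sub_rev] at h1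
  linarith [hmax (h.argmax x)]

theorem gap_nonneg (h : SmoothConcave f gx gy L μ) (x : Vec d₁) (y : Vec d₂) :
    0 ≤ f x (h.argmax x) - f x y := sub_nonneg.2 (h.le_argmax x y)

/-- Strong concavity at y bounds the gap by ‖∇_y f‖ d − μ d²/2, where d is the distance to the
maximiser; completing the square removes d. -/
theorem polyak_lojasiewicz (h : SmoothConcave f gx gy L μ) (x : Vec d₁) (y : Vec d₂) :
    2 * μ * (f x (h.argmax x) - f x y) ≤ ‖gy x y‖ ^ 2 := by
  have h1 := h.conc x (h.argmax x) y
  have h2 := real_inner_le_norm (gy x y) (h.argmax x - y)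
  nlinarith [sq_nonneg (‖gy x y‖ - μ * ‖h.argmax x - y‖), h.pos_μ]

/-- Danskin's theorem with a rate. The lower bound keeps the maximiser at x fixed. For the upper
bound, strong concavity at x' costs ‖∇_y f(x', y*(x))‖² / (2μ), and this gradient is at most L‖x' −
x‖ because it vanishes at x' = x. Lipschitz continuity of the maximiser is not needed. -/
theorem abs_max_sub_le (h : SmoothConcave f gx gy L μ) (x x' : Vec d₁) :
    |f x' (h.argmax x') - f x (h.argmax x) - inner ℝ (gx x (h.argmax x)) (x' - x)|
      ≤ (L / 2 + L ^ 2 / (2 * μ)) * ‖x' - x‖ ^ 2 := by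
  have hμ := h.pos_μ
  have hL := h.pos_L
  have h1 := abs_le.1 (h.quad_x x x' (h.argmax x))
  have h2 := h.le_argmax x' (h.argmax x)
  have h3 := h.conc x' (h.argmax x') (h.argmax x)
  have h4 := real_inner_le_norm (gy x' (h.argmax x)) (h.argmax x' - h.argmax x)
  have h5 := h.lip x' x (h.argmax x) (h.argmax x)
  rw [h.gy_argmax, sub_zero, sub_self, norm_zero] at h5
  have h6 : ‖gy x' (h.argmax x)‖ ^ 2 ≤ L ^ 2 * ‖x' - x‖ ^ 2 := by
    nlinarith [sq_nonneg ‖gx x' (h.argmax x) - gx x (h.argmax x)‖]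
  have h7 : ‖gy x' (h.argmax x)‖ * ‖h.argmax x' - h.argmax x‖
      - μ / 2 * ‖h.argmax x' - h.argmax x‖ ^ 2 ≤ L ^ 2 / (2 * μ) * ‖x' - x‖ ^ 2 := by
    rw [show L ^ 2 / (2 * μ) * ‖x' - x‖ ^ 2 = L ^ 2 * ‖x' - x‖ ^ 2 / (2 * μ) by ring,
      le_div_iff₀ (by positivity)]
    nlinarith [sq_nonneg (‖gy x' (h.argmax x)‖ - μ * ‖h.argmax x' - h.argmax x‖)]
  have h8 : 0 ≤ L ^ 2 / (2 * μ) * ‖x' - x‖ ^ 2 := by positivity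
  rw [abs_le]
  constructor <;> nlinarith

theorem hasGradientAt_max (h : SmoothConcave f gx gy L μ) (x : Vec d₁) :
    HasGradientAt (fun x => ⨆ y, f x y) (gx x (h.argmax x)) x := by
  have : (fun x => ⨆ y, f x y) = fun x => f x (h.argmax x) := funext h.iSup_eq
  rw [this]
  exact hasGradientAt_of_abs_sub_sub_inner_le (h.abs_max_sub_le x)

/-- Lipschitz continuity gives L² times the squared distance to the maximiser, and quadratic growth
bounds that distance by 2/μ times the gap. -/
theorem gx_argmax_sub_sq_le (h : SmoothConcave f gx gy L μ) (x : Vec d₁) (y : Vec d₂) :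
    ‖gx x (h.argmax x) - gx x y‖ ^ 2 ≤ 2 * (L / μ * L) * (f x (h.argmax x) - f x y) := by
  have hμ := h.pos_μ
  have h1 := h.lip x x (h.argmax x) y
  have h2 := h.dist_argmax_le x y
  rw [norm_sub_rev] at h2
  rw [sub_self, norm_zero] at h1
  have h3 : L ^ 2 * ‖h.argmax x - y‖ ^ 2 ≤ 2 * (L / μ * L) * (f x (h.argmax x) - f x y) := by
    rw [show 2 * (L / μ * L) * (f x (h.argmax x) - f x y)
      = L ^ 2 * (2 / μ * (f x (h.argmax x) - f x y)) by ring]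
    gcongr
    rw [show ∀ A : ℝ, 2 / μ * A = 2 * A / μ by intro A; ring, le_div_iff₀ hμ]
    linarith
  nlinarith [sq_nonneg ‖gy x (h.argmax x) - gy x y‖]

/-- Polarising 2⟨∇Φ, v⟩ produces ‖∇Φ‖² and also a spare ‖v‖², of which the curvature of Φ consumes
only a small fraction for such step sizes. -/
theorem max_descent (h : SmoothConcave f gx gy L μ) (hd : 0 < d₂) {η : ℝ} (hη : 0 < η)
    (hηL : L / μ * L * η ≤ 1 / 1000) (x v : Vec d₁) (y : Vec d₂) :
    ‖gx x (h.argmax x)‖ ^ 2 + 99 / 100 * ‖v‖ ^ 2 ≤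
      2 / η * (f x (h.argmax x) - f (x - η • v) (h.argmax (x - η • v)))
      + 4 * (L / μ * L) * (f x (h.argmax x) - f x y) + 2 * ‖gx x y - v‖ ^ 2 := by
  have hμ := h.pos_μ
  have hL := h.pos_L
  have hκ : 1 ≤ L / μ := (one_le_div hμ).2 (h.mu_le hd)
  have h1 := (abs_le.1 (h.abs_max_sub_le x (x - η • v))).2
  rw [sub_sub_cancel_left, inner_neg_right, inner_smul_right, norm_neg, norm_smul,
    Real.norm_of_nonneg hη.le] at h1
  have h2 : 2 * inner ℝ (gx x (h.argmax x)) v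
      = ‖gx x (h.argmax x)‖ ^ 2 + ‖v‖ ^ 2 - ‖gx x (h.argmax x) - v‖ ^ 2 := by
    rw [norm_sub_sq_real]; ring
  have h3 := norm_add_sq_le_two (gx x (h.argmax x) - gx x y) (gx x y - v)
  rw [sub_add_sub_cancel] at h3
  have h4 := h.gx_argmax_sub_sq_le x y
  have h5 : L / 2 + L ^ 2 / (2 * μ) ≤ L / μ * L := by
    have : L ^ 2 / (2 * μ) = L / μ * L / 2 := by field_simp
    nlinarith
  have h6 : (L / 2 + L ^ 2 / (2 * μ)) * (η * ‖v‖) ^ 2 ≤ η * (1 / 1000 * ‖v‖ ^ 2) := by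
    calc _ ≤ (L / μ * L) * (η * ‖v‖) ^ 2 := by gcongr
      _ = η * (L / μ * L * η * ‖v‖ ^ 2) := by ring
      _ ≤ _ := by gcongr
  have h7 : ‖gx x (h.argmax x)‖ ^ 2 + 998 / 1000 * ‖v‖ ^ 2 - ‖gx x (h.argmax x) - v‖ ^ 2 ≤
      2 / η * (f x (h.argmax x) - f (x - η • v) (h.argmax (x - η • v))) := by
    rw [show ∀ A : ℝ, 2 / η * A = 2 * A / η by intro A; ring, le_div_iff₀ hη]
    have h8 : η * (2 * inner ℝ (gx x (h.argmax x)) v) = η * (‖gx x (h.argmax x)‖ ^ 2 + ‖v‖ ^ 2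
      - ‖gx x (h.argmax x) - v‖ ^ 2) := by rw [h2]
    linarith
  linarith [sq_nonneg ‖v‖]

/-- The ascent step at fixed x contracts the gap by 1 − ημ. The move in x then changes Φ and f(·, y
+ ηu) by nearly the same amount, since their gradients differ by a multiple of the square root of
the gap. Half of the contraction is spent on this cross term. -/
theorem gap_step (h : SmoothConcave f gx gy L μ) (hd : 0 < d₂) {η ηx : ℝ} (hη : 0 < η)
    (hηx : 0 < ηx) (hηL : L * η ≤ 1 / 1000) (x v : Vec d₁) (y u : Vec d₂) :
    f (x - ηx • v) (h.argmax (x - ηx • v)) - f (x - ηx • v) (y + η • u) ≤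
      (1 - η * μ / 2) * (f x (h.argmax x) - f x y) + (-(49 / 100 * η * ‖u‖ ^ 2)
      + 501 / 1000 * η * ‖gy x y - u‖ ^ 2
      + 101 / 100 * ((L / μ) ^ 2 * ηx ^ 2 / η) * ‖v‖ ^ 2) := by
  have hμ := h.pos_μ
  have hL := h.pos_L
  have hμL := h.mu_le hd
  have hκ : 1 ≤ L / μ := (one_le_div hμ).2 hμL
  set q := f x (h.argmax x) - f x y with hq
  set q' := f x (h.argmax x) - f x (y + η • u) with hq'
  have hq0 : 0 ≤ q := h.gap_nonneg x y
  have hq0' : 0 ≤ q' := h.gap_nonneg x _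
  have a1 := (abs_le.1 (h.quad_y x y (y + η • u))).1
  rw [add_sub_cancel_left, inner_smul_right, norm_smul, Real.norm_of_nonneg hη.le] at a1
  have a2 : 2 * inner ℝ (gy x y) u = ‖gy x y‖ ^ 2 + ‖u‖ ^ 2 - ‖gy x y - u‖ ^ 2 := by
    rw [norm_sub_sq_real]; ring
  have a3 := h.polyak_lojasiewicz x y
  have a4 : q' ≤ (1 - η * μ) * q - η / 2 * (1 - L * η) * ‖u‖ ^ 2
      + η / 2 * ‖gy x y - u‖ ^ 2 := by
    have e1 : η * inner ℝ (gy x y) u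
        = η / 2 * (‖gy x y‖ ^ 2 + ‖u‖ ^ 2 - ‖gy x y - u‖ ^ 2) := by rw [← a2]; ring
    have e2 : η / 2 * (2 * μ * q) ≤ η / 2 * ‖gy x y‖ ^ 2 := by gcongr
    have e3 : q' = q - (f x (y + η • u) - f x y) := by rw [hq, hq']; ring
    linarith
  have b1 := (abs_le.1 (h.abs_max_sub_le x (x - ηx • v))).2
  have b2 := (abs_le.1 (h.quad_x x (x - ηx • v) (y + η • u))).1
  rw [sub_sub_cancel_left, inner_neg_right, inner_smul_right, norm_neg, norm_smul,
    Real.norm_of_nonneg hηx.le] at b1 b2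
  have b3 := abs_le.1 (abs_real_inner_le_norm (gx x (h.argmax x) - gx x (y + η • u)) v) |>.1
  rw [inner_sub_left] at b3
  have b4 := h.gx_argmax_sub_sq_le x (y + η • u)
  set w := ‖gx x (h.argmax x) - gx x (y + η • u)‖
  have hκμ : L / μ * μ = L := by field_simp
  set κ := L / μ with hκd
  -- The Young weight η/(4κ²) is chosen so that w² ≤ 2κL q' turns into exactly ημ q'/2.
  have b5 : ηx * (w * ‖v‖) ≤ η * μ / 2 * q' + κ ^ 2 * ηx ^ 2 / η * ‖v‖ ^ 2 := by
    have c1 : w ^ 2 * (η / (4 * κ ^ 2)) ≤ η * μ / 2 * q' := by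
      calc w ^ 2 * (η / (4 * κ ^ 2)) ≤ 2 * (κ * L) * q' * (η / (4 * κ ^ 2)) := by gcongr
        _ = η * μ / 2 * q' := by rw [← hκμ]; field_simp; ring
    have c2 : ηx * (w * ‖v‖) ≤ w ^ 2 * (η / (4 * κ ^ 2)) + κ ^ 2 * ηx ^ 2 / η * ‖v‖ ^ 2 := by
      have : w ^ 2 * (η / (4 * κ ^ 2)) + κ ^ 2 * ηx ^ 2 / η * ‖v‖ ^ 2 - ηx * (w * ‖v‖)
          = (w * η - 2 * κ ^ 2 * ηx * ‖v‖) ^ 2 / (4 * κ ^ 2 * η) := by field_simp; ring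
      have : 0 ≤ (w * η - 2 * κ ^ 2 * ηx * ‖v‖) ^ 2 / (4 * κ ^ 2 * η) := by positivity
      linarith
    linarith
  have b6 : (L / 2 + L ^ 2 / (2 * μ)) * (ηx * ‖v‖) ^ 2 + L / 2 * (ηx * ‖v‖) ^ 2
      ≤ 1 / 100 * (κ ^ 2 * ηx ^ 2 / η) * ‖v‖ ^ 2 := by
    have c0 : L ^ 2 / (2 * μ) = κ * L / 2 := by rw [hκd]; field_simp
    have c1 : L + κ * L / 2 ≤ 1 / 100 * (κ ^ 2 / η) := by
      rw [mul_div_assoc', le_div_iff₀ hη]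
      have : κ * (L * η) ≤ κ * (1 / 1000) := by gcongr
      nlinarith
    calc _ = (L + κ * L / 2) * (ηx * ‖v‖) ^ 2 := by rw [c0]; ring
      _ ≤ (1 / 100 * (κ ^ 2 / η)) * (ηx * ‖v‖) ^ 2 := by gcongr
      _ = _ := by ring
  have b7 : f (x - ηx • v) (h.argmax (x - ηx • v)) - f (x - ηx • v) (y + η • u)
      ≤ (1 + η * μ / 2) * q' + 101 / 100 * (κ ^ 2 * ηx ^ 2 / η) * ‖v‖ ^ 2 := by
    have c1 := mul_le_mul_of_nonneg_left b3 hηx.le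
    linarith
  have hημ : η * μ ≤ 1 / 1000 := by
    have := mul_le_mul_of_nonneg_left hμL hη.le
    linarith
  have hημ0 : 0 < η * μ := by positivity
  have d1 : (1 + η * μ / 2) * q' ≤ (1 + η * μ / 2) * ((1 - η * μ) * q
      - η / 2 * (1 - L * η) * ‖u‖ ^ 2 + η / 2 * ‖gy x y - u‖ ^ 2) := by gcongr
  have d2 : (1 + η * μ / 2) * ((1 - η * μ) * q) ≤ (1 - η * μ / 2) * q := by
    have : 0 ≤ (η * μ) ^ 2 * q := by positivity
    linarith
  have d3 : 49 / 100 * η * ‖u‖ ^ 2 ≤ (1 + η * μ / 2) * (η / 2 * (1 - L * η) * ‖u‖ ^ 2) := by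
    have : 49 / 100 * η ≤ (1 + η * μ / 2) * (η / 2 * (1 - L * η)) := by
      have : (1 : ℝ) * (η / 2 * (999 / 1000)) ≤ (1 + η * μ / 2) * (η / 2 * (1 - L * η)) := by
        gcongr
        · linarith
        · linarith
      linarith
    have := mul_le_mul_of_nonneg_right this (sq_nonneg ‖u‖)
    linarith
  have d4 : (1 + η * μ / 2) * (η / 2 * ‖gy x y - u‖ ^ 2) ≤ 501 / 1000 * η * ‖gy x y - u‖ ^ 2 := by
    have : (1 + η * μ / 2) * (η / 2) ≤ 501 / 1000 * η := by
      have := mul_le_mul_of_nonneg_left hημ hη.le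
      linarith
    have := mul_le_mul_of_nonneg_right this (sq_nonneg ‖gy x y - u‖)
    linarith
  linarith

theorem sum_le_of_contraction {q r : ℕ → ℝ} {a : ℝ} (hq : ∀ t, 0 ≤ q t)
    (h : ∀ t, q (t + 1) ≤ (1 - a) * q t + r t) (T : ℕ) :
    a * ∑ t ∈ Finset.range T, q t ≤ q 0 + ∑ t ∈ Finset.range T, r t := by
  have : a * ∑ t ∈ Finset.range T, q t + q T ≤ q 0 + ∑ t ∈ Finset.range T, r t := by
    induction T with
    | zero => simp
    | succ n ih =>
      rw [Finset.sum_range_succ, Finset.sum_range_succ]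
      linarith [h n]
  linarith [hq T]

/-- Gradient descent ascent with inexact gradients. -/
theorem sum_gradient_sq_le (h : SmoothConcave f gx gy L μ) (hd : 0 < d₂) {ηx ηy Δ : ℝ}
    (hηx : 0 < ηx) (hηy : ηy = 10 * (L / μ) ^ 2 * ηx) (hηL : L * ηy ≤ 1 / 1000)
    {x v : ℕ → Vec d₁} {y u : ℕ → Vec d₂} (hx : ∀ t, x (t + 1) = x t - ηx • v t)
    (hy : ∀ t, y (t + 1) = y t + ηy • u t) (T : ℕ)
    (hΔ : f (x 0) (h.argmax (x 0)) - f (x T) (h.argmax (x T)) ≤ Δ) :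
    ∑ t ∈ Finset.range T, ‖gx (x t) (h.argmax (x t))‖ ^ 2
      + 9 / 10 * ∑ t ∈ Finset.range T, ‖v t‖ ^ 2
      + 39 / 10 * (L / μ) ^ 2 * ∑ t ∈ Finset.range T, ‖u t‖ ^ 2 ≤
    2 * Δ / ηx + 8 * (L / μ) ^ 2 * (f (x 0) (h.argmax (x 0)) - f (x 0) (y 0)) / ηy
      + 2 * ∑ t ∈ Finset.range T, ‖gx (x t) (y t) - v t‖ ^ 2
      + 41 / 10 * (L / μ) ^ 2 * ∑ t ∈ Finset.range T, ‖gy (x t) (y t) - u t‖ ^ 2 := by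
  have hμ := h.pos_μ
  have hL := h.pos_L
  have hκ : 1 ≤ L / μ := (one_le_div hμ).2 (h.mu_le hd)
  have hκμ : L / μ * μ = L := by field_simp
  have hηy0 : 0 < ηy := by rw [hηy]; positivity
  have hκη : L / μ * L * ηx ≤ 1 / 1000 := by
    refine le_trans ?_ hηL
    rw [hηy]
    nlinarith [mul_pos hL hηx, mul_nonneg (mul_pos hL hηx).le (sub_nonneg.2 hκ)]
  have h1 : ∑ t ∈ Finset.range T, (‖gx (x t) (h.argmax (x t))‖ ^ 2 + 99 / 100 * ‖v t‖ ^ 2) ≤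
      ∑ t ∈ Finset.range T, (2 / ηx * (f (x t) (h.argmax (x t))
        - f (x (t + 1)) (h.argmax (x (t + 1))))
      + 4 * (L / μ * L) * (f (x t) (h.argmax (x t)) - f (x t) (y t))
      + 2 * ‖gx (x t) (y t) - v t‖ ^ 2) := by
    refine Finset.sum_le_sum fun t _ => ?_
    rw [hx]
    exact h.max_descent hd hηx hκη (x t) (v t) (y t)
  simp only [Finset.sum_add_distrib, ← Finset.mul_sum] at h1
  rw [Finset.sum_range_sub' (fun t => f (x t) (h.argmax (x t)))] at h1
  have h2 := sum_le_of_contraction (q := fun t => f (x t) (h.argmax (x t)) - f (x t) (y t))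
    (a := ηy * μ / 2) (fun t => h.gap_nonneg _ _) (fun t => by
      have := h.gap_step hd hηy0 hηx hηL (x t) (v t) (y t) (u t)
      rw [← hx, ← hy] at this
      exact this) T
  simp only [Finset.sum_add_distrib, ← Finset.mul_sum, Finset.sum_neg_distrib] at h2
  have h3 : 2 / ηx * (f (x 0) (h.argmax (x 0)) - f (x T) (h.argmax (x T))) ≤ 2 * Δ / ηx := by
    rw [div_mul_eq_mul_div]
    gcongr
  set q0 := f (x 0) (h.argmax (x 0)) - f (x 0) (y 0)
  set S := ∑ t ∈ Finset.range T, (f (x t) (h.argmax (x t)) - f (x t) (y t))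
  set V := ∑ t ∈ Finset.range T, ‖v t‖ ^ 2
  set U := ∑ t ∈ Finset.range T, ‖u t‖ ^ 2
  set A := ∑ t ∈ Finset.range T, ‖gy (x t) (y t) - u t‖ ^ 2
  set κ := L / μ
  have hκp : 0 < κ := by positivity
  have hA : 0 ≤ A := Finset.sum_nonneg fun _ _ => by positivity
  have hU : 0 ≤ U := Finset.sum_nonneg fun _ _ => by positivity
  have hV : 0 ≤ V := Finset.sum_nonneg fun _ _ => by positivity
  -- This weight turns the summed gap into 4κL S, exactly the gap term in the descent inequality.
  have h4 := mul_le_mul_of_nonneg_left h2 (a := 8 * κ ^ 2 / ηy) (by positivity)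
  have e1 : 8 * κ ^ 2 / ηy * (ηy * μ / 2 * S) = 4 * (κ * L) * S := by
    rw [← hκμ]; field_simp; ring
  -- With ηy = 10κ²ηx the x-steps cost 0.0808 V, out of the 0.99 V that descent provides.
  have e2 : 8 * κ ^ 2 / ηy * (q0 + (-(49 / 100 * ηy * U) + 501 / 1000 * ηy * A
      + 101 / 100 * (κ ^ 2 * ηx ^ 2 / ηy) * V))
      = 8 * κ ^ 2 * q0 / ηy - 392 / 100 * κ ^ 2 * U + 4008 / 1000 * κ ^ 2 * A
        + 808 / 10000 * V := by
    rw [hηy]; field_simp; ring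
  rw [e1, e2] at h4
  have h5 : 0 ≤ κ ^ 2 * A := by positivity
  have h6 : 0 ≤ κ ^ 2 * U := by positivity
  linarith

end SmoothConcave

end Minimax

/-! ### Averages and deviations over the agents -/

section Average

variable {m d : ℕ}

/-- The average over the agents. -/
noncomputable def avg (a : Fin m → Vec d) : Vec d := (1 / (m : ℝ)) • ∑ i, a i

/-- The mean square over the agents. -/
noncomputable def msq (a : Fin m → Vec d) : ℝ := (1 / (m : ℝ)) * ∑ i, ‖a i‖ ^ 2

/-- The mean square deviation from the average. -/
noncomputable def dev (a : Fin m → Vec d) : ℝ := msq (fun i => a i - avg a)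

theorem msq_nonneg (a : Fin m → Vec d) : 0 ≤ msq a := by unfold msq; positivity

theorem dev_nonneg (a : Fin m → Vec d) : 0 ≤ dev a := msq_nonneg _

theorem avg_add (a b : Fin m → Vec d) : avg (fun i => a i + b i) = avg a + avg b := by
  simp [avg, Finset.sum_add_distrib]

theorem avg_sub (a b : Fin m → Vec d) : avg (fun i => a i - b i) = avg a - avg b := by
  simp [avg, Finset.sum_sub_distrib, smul_sub]

theorem avg_smul (c : ℝ) (a : Fin m → Vec d) : avg (fun i => c • a i) = c • avg a := by
  simp only [avg, ← Finset.smul_sum]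
  rw [smul_comm]

theorem avg_const (hm : 0 < m) (c : Vec d) : avg (fun _ : Fin m => c) = c := by
  have : (m : ℝ) ≠ 0 := by positivity
  simp only [avg, Finset.sum_const, Finset.card_univ, Fintype.card_fin, ← Nat.cast_smul_eq_nsmul ℝ,
    smul_smul]
  rw [one_div_mul_cancel this, one_smul]

theorem norm_avg_sq_le (a : Fin m → Vec d) : ‖avg a‖ ^ 2 ≤ msq a := by
  rcases Nat.eq_zero_or_pos m with rfl | hm
  · simp [avg, msq]
  have h := norm_sum_sq_le Finset.univ a
  rw [Finset.card_univ, Fintype.card_fin] at h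
  rw [avg, msq, norm_smul, mul_pow, Real.norm_of_nonneg (by positivity)]
  calc (1 / (m : ℝ)) ^ 2 * ‖∑ i, a i‖ ^ 2 ≤ (1 / (m : ℝ)) ^ 2 * (m * ∑ i, ‖a i‖ ^ 2) := by gcongr
    _ = _ := by field_simp

theorem msq_smul (c : ℝ) (a : Fin m → Vec d) : msq (fun i => c • a i) = c ^ 2 * msq a := by
  simp only [msq, norm_smul, mul_pow, ← Finset.mul_sum, Real.norm_eq_abs, sq_abs]
  ring

theorem dev_add_norm_avg_sq (hm : 0 < m) (a : Fin m → Vec d) : dev a + ‖avg a‖ ^ 2 = msq a := by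
  have hm' : (m : ℝ) ≠ 0 := by positivity
  have h1 : ∑ i, inner ℝ (a i) (avg a) = m * ‖avg a‖ ^ 2 := by
    rw [← sum_inner, ← real_inner_self_eq_norm_sq]
    have : ∑ i, a i = (m : ℝ) • avg a := by rw [avg, smul_smul, mul_one_div_cancel hm', one_smul]
    rw [this, inner_smul_left]; simp
  simp only [dev, msq, norm_sub_sq_real, Finset.sum_add_distrib, Finset.sum_sub_distrib,
    ← Finset.mul_sum, h1, Finset.sum_const, Finset.card_univ, Fintype.card_fin, nsmul_eq_mul]
  field_simp
  ring

theorem dev_le_msq (hm : 0 < m) (a : Fin m → Vec d) : dev a ≤ msq a := by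
  linarith [dev_add_norm_avg_sq hm a, sq_nonneg ‖avg a‖]

/-- One round of communication. -/
noncomputable def mix (W : Matrix (Fin m) (Fin m) ℝ) (a : Fin m → Vec d) : Fin m → Vec d :=
  fun i => ∑ j, W i j • a j

end Average

/-! ### Consensus and gradient tracking -/

section Mixing

variable {m : ℕ} {W : Matrix (Fin m) (Fin m) ℝ} {lam : ℝ}

theorem IsMixing.lam_nonneg (hW : IsMixing W lam) : 0 ≤ lam := hW.gap ▸ norm_nonneg _

theorem IsMixing.avg_mix {d : ℕ} (hW : IsMixing W lam) (a : Fin m → Vec d) : avg (mix W a) = avg a := by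
  simp only [avg, mix]
  rw [Finset.sum_comm]
  congr 1
  refine Finset.sum_congr rfl fun j _ => ?_
  rw [← Finset.sum_smul, sum_col_of_mem_doublyStochastic hW.stoch, one_smul]

theorem IsMixing.sum_sq_le (hW : IsMixing W lam) (b : Fin m → ℝ) :
    ∑ i, (∑ j, (W i j - 1 / (m : ℝ)) * b j) ^ 2 ≤ lam ^ 2 * ∑ j, b j ^ 2 := by
  have h := (Matrix.toEuclideanCLM (n := Fin m) (𝕜 := ℝ)
    (W - Matrix.of fun _ _ => 1 / (m : ℝ))).le_opNorm (WithLp.toLp 2 b)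
  rw [hW.gap] at h
  have h2 := pow_le_pow_left₀ (norm_nonneg _) h 2
  rw [mul_pow, EuclideanSpace.real_norm_sq_eq, EuclideanSpace.real_norm_sq_eq,
    Matrix.toEuclideanCLM_toLp] at h2
  simpa [Matrix.mulVec, dotProduct] using h2

/-- The matrix W − 𝟏𝟏ᵀ/m annihilates constants, so the deviation after mixing is its image of the
deviation before. The operator norm bound is applied coordinate by coordinate. -/
theorem IsMixing.msq_mix_sub_avg_le (hW : IsMixing W lam) {d : ℕ} (a : Fin m → Vec d) :
    dev (mix W a) ≤ lam ^ 2 * dev a := by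
  rcases Nat.eq_zero_or_pos m with rfl | hm
  · simp [dev, msq]
  have hm' : (m : ℝ) ≠ 0 := by positivity
  have h1 : ∀ i, mix W a i - avg a = ∑ j, (W i j - 1 / (m : ℝ)) • (a j - avg a) := by
    intro i
    have e1 : ∑ j, (W i j - 1 / (m : ℝ)) = 0 := by
      rw [Finset.sum_sub_distrib, sum_row_of_mem_doublyStochastic hW.stoch]
      simp [hm']
    simp only [smul_sub, Finset.sum_sub_distrib, ← Finset.sum_smul, e1, zero_smul, sub_zero]
    simp only [mix, avg, sub_smul, Finset.sum_sub_distrib, Finset.smul_sum]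
  simp only [dev, msq, hW.avg_mix, h1]
  rw [← mul_assoc, mul_comm (lam ^ 2), mul_assoc]
  refine mul_le_mul_of_nonneg_left ?_ (by positivity)
  simp only [EuclideanSpace.real_norm_sq_eq]
  rw [Finset.sum_comm, Finset.sum_comm (s := Finset.univ (α := Fin m)), Finset.mul_sum]
  refine Finset.sum_le_sum fun k _ => ?_
  have := hW.sum_sq_le (fun j => (a j - avg a) k)
  simpa using this

/-- Young's inequality with ratio (1 − λ)/λ: weakening λ² to λ on the old deviation leaves room for
the perturbation at weight 1/(1 − λ). Cleared of denominators it also covers λ = 0. -/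
theorem IsMixing.dev_mix_add_le (hW : IsMixing W lam) {d : ℕ} (a b : Fin m → Vec d) :
    dev (mix W (fun i => a i + b i)) ≤ lam * dev a + 1 / (1 - lam) * dev b := by
  have h0 := hW.lam_nonneg
  have h1 : 0 < 1 - lam := sub_pos.2 hW.lt_one
  refine (hW.msq_mix_sub_avg_le _).trans ?_
  have h : lam * dev a + 1 / (1 - lam) * dev b = 1 / (m : ℝ) * ∑ i,
      (lam * ‖a i - avg a‖ ^ 2 + 1 / (1 - lam) * ‖b i - avg b‖ ^ 2) := by
    simp only [dev, msq, Finset.sum_add_distrib, ← Finset.mul_sum]; ring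
  rw [h, dev, msq, ← mul_assoc, mul_comm (lam ^ 2), mul_assoc, Finset.mul_sum]
  gcongr with i
  rw [avg_add, add_sub_add_comm]
  set p := a i - avg a
  set q := b i - avg b
  have h2 : lam ^ 2 * ‖p + q‖ ^ 2 ≤ lam ^ 2 * (‖p‖ + ‖q‖) ^ 2 := by
    gcongr; exact norm_add_le _ _
  refine h2.trans ?_
  rw [one_div, inv_mul_eq_div, ← sub_le_iff_le_add', le_div_iff₀ h1]
  nlinarith [mul_nonneg h0 (sq_nonneg ((1 - lam) * ‖p‖ - lam * ‖q‖)),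
    mul_nonneg (mul_nonneg h1.le (by linarith : 0 ≤ 1 + lam)) (sq_nonneg ‖q‖)]

/-- Only n sources act on n + 1 states, so the sum of sources stops one index earlier. -/
theorem sum_succ_le_of_contraction {q r : ℕ → ℝ} {c : ℝ} (hc : 0 ≤ c) (hq : ∀ t, 0 ≤ q t)
    (h : ∀ t, q (t + 1) ≤ c * q t + r t) (n : ℕ) :
    (1 - c) * ∑ t ∈ Finset.range (n + 1), q t ≤ q 0 + ∑ t ∈ Finset.range n, r t := by
  have h1 : ∑ t ∈ Finset.range (n + 1), q t ≤
      q 0 + (c * ∑ t ∈ Finset.range n, q t + ∑ t ∈ Finset.range n, r t) := by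
    rw [Finset.sum_range_succ', Finset.mul_sum, ← Finset.sum_add_distrib, add_comm]
    gcongr with t
    exact h t
  have h2 : ∑ t ∈ Finset.range n, q t ≤ ∑ t ∈ Finset.range (n + 1), q t := by
    rw [Finset.sum_range_succ]; linarith [hq n]
  have := mul_le_mul_of_nonneg_left h2 hc
  linarith

/-- Decentralised iteration with gradient tracking of the signals `s`. -/
structure IsTracking (W : Matrix (Fin m) (Fin m) ℝ) (η : ℝ) {d : ℕ}
    (x v s : ℕ → Fin m → Vec d) : Prop where
  init_x : ∃ c, ∀ i, x 0 i = c
  init_v : v 0 = mix W (s 0)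
  step_x : ∀ t, x (t + 1) = mix W (fun j => x t j - η • v t j)
  step_v : ∀ t, v (t + 1) = mix W (fun j => v t j + s (t + 1) j - s t j)

namespace IsTracking

variable {d : ℕ} {η : ℝ} {x v s : ℕ → Fin m → Vec d}

/-- Mixing does not change averages, and the increments of the signal telescope from `v 0`. -/
theorem avg_v (h : IsTracking W η x v s) (hW : IsMixing W lam) (t : ℕ) :
    avg (v t) = avg (s t) := by
  induction t with
  | zero => rw [h.init_v, hW.avg_mix]
  | succ t ih => rw [h.step_v, hW.avg_mix, avg_sub, avg_add, ih, add_sub_cancel_left]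

theorem avg_x (h : IsTracking W η x v s) (hW : IsMixing W lam) (t : ℕ) :
    avg (x (t + 1)) = avg (x t) - η • avg (s t) := by
  rw [h.step_x, hW.avg_mix, avg_sub, avg_smul, h.avg_v hW]

/-- Increments of `s` drive the deviation of `v`, which drives that of `x`. Each stage costs (1 −
λ)⁻² : one factor is the weight of the perturbation, the other comes from summing the contraction.
The common starting point makes the initial deviation of `x` vanish. -/
theorem sum_dev_le (h : IsTracking W η x v s) (hW : IsMixing W lam) (hm : 0 < m) (n : ℕ) :
    ∑ t ∈ Finset.range (n + 1), dev (x t) ≤ η ^ 2 / (1 - lam) ^ 4 *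
      (msq (s 0) + ∑ t ∈ Finset.range n, msq (fun i => s (t + 1) i - s t i)) := by
  have h0 := hW.lam_nonneg
  have h1 : 0 < 1 - lam := sub_pos.2 hW.lt_one
  have hx0 : dev (x 0) = 0 := by
    obtain ⟨c, hc⟩ := h.init_x
    have : x 0 = fun _ => c := funext hc
    simp [dev, this, avg_const hm, msq]
  have hx : ∀ t, dev (x (t + 1)) ≤ lam * dev (x t) + η ^ 2 / (1 - lam) * dev (v t) := by
    intro t
    have := hW.dev_mix_add_le (x t) (fun i => -(η • v t i))
    have e : dev (fun i => -(η • v t i)) = η ^ 2 * dev (v t) := by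
      simp only [dev, ← neg_smul, avg_smul, ← smul_sub]
      rw [msq_smul, neg_sq]
    rw [e] at this
    rw [h.step_x]
    simp only [sub_eq_add_neg (G := Vec d)]
    calc _ ≤ _ := this
      _ = _ := by ring
  have hv : ∀ t, dev (v (t + 1)) ≤ lam * dev (v t)
      + 1 / (1 - lam) * msq (fun i => s (t + 1) i - s t i) := by
    intro t
    rw [h.step_v]
    simp only [add_sub_assoc]
    refine (hW.dev_mix_add_le (v t) (fun i => s (t + 1) i - s t i)).trans ?_
    have := dev_le_msq hm (fun i => s (t + 1) i - s t i)
    gcongr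
  have hv0 : dev (v 0) ≤ msq (s 0) := by
    rw [h.init_v]
    refine (hW.msq_mix_sub_avg_le _).trans ?_
    have h2 := dev_le_msq hm (s 0)
    have h3 := dev_nonneg (s 0)
    have h4 : lam ^ 2 ≤ 1 := pow_le_one₀ h0 hW.lt_one.le
    nlinarith
  have sx := sum_succ_le_of_contraction h0 (fun t => dev_nonneg (x t)) hx n
  have sv := sum_succ_le_of_contraction h0 (fun t => dev_nonneg (v t)) hv n
  rw [← Finset.mul_sum] at sx sv
  have hmono : ∑ t ∈ Finset.range n, dev (v t) ≤ ∑ t ∈ Finset.range (n + 1), dev (v t) := by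
    rw [Finset.sum_range_succ]; linarith [dev_nonneg (v n)]
  set S := ∑ t ∈ Finset.range n, msq (fun i => s (t + 1) i - s t i)
  have hS : 0 ≤ S := Finset.sum_nonneg fun _ _ => msq_nonneg _
  have hs0 := msq_nonneg (s 0)
  have k1 : ∑ t ∈ Finset.range (n + 1), dev (v t) ≤ 1 / (1 - lam) ^ 2 * (msq (s 0) + S) := by
    rw [one_div, inv_mul_eq_div, le_div_iff₀ (by positivity)]
    have : (1 - lam) * ((1 - lam) * ∑ t ∈ Finset.range (n + 1), dev (v t))
        ≤ (1 - lam) * (msq (s 0) + 1 / (1 - lam) * S) := by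
      gcongr; linarith
    have e : (1 - lam) * (msq (s 0) + 1 / (1 - lam) * S) = (1 - lam) * msq (s 0) + S := by
      field_simp
    rw [e] at this
    nlinarith
  have k2 : (1 - lam) * ∑ t ∈ Finset.range (n + 1), dev (x t)
      ≤ η ^ 2 / (1 - lam) * (1 / (1 - lam) ^ 2 * (msq (s 0) + S)) := by
    refine sx.trans ?_
    rw [hx0, zero_add]
    gcongr
    exact hmono.trans k1
  rw [mul_comm, ← le_div_iff₀ h1] at k2
  refine k2.trans (le_of_eq ?_)
  field_simp

/-- The displacement of an agent is the change of its deviation plus the step common to all agents.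
-/
theorem sum_increment_le (h : IsTracking W η x v s) (hW : IsMixing W lam) (hm : 0 < m) (n : ℕ) :
    ∑ t ∈ Finset.range n, msq (fun i => x (t + 1) i - x t i) ≤
      6 * ∑ t ∈ Finset.range (n + 1), dev (x t)
        + 3 * η ^ 2 * ∑ t ∈ Finset.range (n + 1), ‖avg (s t)‖ ^ 2 := by
  have h1 : ∀ t, msq (fun i => x (t + 1) i - x t i) ≤
      3 * dev (x (t + 1)) + 3 * dev (x t) + 3 * η ^ 2 * ‖avg (s t)‖ ^ 2 := by
    intro t
    have e : 3 * dev (x (t + 1)) + 3 * dev (x t) + 3 * η ^ 2 * ‖avg (s t)‖ ^ 2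
        = 1 / (m : ℝ) * ∑ i, 3 * (‖x (t + 1) i - avg (x (t + 1))‖ ^ 2 + ‖x t i - avg (x t)‖ ^ 2
          + ‖η • avg (s t)‖ ^ 2) := by
      have hm' : (m : ℝ) ≠ 0 := by positivity
      simp only [dev, msq, ← Finset.mul_sum, Finset.sum_add_distrib, Finset.sum_const,
        Finset.card_univ, Fintype.card_fin, nsmul_eq_mul, norm_smul, mul_pow, Real.norm_eq_abs,
        sq_abs]
      field_simp
    rw [e, msq]
    gcongr with i
    have e2 : x (t + 1) i - x t i = (x (t + 1) i - avg (x (t + 1))) - (x t i - avg (x t))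
        - η • avg (s t) := by rw [h.avg_x hW t]; abel
    have n1 : ‖x (t + 1) i - x t i‖ ≤ ‖x (t + 1) i - avg (x (t + 1))‖ + ‖x t i - avg (x t)‖
        + ‖η • avg (s t)‖ := by
      rw [e2]
      exact (norm_sub_le _ _).trans (add_le_add_left (norm_sub_le _ _) _)
    have n2 := pow_le_pow_left₀ (norm_nonneg _) n1 2
    set A := ‖x (t + 1) i - avg (x (t + 1))‖
    set B := ‖x t i - avg (x t)‖
    set C := ‖η • avg (s t)‖
    nlinarith [sq_nonneg (A - B), sq_nonneg (A - C), sq_nonneg (B - C)]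
  have h2 := Finset.sum_le_sum fun t (_ : t ∈ Finset.range n) => h1 t
  simp only [Finset.sum_add_distrib, ← Finset.mul_sum] at h2
  have h3 : ∑ t ∈ Finset.range n, dev (x (t + 1)) ≤ ∑ t ∈ Finset.range (n + 1), dev (x t) := by
    rw [Finset.sum_range_succ']; linarith [dev_nonneg (x 0)]
  have h4 : ∑ t ∈ Finset.range n, dev (x t) ≤ ∑ t ∈ Finset.range (n + 1), dev (x t) := by
    rw [Finset.sum_range_succ]; linarith [dev_nonneg (x n)]
  have h5 : ∑ t ∈ Finset.range n, ‖avg (s t)‖ ^ 2 ≤ ∑ t ∈ Finset.range (n + 1), ‖avg (s t)‖ ^ 2 := by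
    rw [Finset.sum_range_succ]; linarith [sq_nonneg ‖avg (s n)‖]
  have h6 := mul_le_mul_of_nonneg_left h5 (by positivity : 0 ≤ 3 * η ^ 2)
  linarith

end IsTracking

end Mixing

/-! ### The global objective inherits smoothness and strong concavity -/

section Objective

variable {m d₁ d₂ : ℕ} {Z : Type*} [MeasurableSpace Z] {Q : Problem m d₁ d₂ Z} {L μ σ : ℝ}

theorem Problem.smoothConcave (hm : 0 < m) (hL : 0 < L) (hμ : 0 < μ) (hW : Q.WellPosed)
    (hS : Q.Smooth L) (hV : Q.BoundedVariance σ) (hC : Q.StronglyConcave μ) :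
    SmoothConcave Q.fbar (fun x y => avg fun i => Q.fgradX i x y)
      (fun x y => avg fun i => Q.fgradY i x y) L μ where
  pos_L := hL
  pos_μ := hμ
  quad_x x x' y := by
    have hm' : (m : ℝ) ≠ 0 := by positivity
    have e : Q.fbar x' y - Q.fbar x y - inner ℝ (avg fun i => Q.fgradX i x y) (x' - x)
        = 1 / (m : ℝ) * ∑ i, (Q.f i x' y - Q.f i x y - inner ℝ (Q.fgradX i x y) (x' - x)) := by
      simp only [Problem.fbar, avg, inner_smul_left, sum_inner, Finset.sum_sub_distrib]
      simp; ring
    rw [e, abs_mul, abs_of_nonneg (by positivity : 0 ≤ 1 / (m : ℝ))]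
    calc 1 / (m : ℝ) * |∑ i, (Q.f i x' y - Q.f i x y - inner ℝ (Q.fgradX i x y) (x' - x))|
        ≤ 1 / (m : ℝ) * ∑ _i : Fin m, L / 2 * ‖x' - x‖ ^ 2 := by
          gcongr
          exact (Finset.abs_sum_le_sum_abs _ _).trans
            (Finset.sum_le_sum fun i _ => Q.abs_f_sub_x_le hW hS hL hV i x x' y)
      _ = _ := by simp; field_simp
  quad_y x y y' := by
    have hm' : (m : ℝ) ≠ 0 := by positivity
    have e : Q.fbar x y' - Q.fbar x y - inner ℝ (avg fun i => Q.fgradY i x y) (y' - y)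
        = 1 / (m : ℝ) * ∑ i, (Q.f i x y' - Q.f i x y - inner ℝ (Q.fgradY i x y) (y' - y)) := by
      simp only [Problem.fbar, avg, inner_smul_left, sum_inner, Finset.sum_sub_distrib]
      simp; ring
    rw [e, abs_mul, abs_of_nonneg (by positivity : 0 ≤ 1 / (m : ℝ))]
    calc 1 / (m : ℝ) * |∑ i, (Q.f i x y' - Q.f i x y - inner ℝ (Q.fgradY i x y) (y' - y))|
        ≤ 1 / (m : ℝ) * ∑ _i : Fin m, L / 2 * ‖y' - y‖ ^ 2 := by
          gcongr
          exact (Finset.abs_sum_le_sum_abs _ _).trans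
            (Finset.sum_le_sum fun i _ => Q.abs_f_sub_y_le hW hS hL hV i x y y')
      _ = _ := by simp; field_simp
  lip x x' y y' := by
    have hm' : (m : ℝ) ≠ 0 := by positivity
    rw [← avg_sub, ← avg_sub]
    refine (add_le_add (norm_avg_sq_le _) (norm_avg_sq_le _)).trans ?_
    rw [msq, msq, ← mul_add, ← Finset.sum_add_distrib]
    calc _ ≤ 1 / (m : ℝ) * ∑ _i : Fin m, L ^ 2 * (‖x - x'‖ ^ 2 + ‖y - y'‖ ^ 2) := by
          gcongr with i
          exact Q.fgrad_lip hW hS hV i x x' y y'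
      _ = _ := by simp; field_simp
  conc x y y' := by
    have hm' : (m : ℝ) ≠ 0 := by positivity
    have e : Q.fbar x y' + inner ℝ (avg fun i => Q.fgradY i x y') (y - y') - μ / 2 * ‖y - y'‖ ^ 2
        = 1 / (m : ℝ) * ∑ i, (Q.f i x y' + inner ℝ (Q.fgradY i x y') (y - y')
          - μ / 2 * ‖y - y'‖ ^ 2) := by
      simp only [Problem.fbar, avg, inner_smul_left, sum_inner, Finset.sum_sub_distrib,
        Finset.sum_add_distrib]
      simp; field_simp
    rw [e, Problem.fbar]
    gcongr with i
    exact hC i x y y'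

end Objective

/-! ### Estimates along a single run -/

section Path

variable {m d₁ d₂ : ℕ} {Z : Type*} [MeasurableSpace Z] (Q : Problem m d₁ d₂ Z)
  (A : Params m d₁ d₂)

/-- Error of the estimator of `∇ₓ f_i`. -/
noncomputable def errX (s : State m d₁ d₂) (i : Fin m) : Vec d₁ :=
  s.g i - Q.fgradX i (s.x i) (s.y i)

/-- Error of the estimator of `∇_y f_i`. -/
noncomputable def errY (s : State m d₁ d₂) (i : Fin m) : Vec d₂ :=
  s.h i - Q.fgradY i (s.x i) (s.y i)

/-- Sampling error of a mini-batch gradient in `x` at the iterates of `s`. -/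
noncomputable def resX (n : ℕ) (z : Fin m → ℕ → Z) (s : State m d₁ d₂) (i : Fin m) : Vec d₁ :=
  batchX Q n (z i) i (s.x i) (s.y i) - Q.fgradX i (s.x i) (s.y i)

/-- Sampling error of a mini-batch gradient in `y` at the iterates of `s`. -/
noncomputable def resY (n : ℕ) (z : Fin m → ℕ → Z) (s : State m d₁ d₂) (i : Fin m) : Vec d₂ :=
  batchY Q n (z i) i (s.x i) (s.y i) - Q.fgradY i (s.x i) (s.y i)

/-- Mean square displacement of the iterates. -/
noncomputable def moveSq (s s' : State m d₁ d₂) : ℝ :=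
  msq (fun i => s'.x i - s.x i) + msq (fun i => s'.y i - s.y i)

/-- The increment of the recursion of `errX`. -/
noncomputable def innovX (z : Fin m → ℕ → Z) (s s' : State m d₁ d₂) (i : Fin m) : Vec d₁ :=
  resX Q A.b z s' i - (1 - A.βx) • resX Q A.b z s i

/-- The increment of the recursion of `errY`. -/
noncomputable def innovY (z : Fin m → ℕ → Z) (s s' : State m d₁ d₂) (i : Fin m) : Vec d₂ :=
  resY Q A.b z s' i - (1 - A.βy) • resY Q A.b z s i

variable {Q A}

/-- The same fresh batch is used at the old and the new iterate. Hence the old error is damped by 1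
− β and only sampling errors of that batch are added. -/
theorem errX_next (z : Fin m → ℕ → Z) (nx : Fin m → Vec d₁) (ny : Fin m → Vec d₂)
    (s : State m d₁ d₂) (i : Fin m) :
    errX Q (nextState Q A z nx ny s) i = (1 - A.βx) • errX Q s i
      + innovX Q A z s (nextState Q A z nx ny s) i := by
  simp only [errX, innovX, resX, nextState]
  module

theorem errY_next (z : Fin m → ℕ → Z) (nx : Fin m → Vec d₁) (ny : Fin m → Vec d₂)
    (s : State m d₁ d₂) (i : Fin m) :
    errY Q (nextState Q A z nx ny s) i = (1 - A.βy) • errY Q s i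
      + innovY Q A z s (nextState Q A z nx ny s) i := by
  simp only [errY, innovY, resY, nextState]
  module

theorem norm_batch_average_sq_le {d : ℕ} (n : ℕ) (a : ℕ → Vec d) :
    ‖(1 / (n : ℝ)) • ∑ k ∈ Finset.range n, a k‖ ^ 2 ≤
      (1 / (n : ℝ)) * ∑ k ∈ Finset.range n, ‖a k‖ ^ 2 := by
  rcases Nat.eq_zero_or_pos n with rfl | hn
  · simp
  have h := norm_sum_sq_le (Finset.range n) a
  rw [Finset.card_range] at h
  rw [norm_smul, mul_pow, Real.norm_of_nonneg (by positivity)]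
  calc (1 / (n : ℝ)) ^ 2 * ‖∑ k ∈ Finset.range n, a k‖ ^ 2
      ≤ (1 / (n : ℝ)) ^ 2 * (n * ∑ k ∈ Finset.range n, ‖a k‖ ^ 2) := by gcongr
    _ = _ := by field_simp

variable {L μ σ : ℝ}

theorem batch_lip (hS : Q.Smooth L) {n : ℕ} (hn : 1 ≤ n) (z : ℕ → Z) (i : Fin m)
    (x x' : Vec d₁) (y y' : Vec d₂) :
    ‖batchX Q n z i x y - batchX Q n z i x' y'‖ ^ 2
      + ‖batchY Q n z i x y - batchY Q n z i x' y'‖ ^ 2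
      ≤ L ^ 2 * (‖x - x'‖ ^ 2 + ‖y - y'‖ ^ 2) := by
  have hn' : (n : ℝ) ≠ 0 := by positivity
  simp only [batchX, batchY, ← smul_sub, ← Finset.sum_sub_distrib]
  refine (add_le_add (norm_batch_average_sq_le _ _) (norm_batch_average_sq_le _ _)).trans ?_
  rw [← mul_add, ← Finset.sum_add_distrib]
  calc _ ≤ 1 / (n : ℝ) * ∑ _k ∈ Finset.range n, L ^ 2 * (‖x - x'‖ ^ 2 + ‖y - y'‖ ^ 2) := by
        gcongr
        exact hS.lip _ _ _ _ _ _
    _ = _ := by simp; field_simp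

/-- Regrouped as (a − b) − (c − e) + β(b − e): two differences between nearby points, small by
Lipschitz continuity, and a full sampling error that carries the factor β. -/
theorem norm_innovation_sq_le {d : ℕ} (a b c e : Vec d) (β : ℝ) :
    ‖(a - c) - (1 - β) • (b - e)‖ ^ 2 ≤
      3 * ‖a - b‖ ^ 2 + 3 * ‖c - e‖ ^ 2 + 3 * (β ^ 2 * ‖b - e‖ ^ 2) := by
  have e1 : (a - c) - (1 - β) • (b - e) = (a - b) - (c - e) + β • (b - e) := by module
  have n1 : ‖(a - c) - (1 - β) • (b - e)‖ ≤ ‖a - b‖ + ‖c - e‖ + ‖β • (b - e)‖ := by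
    rw [e1]
    exact (norm_add_le _ _).trans (add_le_add_left (norm_sub_le _ _) _)
  have n2 := pow_le_pow_left₀ (norm_nonneg _) n1 2
  have n3 : ‖β • (b - e)‖ ^ 2 = β ^ 2 * ‖b - e‖ ^ 2 := by
    rw [norm_smul, mul_pow, Real.norm_eq_abs, sq_abs]
  rw [← n3]
  nlinarith [sq_nonneg (‖a - b‖ - ‖c - e‖), sq_nonneg (‖a - b‖ - ‖β • (b - e)‖),
    sq_nonneg (‖c - e‖ - ‖β • (b - e)‖)]

theorem msq_innovX_le (hW : Q.WellPosed) (hS : Q.Smooth L) (hV : Q.BoundedVariance σ)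
    (hb : 1 ≤ A.b) (z : Fin m → ℕ → Z) (s s' : State m d₁ d₂) :
    msq (innovX Q A z s s') ≤
      6 * L ^ 2 * moveSq s s' + 3 * A.βx ^ 2 * msq (resX Q A.b z s) := by
  have e : 6 * L ^ 2 * moveSq s s' + 3 * A.βx ^ 2 * msq (resX Q A.b z s) = 1 / (m : ℝ) *
      ∑ i, (6 * (L ^ 2 * (‖s'.x i - s.x i‖ ^ 2 + ‖s'.y i - s.y i‖ ^ 2))
        + 3 * (A.βx ^ 2 * ‖resX Q A.b z s i‖ ^ 2)) := by
    simp only [moveSq, msq, ← Finset.mul_sum, Finset.sum_add_distrib]; ring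
  rw [e, msq]
  gcongr with i
  have h1 := norm_innovation_sq_le (batchX Q A.b (z i) i (s'.x i) (s'.y i))
    (batchX Q A.b (z i) i (s.x i) (s.y i)) (Q.fgradX i (s'.x i) (s'.y i))
    (Q.fgradX i (s.x i) (s.y i)) A.βx
  have h2 := batch_lip hS hb (z i) i (s'.x i) (s.x i) (s'.y i) (s.y i)
  have h3 := Q.fgrad_lip hW hS hV i (s'.x i) (s.x i) (s'.y i) (s.y i)
  simp only [innovX, resX]
  linarith [sq_nonneg ‖batchY Q A.b (z i) i (s'.x i) (s'.y i)
      - batchY Q A.b (z i) i (s.x i) (s.y i)‖,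
    sq_nonneg ‖Q.fgradY i (s'.x i) (s'.y i) - Q.fgradY i (s.x i) (s.y i)‖]

theorem msq_innovY_le (hW : Q.WellPosed) (hS : Q.Smooth L) (hV : Q.BoundedVariance σ)
    (hb : 1 ≤ A.b) (z : Fin m → ℕ → Z) (s s' : State m d₁ d₂) :
    msq (innovY Q A z s s') ≤
      6 * L ^ 2 * moveSq s s' + 3 * A.βy ^ 2 * msq (resY Q A.b z s) := by
  have e : 6 * L ^ 2 * moveSq s s' + 3 * A.βy ^ 2 * msq (resY Q A.b z s) = 1 / (m : ℝ) *
      ∑ i, (6 * (L ^ 2 * (‖s'.x i - s.x i‖ ^ 2 + ‖s'.y i - s.y i‖ ^ 2))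
        + 3 * (A.βy ^ 2 * ‖resY Q A.b z s i‖ ^ 2)) := by
    simp only [moveSq, msq, ← Finset.mul_sum, Finset.sum_add_distrib]; ring
  rw [e, msq]
  gcongr with i
  have h1 := norm_innovation_sq_le (batchY Q A.b (z i) i (s'.x i) (s'.y i))
    (batchY Q A.b (z i) i (s.x i) (s.y i)) (Q.fgradY i (s'.x i) (s'.y i))
    (Q.fgradY i (s.x i) (s.y i)) A.βy
  have h2 := batch_lip hS hb (z i) i (s'.x i) (s.x i) (s'.y i) (s.y i)
  have h3 := Q.fgrad_lip hW hS hV i (s'.x i) (s.x i) (s'.y i) (s.y i)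
  simp only [innovY, resY]
  linarith [sq_nonneg ‖batchX Q A.b (z i) i (s'.x i) (s'.y i)
      - batchX Q A.b (z i) i (s.x i) (s.y i)‖,
    sq_nonneg ‖Q.fgradX i (s'.x i) (s'.y i) - Q.fgradX i (s.x i) (s.y i)‖]

variable (z : ℕ → Fin m → ℕ → Z) (nx : ℕ → Fin m → Vec d₁) (ny : ℕ → Fin m → Vec d₂)

theorem run_gs (t : ℕ) (i : Fin m) :
    (run Q A z nx ny t).gs i = (run Q A z nx ny t).g i + nx t i := by
  cases t <;> rfl

theorem run_hs (t : ℕ) (i : Fin m) :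
    (run Q A z nx ny t).hs i = (run Q A z nx ny t).h i + ny t i := by
  cases t <;> rfl

theorem isTracking_x : IsTracking A.W A.ηx (fun t => (run Q A z nx ny t).x)
    (fun t => (run Q A z nx ny t).v) (fun t => (run Q A z nx ny t).gs) where
  init_x := ⟨A.x₀, fun _ => rfl⟩
  init_v := rfl
  step_x _ := rfl
  step_v _ := rfl

/-- Ascent is descent with a negative step, and the tracking bounds involve only the square of the
step. -/
theorem isTracking_y : IsTracking A.W (-A.ηy) (fun t => (run Q A z nx ny t).y)
    (fun t => (run Q A z nx ny t).u) (fun t => (run Q A z nx ny t).hs) where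
  init_x := ⟨A.y₀, fun _ => rfl⟩
  init_v := rfl
  step_x t := by
    simp only [neg_smul, sub_neg_eq_add]
    rfl
  step_v _ := rfl

theorem norm_add_five_sq_le {d : ℕ} (a b c e f : Vec d) :
    ‖a + b + c + e + f‖ ^ 2 ≤ 5 * (‖a‖ ^ 2 + ‖b‖ ^ 2 + ‖c‖ ^ 2 + ‖e‖ ^ 2 + ‖f‖ ^ 2) := by
  have := norm_sum_sq_le Finset.univ ![a, b, c, e, f]
  simpa [Fin.sum_univ_five] using this

/-- The increment of a perturbed estimator splits into the change of the batch gradient, β times the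
estimator error, β times the sampling error, and the two noises. -/
theorem norm_estimator_increment_sq_le {d : ℕ} (g fg b b' n n' : Vec d) (β : ℝ) :
    ‖((1 - β) • (g - b) + b' + n') - (g + n)‖ ^ 2 ≤
      5 * (‖b' - b‖ ^ 2 + β ^ 2 * ‖g - fg‖ ^ 2 + β ^ 2 * ‖b - fg‖ ^ 2 + ‖n'‖ ^ 2 + ‖n‖ ^ 2) := by
  have e : ((1 - β) • (g - b) + b' + n') - (g + n)
      = (b' - b) + (-β) • (g - fg) + β • (b - fg) + n' + (-n) := by module
  rw [e]
  refine (norm_add_five_sq_le _ _ _ _ _).trans (le_of_eq ?_)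
  simp only [norm_smul, mul_pow, norm_neg, Real.norm_eq_abs, sq_abs]

/-- Mean square of the noise of an iteration. -/
noncomputable def noiseSq (nx : Fin m → Vec d₁) (ny : Fin m → Vec d₂) : ℝ := msq nx + msq ny

theorem msq_increment_le (hS : Q.Smooth L) (hb : 1 ≤ A.b) (t : ℕ) :
    msq (fun i => (run Q A z nx ny (t + 1)).gs i - (run Q A z nx ny t).gs i)
      + msq (fun i => (run Q A z nx ny (t + 1)).hs i - (run Q A z nx ny t).hs i) ≤
    5 * (L ^ 2 * moveSq (run Q A z nx ny t) (run Q A z nx ny (t + 1))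
      + A.βx ^ 2 * (msq (errX Q (run Q A z nx ny t))
        + msq (resX Q A.b (z (t + 1)) (run Q A z nx ny t)))
      + A.βy ^ 2 * (msq (errY Q (run Q A z nx ny t))
        + msq (resY Q A.b (z (t + 1)) (run Q A z nx ny t)))
      + (noiseSq (nx (t + 1)) (ny (t + 1)) + noiseSq (nx t) (ny t))) := by
  set s := run Q A z nx ny t with hs
  set s' := run Q A z nx ny (t + 1) with hs'
  have e : 5 * (L ^ 2 * moveSq s s'
      + A.βx ^ 2 * (msq (errX Q s) + msq (resX Q A.b (z (t + 1)) s))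
      + A.βy ^ 2 * (msq (errY Q s) + msq (resY Q A.b (z (t + 1)) s))
      + (noiseSq (nx (t + 1)) (ny (t + 1)) + noiseSq (nx t) (ny t))) = 1 / (m : ℝ) *
      ∑ i, 5 * (L ^ 2 * (‖s'.x i - s.x i‖ ^ 2 + ‖s'.y i - s.y i‖ ^ 2)
        + A.βx ^ 2 * (‖errX Q s i‖ ^ 2 + ‖resX Q A.b (z (t + 1)) s i‖ ^ 2)
        + A.βy ^ 2 * (‖errY Q s i‖ ^ 2 + ‖resY Q A.b (z (t + 1)) s i‖ ^ 2)
        + (‖nx (t + 1) i‖ ^ 2 + ‖ny (t + 1) i‖ ^ 2 + (‖nx t i‖ ^ 2 + ‖ny t i‖ ^ 2))) := by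
    simp only [moveSq, noiseSq, msq, ← Finset.mul_sum, Finset.sum_add_distrib]; ring
  rw [e, msq, msq, ← mul_add, ← Finset.sum_add_distrib]
  gcongr with i
  have h1 := norm_estimator_increment_sq_le (s.g i) (Q.fgradX i (s.x i) (s.y i))
    (batchX Q A.b (z (t + 1) i) i (s.x i) (s.y i))
    (batchX Q A.b (z (t + 1) i) i (s'.x i) (s'.y i)) (nx t i) (nx (t + 1) i) A.βx
  have h2 := norm_estimator_increment_sq_le (s.h i) (Q.fgradY i (s.x i) (s.y i))
    (batchY Q A.b (z (t + 1) i) i (s.x i) (s.y i))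
    (batchY Q A.b (z (t + 1) i) i (s'.x i) (s'.y i)) (ny t i) (ny (t + 1) i) A.βy
  have h3 := batch_lip hS hb (z (t + 1) i) i (s'.x i) (s.x i) (s'.y i) (s.y i)
  have e1 : s'.gs i = (1 - A.βx) • (s.g i - batchX Q A.b (z (t + 1) i) i (s.x i) (s.y i))
    + batchX Q A.b (z (t + 1) i) i (s'.x i) (s'.y i) + nx (t + 1) i := rfl
  have e2 : s'.hs i = (1 - A.βy) • (s.h i - batchY Q A.b (z (t + 1) i) i (s.x i) (s.y i))
    + batchY Q A.b (z (t + 1) i) i (s'.x i) (s'.y i) + ny (t + 1) i := rfl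
  rw [e1, e2, hs, run_gs, run_hs, ← hs]
  simp only [errX, errY, resX, resY]
  linarith

/-- Disagreement and noise are relaxed to mean squares, but the estimator error is kept as the
square of an average, so that its gain 1/m survives. -/
theorem norm_sub_estimator_sq_le {d : ℕ} (f' f n g : Fin m → Vec d) :
    ‖avg f' - avg (fun i => g i + n i)‖ ^ 2 ≤
      3 * (msq (fun i => f' i - f i) + ‖avg fun i => g i - f i‖ ^ 2 + msq n) := by
  have e : avg f' - avg (fun i => g i + n i)
      = avg (fun i => f' i - f i) - avg (fun i => g i - f i) - avg n := by
    rw [avg_add, avg_sub, avg_sub]; abel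
  have n1 : ‖avg f' - avg (fun i => g i + n i)‖
      ≤ ‖avg (fun i => f' i - f i)‖ + ‖avg (fun i => g i - f i)‖ + ‖avg n‖ := by
    rw [e]
    exact (norm_sub_le _ _).trans (add_le_add_left (norm_sub_le _ _) _)
  have n2 := pow_le_pow_left₀ (norm_nonneg _) n1 2
  have n3 := norm_avg_sq_le (fun i => f' i - f i)
  have n4 := norm_avg_sq_le n
  set a := ‖avg (fun i => f' i - f i)‖
  set b := ‖avg (fun i => g i - f i)‖
  set c := ‖avg n‖
  nlinarith [sq_nonneg (a - b), sq_nonneg (a - c), sq_nonneg (b - c)]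

theorem sum_gradient_sq_le_of_run (hm : 0 < m) (hd : 0 < d₂) (hL : 0 < L) (hμ : 0 < μ)
    (hW : Q.WellPosed) (hS : Q.Smooth L) (hV : Q.BoundedVariance σ) (hC : Q.StronglyConcave μ)
    {lam : ℝ} (hmix : IsMixing A.W lam) (hηx : 0 < A.ηx)
    (hηy : A.ηy = 10 * (L / μ) ^ 2 * A.ηx) (hηL : L * A.ηy ≤ 1 / 1000)
    (hbdd : BddBelow (Set.range Q.Phi)) {Δ : ℝ} (hΔ : Q.Phi A.x₀ - ⨅ x, Q.Phi x ≤ Δ)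
    {ystar : Vec d₂} (hys : IsMaxOn (Q.fbar A.x₀) Set.univ ystar) {δ₀ : ℝ}
    (hδ : ‖ystar - A.y₀‖ ^ 2 ≤ δ₀) (T : ℕ) :
    ∑ t ∈ Finset.range T, ‖gradient Q.Phi (xbar Q A z nx ny t)‖ ^ 2
      + 9 / 10 * ∑ t ∈ Finset.range T, ‖avg (run Q A z nx ny t).gs‖ ^ 2
      + 39 / 10 * (L / μ) ^ 2 * ∑ t ∈ Finset.range T, ‖avg (run Q A z nx ny t).hs‖ ^ 2 ≤
    2 * Δ / A.ηx + 8 * (L / μ) ^ 2 * (L / 2 * δ₀) / A.ηy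
      + 123 / 10 * (L / μ) ^ 2 *
        (L ^ 2 * (∑ t ∈ Finset.range T, dev (run Q A z nx ny t).x
          + ∑ t ∈ Finset.range T, dev (run Q A z nx ny t).y)
        + (∑ t ∈ Finset.range T, ‖avg (errX Q (run Q A z nx ny t))‖ ^ 2
          + ∑ t ∈ Finset.range T, ‖avg (errY Q (run Q A z nx ny t))‖ ^ 2)
        + ∑ t ∈ Finset.range T, noiseSq (nx t) (ny t)) := by
  have h := Q.smoothConcave hm hL hμ hW hS hV hC
  have hκ : 1 ≤ L / μ := (one_le_div hμ).2 (h.mu_le hd)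
  have hκ2 : 1 ≤ (L / μ) ^ 2 := one_le_pow₀ hκ
  have hηy0 : 0 < A.ηy := by rw [hηy]; positivity
  have hPhi : ∀ x, Q.Phi x = Q.fbar x (h.argmax x) := h.iSup_eq
  set s := run Q A z nx ny
  have key := h.sum_gradient_sq_le hd hηx hηy hηL (Δ := Δ) (x := fun t => avg (s t).x)
    (y := fun t => avg (s t).y) (v := fun t => avg (s t).gs) (u := fun t => avg (s t).hs)
    (fun t => (isTracking_x z nx ny).avg_x hmix t)
    (fun t => by
      have := (isTracking_y (Q := Q) (A := A) z nx ny).avg_x hmix t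
      rwa [neg_smul, sub_neg_eq_add] at this) T
    (by
      rw [← hPhi, ← hPhi]
      have e0 : avg (s 0).x = A.x₀ := avg_const hm A.x₀
      rw [e0]
      linarith [ciInf_le hbdd (avg (s T).x)])
  have hgrad : ∀ x, gradient Q.Phi x = avg fun i => Q.fgradX i x (h.argmax x) :=
    fun x => (h.hasGradientAt_max x).gradient
  have e1 : ∀ t, gradient Q.Phi (xbar Q A z nx ny t)
      = avg fun i => Q.fgradX i (avg (s t).x) (h.argmax (avg (s t).x)) := fun t => hgrad _
  simp only [e1]
  have hq0 : Q.fbar (avg (s 0).x) (h.argmax (avg (s 0).x)) - Q.fbar (avg (s 0).x) (avg (s 0).y)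
      ≤ L / 2 * δ₀ := by
    have e0 : avg (s 0).x = A.x₀ := avg_const hm A.x₀
    have e0' : avg (s 0).y = A.y₀ := avg_const hm A.y₀
    rw [e0, e0']
    refine (h.gap_le_of_isMax (fun y => hys (Set.mem_univ y)) A.y₀).trans ?_
    gcongr
  have hq1 : 8 * (L / μ) ^ 2 * (Q.fbar (avg (s 0).x) (h.argmax (avg (s 0).x))
      - Q.fbar (avg (s 0).x) (avg (s 0).y)) / A.ηy ≤ 8 * (L / μ) ^ 2 * (L / 2 * δ₀) / A.ηy := by
    gcongr
  have hxy : ∀ t, 2 * ‖(avg fun i => Q.fgradX i (avg (s t).x) (avg (s t).y)) - avg (s t).gs‖ ^ 2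
      + 41 / 10 * (L / μ) ^ 2
        * ‖(avg fun i => Q.fgradY i (avg (s t).x) (avg (s t).y)) - avg (s t).hs‖ ^ 2
      ≤ 123 / 10 * (L / μ) ^ 2 * (L ^ 2 * (dev (s t).x + dev (s t).y)
        + (‖avg (errX Q (s t))‖ ^ 2 + ‖avg (errY Q (s t))‖ ^ 2) + noiseSq (nx t) (ny t)) := by
    intro t
    have b1 := norm_sub_estimator_sq_le (fun i => Q.fgradX i (avg (s t).x) (avg (s t).y))
      (fun i => Q.fgradX i ((s t).x i) ((s t).y i)) (nx t) (s t).g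
    have b2 := norm_sub_estimator_sq_le (fun i => Q.fgradY i (avg (s t).x) (avg (s t).y))
      (fun i => Q.fgradY i ((s t).x i) ((s t).y i)) (ny t) (s t).h
    have eg : (fun i => (s t).g i + nx t i) = (s t).gs := funext fun i => (run_gs z nx ny t i).symm
    have eh : (fun i => (s t).h i + ny t i) = (s t).hs := funext fun i => (run_hs z nx ny t i).symm
    rw [eg] at b1
    rw [eh] at b2
    have b3 : msq (fun i => Q.fgradX i (avg (s t).x) (avg (s t).y)
          - Q.fgradX i ((s t).x i) ((s t).y i))
        + msq (fun i => Q.fgradY i (avg (s t).x) (avg (s t).y)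
          - Q.fgradY i ((s t).x i) ((s t).y i)) ≤ L ^ 2 * (dev (s t).x + dev (s t).y) := by
      have e2 : L ^ 2 * (dev (s t).x + dev (s t).y) = 1 / (m : ℝ) * ∑ i, L ^ 2 *
          (‖(s t).x i - avg (s t).x‖ ^ 2 + ‖(s t).y i - avg (s t).y‖ ^ 2) := by
        simp only [dev, msq, ← Finset.mul_sum, Finset.sum_add_distrib]; ring
      rw [e2, msq, msq, ← mul_add, ← Finset.sum_add_distrib]
      gcongr with i
      have := Q.fgrad_lip hW hS hV i (avg (s t).x) ((s t).x i) (avg (s t).y) ((s t).y i)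
      rwa [norm_sub_rev (avg (s t).x), norm_sub_rev (avg (s t).y)] at this
    set X := ‖(avg fun i => Q.fgradX i (avg (s t).x) (avg (s t).y)) - avg (s t).gs‖ ^ 2
    set Y := ‖(avg fun i => Q.fgradY i (avg (s t).x) (avg (s t).y)) - avg (s t).hs‖ ^ 2
    -- The x-error is raised to the weight of the y-error, since the Lipschitz bound controls only
    -- their sum.
    have b4 : 2 * X ≤ 41 / 10 * (L / μ) ^ 2 * X := by
      have : 0 ≤ X := by positivity
      nlinarith
    have b5 : X + Y ≤ 3 * (L ^ 2 * (dev (s t).x + dev (s t).y)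
        + (‖avg (errX Q (s t))‖ ^ 2 + ‖avg (errY Q (s t))‖ ^ 2) + noiseSq (nx t) (ny t)) := by
      change X ≤ 3 * (_ + ‖avg (errX Q (s t))‖ ^ 2 + _) at b1
      change Y ≤ 3 * (_ + ‖avg (errY Q (s t))‖ ^ 2 + _) at b2
      rw [noiseSq]
      linarith
    have b6 := mul_le_mul_of_nonneg_left b5 (by positivity : 0 ≤ 41 / 10 * (L / μ) ^ 2)
    linarith
  have hsum := Finset.sum_le_sum fun t (_ : t ∈ Finset.range T) => hxy t
  simp only [Finset.sum_add_distrib, ← Finset.mul_sum] at hsum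
  linarith

end Path

/-! ### Measurability of the run -/

section Measurability

variable {m d₁ d₂ : ℕ} {Z : Type*} [MeasurableSpace Z] {Q : Problem m d₁ d₂ Z}
  {A : Params m d₁ d₂} {L μ σ : ℝ}

theorem Problem.continuous_fgradX (hL : 0 < L) (hW : Q.WellPosed) (hS : Q.Smooth L)
    (hV : Q.BoundedVariance σ) (i : Fin m) :
    Continuous fun p : Vec d₁ × Vec d₂ => Q.fgradX i p.1 p.2 := by
  refine continuous_of_norm_sub_le hL fun p q => ?_
  have h := Q.fgrad_lip hW hS hV i p.1 q.1 p.2 q.2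
  have h0 := mul_nonneg (norm_nonneg (p.1 - q.1)) (norm_nonneg (p.2 - q.2))
  refine abs_le_of_sq_le_sq' ?_ (by positivity) |>.2
  nlinarith [sq_nonneg ‖Q.fgradY i p.1 p.2 - Q.fgradY i q.1 q.2‖, mul_nonneg (sq_nonneg L) h0]

theorem Problem.continuous_fgradY (hL : 0 < L) (hW : Q.WellPosed) (hS : Q.Smooth L)
    (hV : Q.BoundedVariance σ) (i : Fin m) :
    Continuous fun p : Vec d₁ × Vec d₂ => Q.fgradY i p.1 p.2 := by
  refine continuous_of_norm_sub_le hL fun p q => ?_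
  have h := Q.fgrad_lip hW hS hV i p.1 q.1 p.2 q.2
  have h0 := mul_nonneg (norm_nonneg (p.1 - q.1)) (norm_nonneg (p.2 - q.2))
  refine abs_le_of_sq_le_sq' ?_ (by positivity) |>.2
  nlinarith [sq_nonneg ‖Q.fgradX i p.1 p.2 - Q.fgradX i q.1 q.2‖, mul_nonneg (sq_nonneg L) h0]

/-- All components of a random state are measurable. -/
structure MeasState {Ω : Type*} (mΩ : MeasurableSpace Ω) (S : Ω → State m d₁ d₂) : Prop where
  x : ∀ i, Measurable[mΩ] fun ω => (S ω).x i
  y : ∀ i, Measurable[mΩ] fun ω => (S ω).y i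
  g : ∀ i, Measurable[mΩ] fun ω => (S ω).g i
  h : ∀ i, Measurable[mΩ] fun ω => (S ω).h i
  gs : ∀ i, Measurable[mΩ] fun ω => (S ω).gs i
  hs : ∀ i, Measurable[mΩ] fun ω => (S ω).hs i
  v : ∀ i, Measurable[mΩ] fun ω => (S ω).v i
  u : ∀ i, Measurable[mΩ] fun ω => (S ω).u i

variable {Ω : Type*}

theorem measurable_batchX [mΩ : MeasurableSpace Ω] (hL : 0 < L) (hW : Q.WellPosed)
    (hS : Q.Smooth L) (n : ℕ) {z : ℕ → Ω → Z} {x : Ω → Vec d₁} {y : Ω → Vec d₂} (i : Fin m)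
    (hz : ∀ k, Measurable (z k)) (hx : Measurable x) (hy : Measurable y) :
    Measurable fun ω => batchX Q n (fun k => z k ω) i (x ω) (y ω) := by
  unfold batchX
  refine (Finset.measurable_fun_sum _ fun k _ => ?_).const_smul (1 / (n : ℝ))
  exact (Q.measurable_gradX_uncurry hW hS hL i).comp ((hx.prodMk hy).prodMk (hz k))

theorem measurable_batchY [mΩ : MeasurableSpace Ω] (hL : 0 < L) (hW : Q.WellPosed)
    (hS : Q.Smooth L) (n : ℕ) {z : ℕ → Ω → Z} {x : Ω → Vec d₁} {y : Ω → Vec d₂} (i : Fin m)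
    (hz : ∀ k, Measurable (z k)) (hx : Measurable x) (hy : Measurable y) :
    Measurable fun ω => batchY Q n (fun k => z k ω) i (x ω) (y ω) := by
  unfold batchY
  refine (Finset.measurable_fun_sum _ fun k _ => ?_).const_smul (1 / (n : ℝ))
  exact (Q.measurable_gradY_uncurry hW hS hL i).comp ((hx.prodMk hy).prodMk (hz k))

theorem measState_init [mΩ : MeasurableSpace Ω] (hL : 0 < L) (hW : Q.WellPosed)
    (hS : Q.Smooth L) {z : Fin m → ℕ → Ω → Z} {nx : Fin m → Ω → Vec d₁} {ny : Fin m → Ω → Vec d₂}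
    (hz : ∀ i k, Measurable (z i k)) (hnx : ∀ i, Measurable (nx i))
    (hny : ∀ i, Measurable (ny i)) :
    MeasState mΩ fun ω => initState Q A (fun i k => z i k ω) (fun i => nx i ω)
      (fun i => ny i ω) := by
  have hg := fun i => measurable_batchX hL hW hS A.b₀ i (hz i) (measurable_const (a := A.x₀))
    (measurable_const (a := A.y₀))
  have hh := fun i => measurable_batchY hL hW hS A.b₀ i (hz i) (measurable_const (a := A.x₀))
    (measurable_const (a := A.y₀))
  have hgs := fun i => (hg i).add (hnx i)
  have hhs := fun i => (hh i).add (hny i)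
  exact ⟨fun _ => measurable_const, fun _ => measurable_const, hg, hh, hgs, hhs,
    fun i => Finset.measurable_fun_sum Finset.univ fun j _ => (hgs j).const_smul (A.W i j),
    fun i => Finset.measurable_fun_sum Finset.univ fun j _ => (hhs j).const_smul (A.W i j)⟩

/-- The new positions do not see the fresh batch. They are therefore measurable even for a σ-algebra
that omits a fresh sample. -/
theorem MeasState.next_x [mΩ : MeasurableSpace Ω] {S : Ω → State m d₁ d₂} (h : MeasState mΩ S)
    (z : Ω → Fin m → ℕ → Z) (nx : Ω → Fin m → Vec d₁) (ny : Ω → Fin m → Vec d₂) (i : Fin m) :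
    Measurable fun ω => (nextState Q A (z ω) (nx ω) (ny ω) (S ω)).x i :=
  Finset.measurable_fun_sum Finset.univ fun j _ => ((h.x j).sub ((h.v j).const_smul A.ηx)).const_smul (A.W i j)

theorem MeasState.next_y [mΩ : MeasurableSpace Ω] {S : Ω → State m d₁ d₂} (h : MeasState mΩ S)
    (z : Ω → Fin m → ℕ → Z) (nx : Ω → Fin m → Vec d₁) (ny : Ω → Fin m → Vec d₂) (i : Fin m) :
    Measurable fun ω => (nextState Q A (z ω) (nx ω) (ny ω) (S ω)).y i :=
  Finset.measurable_fun_sum Finset.univ fun j _ => ((h.y j).add ((h.u j).const_smul A.ηy)).const_smul (A.W i j)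

theorem MeasState.next [mΩ : MeasurableSpace Ω] (hL : 0 < L) (hW : Q.WellPosed)
    (hS : Q.Smooth L) {S : Ω → State m d₁ d₂} (h : MeasState mΩ S)
    {z : Fin m → ℕ → Ω → Z} {nx : Fin m → Ω → Vec d₁} {ny : Fin m → Ω → Vec d₂}
    (hz : ∀ i k, Measurable (z i k)) (hnx : ∀ i, Measurable (nx i))
    (hny : ∀ i, Measurable (ny i)) :
    MeasState mΩ fun ω => nextState Q A (fun i k => z i k ω) (fun i => nx i ω)
      (fun i => ny i ω) (S ω) := by
  have hx := fun i => h.next_x (Q := Q) (A := A) (fun ω i k => z i k ω) (fun ω i => nx i ω)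
    (fun ω i => ny i ω) i
  have hy := fun i => h.next_y (Q := Q) (A := A) (fun ω i k => z i k ω) (fun ω i => nx i ω)
    (fun ω i => ny i ω) i
  have hg := fun i => (((h.g i).sub (measurable_batchX hL hW hS A.b i (hz i) (h.x i)
    (h.y i))).const_smul (1 - A.βx)).add (measurable_batchX hL hW hS A.b i (hz i) (hx i) (hy i))
  have hh := fun i => (((h.h i).sub (measurable_batchY hL hW hS A.b i (hz i) (h.x i)
    (h.y i))).const_smul (1 - A.βy)).add (measurable_batchY hL hW hS A.b i (hz i) (hx i) (hy i))
  have hgs := fun i => (hg i).add (hnx i)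
  have hhs := fun i => (hh i).add (hny i)
  exact ⟨hx, hy, hg, hh, hgs, hhs,
    fun i => Finset.measurable_fun_sum Finset.univ fun j _ =>
      (((h.v j).add (hgs j)).sub (h.gs j)).const_smul (A.W i j),
    fun i => Finset.measurable_fun_sum Finset.univ fun j _ =>
      (((h.u j).add (hhs j)).sub (h.hs j)).const_smul (A.W i j)⟩

/-- The run of the algorithm on random inputs. -/
noncomputable def randRun (Q : Problem m d₁ d₂ Z) (A : Params m d₁ d₂)
    (z : ℕ → Fin m → ℕ → Ω → Z) (nx : ℕ → Fin m → Ω → Vec d₁)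
    (ny : ℕ → Fin m → Ω → Vec d₂) (t : ℕ) (ω : Ω) : State m d₁ d₂ :=
  run Q A (fun s i k => z s i k ω) (fun s i => nx s i ω) (fun s i => ny s i ω) t

variable {z : ℕ → Fin m → ℕ → Ω → Z} {nx : ℕ → Fin m → Ω → Vec d₁}
  {ny : ℕ → Fin m → Ω → Vec d₂}

/-- Only samples up to time t are required to be measurable, so that `mΩ` may omit a later sample.
-/
theorem measState_randRun [mΩ : MeasurableSpace Ω] (hL : 0 < L) (hW : Q.WellPosed)
    (hS : Q.Smooth L) (t : ℕ) (hz : ∀ s ≤ t, ∀ i k, Measurable (z s i k))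
    (hnx : ∀ s i, Measurable (nx s i)) (hny : ∀ s i, Measurable (ny s i)) :
    MeasState mΩ (randRun Q A z nx ny t) := by
  induction t with
  | zero => exact measState_init hL hW hS (hz 0 le_rfl) (hnx 0) (hny 0)
  | succ t ih =>
    exact (ih fun s hs => hz s (hs.trans t.le_succ)).next hL hW hS (hz (t + 1) le_rfl)
      (hnx (t + 1)) (hny (t + 1))

theorem measurable_errX [mΩ : MeasurableSpace Ω] (hL : 0 < L) (hW : Q.WellPosed)
    (hS : Q.Smooth L) (hV : Q.BoundedVariance σ) {S : Ω → State m d₁ d₂} (h : MeasState mΩ S)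
    (i : Fin m) : Measurable fun ω => errX Q (S ω) i :=
  (h.g i).sub ((Q.continuous_fgradX hL hW hS hV i).measurable.comp ((h.x i).prodMk (h.y i)))

theorem measurable_errY [mΩ : MeasurableSpace Ω] (hL : 0 < L) (hW : Q.WellPosed)
    (hS : Q.Smooth L) (hV : Q.BoundedVariance σ) {S : Ω → State m d₁ d₂} (h : MeasState mΩ S)
    (i : Fin m) : Measurable fun ω => errY Q (S ω) i :=
  (h.h i).sub ((Q.continuous_fgradY hL hW hS hV i).measurable.comp ((h.x i).prodMk (h.y i)))

theorem measurable_resX [mΩ : MeasurableSpace Ω] (hL : 0 < L) (hW : Q.WellPosed)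
    (hS : Q.Smooth L) (hV : Q.BoundedVariance σ) {S : Ω → State m d₁ d₂} (n : ℕ) (i : Fin m)
    {ζ : Fin m → ℕ → Ω → Z} (hζ : ∀ k, Measurable (ζ i k))
    (hx : Measurable fun ω => (S ω).x i) (hy : Measurable fun ω => (S ω).y i) :
    Measurable fun ω => resX Q n (fun j k => ζ j k ω) (S ω) i :=
  (measurable_batchX hL hW hS n i hζ hx hy).sub
    ((Q.continuous_fgradX hL hW hS hV i).measurable.comp (hx.prodMk hy))

theorem measurable_resY [mΩ : MeasurableSpace Ω] (hL : 0 < L) (hW : Q.WellPosed)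
    (hS : Q.Smooth L) (hV : Q.BoundedVariance σ) {S : Ω → State m d₁ d₂} (n : ℕ) (i : Fin m)
    {ζ : Fin m → ℕ → Ω → Z} (hζ : ∀ k, Measurable (ζ i k))
    (hx : Measurable fun ω => (S ω).x i) (hy : Measurable fun ω => (S ω).y i) :
    Measurable fun ω => resY Q n (fun j k => ζ j k ω) (S ω) i :=
  (measurable_batchY hL hW hS n i hζ hx hy).sub
    ((Q.continuous_fgradY hL hW hS hV i).measurable.comp (hx.prodMk hy))

end Measurability

/-! ### Finite second moments of the run -/

section Integrability

variable {m d₁ d₂ : ℕ} {Z : Type*} [MeasurableSpace Z] {Q : Problem m d₁ d₂ Z}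
  {A : Params m d₁ d₂} {L μ σ : ℝ} {Ω : Type*} [MeasurableSpace Ω] {P : Measure Ω}

/-- All components of a random state have finite second moments. -/
structure SqIntState (P : Measure Ω) (S : Ω → State m d₁ d₂) : Prop where
  x : ∀ i, MemLp (fun ω => (S ω).x i) 2 P
  y : ∀ i, MemLp (fun ω => (S ω).y i) 2 P
  g : ∀ i, MemLp (fun ω => (S ω).g i) 2 P
  h : ∀ i, MemLp (fun ω => (S ω).h i) 2 P
  gs : ∀ i, MemLp (fun ω => (S ω).gs i) 2 P
  hs : ∀ i, MemLp (fun ω => (S ω).hs i) 2 P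
  v : ∀ i, MemLp (fun ω => (S ω).v i) 2 P
  u : ∀ i, MemLp (fun ω => (S ω).u i) 2 P

theorem memLp_comp_of_norm_sub_le [IsFiniteMeasure P] {d : ℕ} {G : (Vec d₁ × Vec d₂) → Vec d}
    {L : ℝ} (hL : 0 < L)
    (h : ∀ p q : Vec d₁ × Vec d₂, ‖G p - G q‖ ≤ L * (‖p.1 - q.1‖ + ‖p.2 - q.2‖))
    {x : Ω → Vec d₁} {y : Ω → Vec d₂} (hx : MemLp x 2 P) (hy : MemLp y 2 P) :
    MemLp (fun ω => G (x ω, y ω)) 2 P := by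
  have hG := continuous_of_norm_sub_le hL h
  have hb0 : MemLp (fun ω => L * (‖x ω‖ + ‖y ω‖)) 2 P := (hx.norm.add hy.norm).const_mul L
  have hb : MemLp (fun ω => ‖G 0‖ + L * (‖x ω‖ + ‖y ω‖)) 2 P := (memLp_const ‖G 0‖).add hb0
  have hmeas : AEStronglyMeasurable (fun ω => G (x ω, y ω)) P :=
    (hG.measurable.comp_aemeasurable (hx.aestronglyMeasurable.aemeasurable.prodMk
      hy.aestronglyMeasurable.aemeasurable)).aestronglyMeasurable
  refine hb.mono' hmeas (Filter.Eventually.of_forall fun ω => ?_)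
  have h1 := h (x ω, y ω) 0
  have h2 := norm_le_norm_add_norm_sub' (G (x ω, y ω)) (G 0)
  simp only [Prod.fst_zero, Prod.snd_zero, sub_zero] at h1
  linarith

theorem Problem.fgradX_norm_sub_le (hL : 0 < L) (hW : Q.WellPosed) (hS : Q.Smooth L)
    (hV : Q.BoundedVariance σ) (i : Fin m) (p q : Vec d₁ × Vec d₂) :
    ‖Q.fgradX i p.1 p.2 - Q.fgradX i q.1 q.2‖ ≤ L * (‖p.1 - q.1‖ + ‖p.2 - q.2‖) := by
  have h := Q.fgrad_lip hW hS hV i p.1 q.1 p.2 q.2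
  have h0 := mul_nonneg (norm_nonneg (p.1 - q.1)) (norm_nonneg (p.2 - q.2))
  refine abs_le_of_sq_le_sq' ?_ (by positivity) |>.2
  nlinarith [sq_nonneg ‖Q.fgradY i p.1 p.2 - Q.fgradY i q.1 q.2‖, mul_nonneg (sq_nonneg L) h0]

theorem Problem.fgradY_norm_sub_le (hL : 0 < L) (hW : Q.WellPosed) (hS : Q.Smooth L)
    (hV : Q.BoundedVariance σ) (i : Fin m) (p q : Vec d₁ × Vec d₂) :
    ‖Q.fgradY i p.1 p.2 - Q.fgradY i q.1 q.2‖ ≤ L * (‖p.1 - q.1‖ + ‖p.2 - q.2‖) := by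
  have h := Q.fgrad_lip hW hS hV i p.1 q.1 p.2 q.2
  have h0 := mul_nonneg (norm_nonneg (p.1 - q.1)) (norm_nonneg (p.2 - q.2))
  refine abs_le_of_sq_le_sq' ?_ (by positivity) |>.2
  nlinarith [sq_nonneg ‖Q.fgradX i p.1 p.2 - Q.fgradX i q.1 q.2‖, mul_nonneg (sq_nonneg L) h0]

/-- The gradient is dominated by its value at the origin for the same sample plus linear growth in
the point, so no independence between point and sample is needed. -/
theorem memLp_gradX_comp (hL : 0 < L) (hW : Q.WellPosed) (hS : Q.Smooth L)
    (hV : Q.BoundedVariance σ) (i : Fin m) {z : Ω → Z} {x : Ω → Vec d₁} {y : Ω → Vec d₂}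
    (hz : Measurable z) (hlaw : P.map z = Q.D i) (hx : MemLp x 2 P) (hy : MemLp y 2 P) :
    MemLp (fun ω => Q.gradX i (x ω) (y ω) (z ω)) 2 P := by
  have h0 : MemLp (fun ω => Q.gradX i 0 0 (z ω)) 2 P := by
    have := Q.memLp_gradX hW hS hV i 0 0
    rw [← hlaw] at this
    exact this.comp_of_map hz.aemeasurable
  have hb : MemLp (fun ω => ‖Q.gradX i 0 0 (z ω)‖ + L * (‖x ω‖ + ‖y ω‖)) 2 P :=
    h0.norm.add ((hx.norm.add hy.norm).const_mul L)
  refine hb.mono' (((Q.measurable_gradX_uncurry hW hS hL i).comp_aemeasurable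
    ((hx.aestronglyMeasurable.aemeasurable.prodMk hy.aestronglyMeasurable.aemeasurable).prodMk
      hz.aemeasurable)).aestronglyMeasurable) (Filter.Eventually.of_forall fun ω => ?_)
  have h1 := hS.lip_x hL i (x ω) 0 (y ω) 0 (z ω)
  have h2 := norm_le_norm_add_norm_sub' (Q.gradX i (x ω) (y ω) (z ω)) (Q.gradX i 0 0 (z ω))
  simp only [sub_zero] at h1
  linarith

theorem memLp_gradY_comp (hL : 0 < L) (hW : Q.WellPosed) (hS : Q.Smooth L)
    (hV : Q.BoundedVariance σ) (i : Fin m) {z : Ω → Z} {x : Ω → Vec d₁} {y : Ω → Vec d₂}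
    (hz : Measurable z) (hlaw : P.map z = Q.D i) (hx : MemLp x 2 P) (hy : MemLp y 2 P) :
    MemLp (fun ω => Q.gradY i (x ω) (y ω) (z ω)) 2 P := by
  have h0 : MemLp (fun ω => Q.gradY i 0 0 (z ω)) 2 P := by
    have := Q.memLp_gradY hW hS hV i 0 0
    rw [← hlaw] at this
    exact this.comp_of_map hz.aemeasurable
  have hb : MemLp (fun ω => ‖Q.gradY i 0 0 (z ω)‖ + L * (‖x ω‖ + ‖y ω‖)) 2 P :=
    h0.norm.add ((hx.norm.add hy.norm).const_mul L)
  refine hb.mono' (((Q.measurable_gradY_uncurry hW hS hL i).comp_aemeasurable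
    ((hx.aestronglyMeasurable.aemeasurable.prodMk hy.aestronglyMeasurable.aemeasurable).prodMk
      hz.aemeasurable)).aestronglyMeasurable) (Filter.Eventually.of_forall fun ω => ?_)
  have h1 := hS.lip_y hL i (x ω) 0 (y ω) 0 (z ω)
  have h2 := norm_le_norm_add_norm_sub' (Q.gradY i (x ω) (y ω) (z ω)) (Q.gradY i 0 0 (z ω))
  simp only [sub_zero] at h1
  linarith

theorem memLp_batchX (hL : 0 < L) (hW : Q.WellPosed) (hS : Q.Smooth L)
    (hV : Q.BoundedVariance σ) (n : ℕ) (i : Fin m) {z : ℕ → Ω → Z} {x : Ω → Vec d₁}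
    {y : Ω → Vec d₂} (hz : ∀ k, Measurable (z k)) (hlaw : ∀ k, P.map (z k) = Q.D i)
    (hx : MemLp x 2 P) (hy : MemLp y 2 P) :
    MemLp (fun ω => batchX Q n (fun k => z k ω) i (x ω) (y ω)) 2 P :=
  (memLp_finsetSum _ fun k _ =>
    memLp_gradX_comp hL hW hS hV i (hz k) (hlaw k) hx hy).const_smul (1 / (n : ℝ))

theorem memLp_batchY (hL : 0 < L) (hW : Q.WellPosed) (hS : Q.Smooth L)
    (hV : Q.BoundedVariance σ) (n : ℕ) (i : Fin m) {z : ℕ → Ω → Z} {x : Ω → Vec d₁}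
    {y : Ω → Vec d₂} (hz : ∀ k, Measurable (z k)) (hlaw : ∀ k, P.map (z k) = Q.D i)
    (hx : MemLp x 2 P) (hy : MemLp y 2 P) :
    MemLp (fun ω => batchY Q n (fun k => z k ω) i (x ω) (y ω)) 2 P :=
  (memLp_finsetSum _ fun k _ =>
    memLp_gradY_comp hL hW hS hV i (hz k) (hlaw k) hx hy).const_smul (1 / (n : ℝ))

theorem sqIntState_init [IsProbabilityMeasure P] (hL : 0 < L) (hW : Q.WellPosed)
    (hS : Q.Smooth L) (hV : Q.BoundedVariance σ) {z : Fin m → ℕ → Ω → Z}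
    {nx : Fin m → Ω → Vec d₁} {ny : Fin m → Ω → Vec d₂} (hz : ∀ i k, Measurable (z i k))
    (hlaw : ∀ i k, P.map (z i k) = Q.D i) (hnx : ∀ i, MemLp (nx i) 2 P)
    (hny : ∀ i, MemLp (ny i) 2 P) :
    SqIntState P fun ω => initState Q A (fun i k => z i k ω) (fun i => nx i ω)
      (fun i => ny i ω) := by
  have hg := fun i => memLp_batchX hL hW hS hV A.b₀ i (hz i) (hlaw i)
    (memLp_const (μ := P) A.x₀) (memLp_const A.y₀)
  have hh := fun i => memLp_batchY hL hW hS hV A.b₀ i (hz i) (hlaw i)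
    (memLp_const (μ := P) A.x₀) (memLp_const A.y₀)
  have hgs := fun i => (hg i).add (hnx i)
  have hhs := fun i => (hh i).add (hny i)
  exact ⟨fun _ => memLp_const _, fun _ => memLp_const _, hg, hh, hgs, hhs,
    fun i => memLp_finsetSum Finset.univ fun j _ => (hgs j).const_smul (A.W i j),
    fun i => memLp_finsetSum Finset.univ fun j _ => (hhs j).const_smul (A.W i j)⟩

theorem SqIntState.next [IsProbabilityMeasure P] (hL : 0 < L) (hW : Q.WellPosed)
    (hS : Q.Smooth L) (hV : Q.BoundedVariance σ) {S : Ω → State m d₁ d₂} (h : SqIntState P S)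
    {z : Fin m → ℕ → Ω → Z} {nx : Fin m → Ω → Vec d₁} {ny : Fin m → Ω → Vec d₂}
    (hz : ∀ i k, Measurable (z i k)) (hlaw : ∀ i k, P.map (z i k) = Q.D i)
    (hnx : ∀ i, MemLp (nx i) 2 P) (hny : ∀ i, MemLp (ny i) 2 P) :
    SqIntState P fun ω => nextState Q A (fun i k => z i k ω) (fun i => nx i ω)
      (fun i => ny i ω) (S ω) := by
  have hx : ∀ i, MemLp (fun ω => ∑ j, A.W i j • ((S ω).x j - A.ηx • (S ω).v j)) 2 P := fun i =>
    memLp_finsetSum Finset.univ fun j _ => ((h.x j).sub ((h.v j).const_smul A.ηx)).const_smul (A.W i j)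
  have hy : ∀ i, MemLp (fun ω => ∑ j, A.W i j • ((S ω).y j + A.ηy • (S ω).u j)) 2 P := fun i =>
    memLp_finsetSum Finset.univ fun j _ => ((h.y j).add ((h.u j).const_smul A.ηy)).const_smul (A.W i j)
  have hg := fun i => (((h.g i).sub (memLp_batchX hL hW hS hV A.b i (hz i) (hlaw i) (h.x i)
    (h.y i))).const_smul (1 - A.βx)).add
      (memLp_batchX hL hW hS hV A.b i (hz i) (hlaw i) (hx i) (hy i))
  have hh := fun i => (((h.h i).sub (memLp_batchY hL hW hS hV A.b i (hz i) (hlaw i) (h.x i)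
    (h.y i))).const_smul (1 - A.βy)).add
      (memLp_batchY hL hW hS hV A.b i (hz i) (hlaw i) (hx i) (hy i))
  have hgs := fun i => (hg i).add (hnx i)
  have hhs := fun i => (hh i).add (hny i)
  exact ⟨hx, hy, hg, hh, hgs, hhs,
    fun i => memLp_finsetSum Finset.univ fun j _ =>
      (((h.v j).add (hgs j)).sub (h.gs j)).const_smul (A.W i j),
    fun i => memLp_finsetSum Finset.univ fun j _ =>
      (((h.u j).add (hhs j)).sub (h.hs j)).const_smul (A.W i j)⟩

theorem memLp_resX [IsProbabilityMeasure P] (hL : 0 < L) (hW : Q.WellPosed) (hS : Q.Smooth L)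
    (hV : Q.BoundedVariance σ) {S : Ω → State m d₁ d₂} (h : SqIntState P S) (n : ℕ) (i : Fin m)
    {ζ : Fin m → ℕ → Ω → Z} (hz : ∀ i k, Measurable (ζ i k))
    (hlaw : ∀ i k, P.map (ζ i k) = Q.D i) :
    MemLp (fun ω => resX Q n (fun j k => ζ j k ω) (S ω) i) 2 P :=
  (memLp_batchX hL hW hS hV n i (hz i) (hlaw i) (h.x i) (h.y i)).sub
    (memLp_comp_of_norm_sub_le hL (Q.fgradX_norm_sub_le hL hW hS hV i) (h.x i) (h.y i))

theorem memLp_resY [IsProbabilityMeasure P] (hL : 0 < L) (hW : Q.WellPosed) (hS : Q.Smooth L)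
    (hV : Q.BoundedVariance σ) {S : Ω → State m d₁ d₂} (h : SqIntState P S) (n : ℕ) (i : Fin m)
    {ζ : Fin m → ℕ → Ω → Z} (hz : ∀ i k, Measurable (ζ i k))
    (hlaw : ∀ i k, P.map (ζ i k) = Q.D i) :
    MemLp (fun ω => resY Q n (fun j k => ζ j k ω) (S ω) i) 2 P :=
  (memLp_batchY hL hW hS hV n i (hz i) (hlaw i) (h.x i) (h.y i)).sub
    (memLp_comp_of_norm_sub_le hL (Q.fgradY_norm_sub_le hL hW hS hV i) (h.x i) (h.y i))

theorem memLp_errX [IsProbabilityMeasure P] (hL : 0 < L) (hW : Q.WellPosed) (hS : Q.Smooth L)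
    (hV : Q.BoundedVariance σ) {S : Ω → State m d₁ d₂} (h : SqIntState P S) (i : Fin m) :
    MemLp (fun ω => errX Q (S ω) i) 2 P :=
  (h.g i).sub (memLp_comp_of_norm_sub_le hL (Q.fgradX_norm_sub_le hL hW hS hV i) (h.x i) (h.y i))

theorem memLp_errY [IsProbabilityMeasure P] (hL : 0 < L) (hW : Q.WellPosed) (hS : Q.Smooth L)
    (hV : Q.BoundedVariance σ) {S : Ω → State m d₁ d₂} (h : SqIntState P S) (i : Fin m) :
    MemLp (fun ω => errY Q (S ω) i) 2 P :=
  (h.h i).sub (memLp_comp_of_norm_sub_le hL (Q.fgradY_norm_sub_le hL hW hS hV i) (h.x i) (h.y i))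

end Integrability

/-! ### Orthogonality in L² -/

section L2

variable {Ω : Type*} [MeasurableSpace Ω] {P : Measure Ω} {d : ℕ}

theorem integrable_inner_of_memLp {a b : Ω → Vec d} (ha : MemLp a 2 P) (hb : MemLp b 2 P) :
    Integrable (fun ω => inner ℝ (a ω) (b ω)) P := by
  refine ((ha.integrable_norm_pow two_ne_zero).add (hb.integrable_norm_pow two_ne_zero)).mono'
    (ha.aestronglyMeasurable.inner hb.aestronglyMeasurable)
    (Filter.Eventually.of_forall fun ω => ?_)
  rw [Real.norm_eq_abs]
  refine (abs_real_inner_le_norm _ _).trans ?_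
  simp only [Pi.add_apply]
  nlinarith [sq_nonneg (‖a ω‖ - ‖b ω‖), sq_nonneg (‖a ω‖), sq_nonneg ‖b ω‖]

theorem integrable_sq_of_memLp {a : Ω → Vec d} (ha : MemLp a 2 P) :
    Integrable (fun ω => ‖a ω‖ ^ 2) P := ha.integrable_norm_pow two_ne_zero

theorem integral_norm_sum_sq_of_orthogonal {ι : Type*} (s : Finset ι) {S : ι → Ω → Vec d}
    (hS : ∀ i ∈ s, MemLp (S i) 2 P)
    (horth : ∀ i ∈ s, ∀ j ∈ s, i ≠ j → ∫ ω, inner ℝ (S j ω) (S i ω) ∂P = 0) :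
    ∫ ω, ‖∑ i ∈ s, S i ω‖ ^ 2 ∂P = ∑ i ∈ s, ∫ ω, ‖S i ω‖ ^ 2 ∂P := by
  classical
  have e : ∀ ω, ‖∑ i ∈ s, S i ω‖ ^ 2 = ∑ i ∈ s, ∑ j ∈ s, inner ℝ (S j ω) (S i ω) := by
    intro ω
    rw [← real_inner_self_eq_norm_sq, inner_sum]
    simp only [sum_inner]
  simp only [e]
  rw [integral_finsetSum s fun i hi => integrable_finsetSum s fun j hj =>
    integrable_inner_of_memLp (hS j hj) (hS i hi)]
  refine Finset.sum_congr rfl fun i hi => ?_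
  rw [integral_finsetSum s fun j hj => integrable_inner_of_memLp (hS j hj) (hS i hi),
    Finset.sum_eq_single_of_mem i hi fun j hj hji => horth i hi j hj hji.symm]
  simp only [real_inner_self_eq_norm_sq]

variable {m : ℕ}

theorem memLp_avg {a : Fin m → Ω → Vec d} (ha : ∀ i, MemLp (a i) 2 P) :
    MemLp (fun ω => avg fun i => a i ω) 2 P :=
  (memLp_finsetSum Finset.univ fun i _ => ha i).const_smul (1 / (m : ℝ))

theorem integrable_msq {a : Fin m → Ω → Vec d} (ha : ∀ i, MemLp (a i) 2 P) :
    Integrable (fun ω => msq fun i => a i ω) P :=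
  (integrable_finsetSum _ fun i _ => integrable_sq_of_memLp (ha i)).const_mul _

theorem integral_msq {a : Fin m → Ω → Vec d} (ha : ∀ i, MemLp (a i) 2 P) :
    ∫ ω, msq (fun i => a i ω) ∂P = 1 / (m : ℝ) * ∑ i, ∫ ω, ‖a i ω‖ ^ 2 ∂P := by
  simp only [msq]
  rw [integral_const_mul, integral_finsetSum _ fun i _ => integrable_sq_of_memLp (ha i)]

theorem integral_msq_le (hm : 0 < m) {a : Fin m → Ω → Vec d} (ha : ∀ i, MemLp (a i) 2 P) {c : ℝ}
    (h : ∀ i, ∫ ω, ‖a i ω‖ ^ 2 ∂P ≤ c) : ∫ ω, msq (fun i => a i ω) ∂P ≤ c := by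
  have hm' : (m : ℝ) ≠ 0 := by positivity
  rw [integral_msq ha]
  calc _ ≤ 1 / (m : ℝ) * ∑ _i : Fin m, c := by gcongr with i; exact h i
    _ = c := by simp; field_simp

theorem integral_norm_affine_sq {a b : Ω → Vec d} (ha : MemLp a 2 P) (hb : MemLp b 2 P) (c : ℝ)
    (h : ∫ ω, inner ℝ (a ω) (b ω) ∂P = 0) :
    ∫ ω, ‖c • a ω + b ω‖ ^ 2 ∂P = c ^ 2 * ∫ ω, ‖a ω‖ ^ 2 ∂P + ∫ ω, ‖b ω‖ ^ 2 ∂P := by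
  have e : ∀ ω, ‖c • a ω + b ω‖ ^ 2
      = c ^ 2 * ‖a ω‖ ^ 2 + 2 * c * inner ℝ (a ω) (b ω) + ‖b ω‖ ^ 2 := by
    intro ω
    rw [norm_add_sq_real, inner_smul_left, norm_smul, mul_pow, Real.norm_eq_abs, sq_abs]
    simp; ring
  have i1 := (integrable_sq_of_memLp ha).const_mul (c ^ 2)
  have i2 := (integrable_inner_of_memLp ha hb).const_mul (2 * c)
  simp only [e]
  rw [integral_add (f := fun ω => c ^ 2 * ‖a ω‖ ^ 2 + 2 * c * inner ℝ (a ω) (b ω))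
    (i1.add i2) (integrable_sq_of_memLp hb), integral_add i1 i2,
    integral_const_mul, integral_const_mul, h, mul_zero, add_zero]

/-- Recursive momentum with innovations that are orthogonal to the past and to each other. -/
theorem integral_momentum_step {e S e' : Fin m → Ω → Vec d} {c : ℝ}
    (he : ∀ i, MemLp (e i) 2 P) (hS : ∀ i, MemLp (S i) 2 P)
    (h : ∀ i ω, e' i ω = c • e i ω + S i ω)
    (horth : ∀ i j, ∫ ω, inner ℝ (e j ω) (S i ω) ∂P = 0)
    (hSS : ∀ i j, i ≠ j → ∫ ω, inner ℝ (S j ω) (S i ω) ∂P = 0) :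
    ∫ ω, ‖avg fun i => e' i ω‖ ^ 2 ∂P = c ^ 2 * ∫ ω, ‖avg fun i => e i ω‖ ^ 2 ∂P
        + 1 / (m : ℝ) * ∫ ω, msq (fun i => S i ω) ∂P ∧
      ∫ ω, msq (fun i => e' i ω) ∂P = c ^ 2 * ∫ ω, msq (fun i => e i ω) ∂P
        + ∫ ω, msq (fun i => S i ω) ∂P := by
  constructor
  · have e1 : ∀ ω, (avg fun i => e' i ω) = c • (avg fun i => e i ω) + avg fun i => S i ω := by
      intro ω; simp only [h, avg_add, avg_smul]
    have e2 : ∀ ω, inner ℝ (avg fun i => e i ω) (avg fun i => S i ω)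
        = (1 / (m : ℝ)) * (1 / (m : ℝ)) * ∑ i, ∑ j, inner ℝ (e j ω) (S i ω) := by
      intro ω
      simp only [avg, inner_smul_left, inner_smul_right, inner_sum, sum_inner, Finset.mul_sum,
        mul_assoc]
      rfl
    have e3 : ∫ ω, inner ℝ (avg fun i => e i ω) (avg fun i => S i ω) ∂P = 0 := by
      simp only [e2]
      rw [integral_const_mul, integral_finsetSum _ fun i _ => integrable_finsetSum _ fun j _ =>
        integrable_inner_of_memLp (he j) (hS i)]
      rw [Finset.sum_eq_zero, mul_zero]
      intro i _
      rw [integral_finsetSum _ fun j _ => integrable_inner_of_memLp (he j) (hS i)]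
      exact Finset.sum_eq_zero fun j _ => horth i j
    simp only [e1]
    rw [integral_norm_affine_sq (memLp_avg he) (memLp_avg hS) c e3]
    congr 1
    simp only [avg, norm_smul, mul_pow]
    -- Innovations of different agents are orthogonal: the factor 1/m² meets a sum of m squares,
    -- which is m times their mean. This is the variance reduction by 1/m.
    rw [integral_const_mul, integral_norm_sum_sq_of_orthogonal _ (fun i _ => hS i)
      (fun i _ j _ hij => hSS i j hij), integral_msq hS, Real.norm_of_nonneg (by positivity)]
    ring
  · have he' : ∀ i, MemLp (e' i) 2 P := fun i => by
      have : e' i = fun ω => c • e i ω + S i ω := funext (h i)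
      rw [this]
      exact ((he i).const_smul c).add (hS i)
    rw [integral_msq he', integral_msq he, integral_msq hS]
    simp only [h]
    rw [Finset.sum_congr rfl fun i _ => integral_norm_affine_sq (he i) (hS i) c (horth i i),
      Finset.sum_add_distrib, ← Finset.mul_sum]
    ring

end L2

/-! ### Independence of a fresh sample -/

section Fresh

variable {m d₁ d₂ : ℕ} {Z : Type*} [MeasurableSpace Z] {Q : Problem m d₁ d₂ Z}
  {Ω : Type*} {σx σy : ℝ} {z : ℕ → Fin m → ℕ → Ω → Z} {nx : ℕ → Fin m → Ω → Vec d₁} {ny : ℕ → Fin m → Ω → Vec d₂}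

/-- The σ-algebra of all inputs other than one sample. -/
@[reducible]
def others (z : ℕ → Fin m → ℕ → Ω → Z) (nx : ℕ → Fin m → Ω → Vec d₁)
    (ny : ℕ → Fin m → Ω → Vec d₂) (t : ℕ) (i : Fin m) (k : ℕ) : MeasurableSpace Ω :=
  ⨆ a ∈ {a | a ≠ Sum.inl (t, i, k)}, inputSigma z nx ny a

theorem measurable_others_z {t : ℕ} {i : Fin m} {k : ℕ} {t' : ℕ} {i' : Fin m} {k' : ℕ}
    (h : (t', i', k') ≠ (t, i, k)) : Measurable[others z nx ny t i k] (z t' i' k') := by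
  have h1 : inputSigma z nx ny (Sum.inl (t', i', k')) ≤ others z nx ny t i k :=
    le_iSup₂_of_le (f := fun a (_ : a ∈ {a | a ≠ Sum.inl (t, i, k)}) => inputSigma z nx ny a)
      (Sum.inl (t', i', k')) (fun e => h (Sum.inl.inj e)) le_rfl
  exact Measurable.mono (comap_measurable (z t' i' k')) h1 le_rfl

theorem measurable_others_nx {t : ℕ} {i : Fin m} {k : ℕ} (t' : ℕ) (i' : Fin m) :
    Measurable[others z nx ny t i k] (nx t' i') := by
  have h1 : inputSigma z nx ny (Sum.inr (Sum.inl (t', i'))) ≤ others z nx ny t i k :=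
    le_iSup₂_of_le (f := fun a (_ : a ∈ {a | a ≠ Sum.inl (t, i, k)}) => inputSigma z nx ny a)
      (Sum.inr (Sum.inl (t', i'))) (fun e => by cases e) le_rfl
  exact Measurable.mono (comap_measurable (nx t' i')) h1 le_rfl

theorem measurable_others_ny {t : ℕ} {i : Fin m} {k : ℕ} (t' : ℕ) (i' : Fin m) :
    Measurable[others z nx ny t i k] (ny t' i') := by
  have h1 : inputSigma z nx ny (Sum.inr (Sum.inr (t', i'))) ≤ others z nx ny t i k :=
    le_iSup₂_of_le (f := fun a (_ : a ∈ {a | a ≠ Sum.inl (t, i, k)}) => inputSigma z nx ny a)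
      (Sum.inr (Sum.inr (t', i'))) (fun e => by cases e) le_rfl
  exact Measurable.mono (comap_measurable (ny t' i')) h1 le_rfl

variable [mΩ : MeasurableSpace Ω] {P : Measure Ω}

theorem IsRandomInput.inputSigma_le (hI : IsRandomInput Q σx σy P z nx ny) (a) :
    inputSigma z nx ny a ≤ mΩ := by
  rcases a with ⟨t, i, k⟩ | ⟨t, i⟩ | ⟨t, i⟩
  · exact (hI.measZ t i k).comap_le
  · exact (hI.measX t i).comap_le
  · exact (hI.measY t i).comap_le

theorem IsRandomInput.others_le (hI : IsRandomInput Q σx σy P z nx ny) (t : ℕ) (i : Fin m)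
    (k : ℕ) : others z nx ny t i k ≤ mΩ :=
  iSup₂_le fun a _ => hI.inputSigma_le a

theorem IsRandomInput.map_prod (hI : IsRandomInput Q σx σy P z nx ny) [IsProbabilityMeasure P]
    {α : Type*} [MeasurableSpace α] {t : ℕ} {i : Fin m} {k : ℕ} {H : Ω → α}
    (hH : Measurable[others z nx ny t i k] H) :
    P.map (fun ω => (H ω, z t i k ω)) = (P.map H).prod (Q.D i) := by
  have h1 : Indep (others z nx ny t i k) (MeasurableSpace.comap (z t i k) inferInstance) P := by
    have := indep_iSup_of_disjoint hI.inputSigma_le hI.indep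
      (S := {a | a ≠ Sum.inl (t, i, k)}) (T := {Sum.inl (t, i, k)})
      (Set.disjoint_singleton_right.2 fun h => h rfl)
    rwa [iSup_singleton] at this
  have h2 : IndepFun H (z t i k) P := by
    rw [IndepFun_iff_Indep]
    exact indep_of_indep_of_le_left h1 hH.comap_le
  have h3 := (indepFun_iff_map_prod_eq_prod_map_map
    (hH.mono (hI.others_le t i k) le_rfl).aemeasurable (hI.measZ t i k).aemeasurable).1 h2
  rw [h3, hI.lawZ]

theorem IsRandomInput.integral_fresh (hI : IsRandomInput Q σx σy P z nx ny) (hW : Q.WellPosed)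
    [IsProbabilityMeasure P] {α : Type*} [MeasurableSpace α] {t : ℕ} {i : Fin m} {k : ℕ}
    {H : Ω → α} (hH : Measurable[others z nx ny t i k] H) {φ : α × Z → ℝ} (hφ : Measurable φ)
    (hint : Integrable (fun ω => φ (H ω, z t i k ω)) P) :
    ∫ ω, φ (H ω, z t i k ω) ∂P = ∫ h, ∫ ζ, φ (h, ζ) ∂(Q.D i) ∂(P.map H) := by
  have := hW.prob i
  have hH' : Measurable H := hH.mono (hI.others_le t i k) le_rfl
  have hpair : Measurable fun ω => (H ω, z t i k ω) := hH'.prodMk (hI.measZ t i k)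
  have hprob : IsProbabilityMeasure (P.map H) := Measure.isProbabilityMeasure_map hH'.aemeasurable
  have hint2 : Integrable φ ((P.map H).prod (Q.D i)) := by
    rw [← hI.map_prod hH]
    exact (integrable_map_measure hφ.aestronglyMeasurable hpair.aemeasurable).2 hint
  rw [← integral_prod _ hint2, ← hI.map_prod hH,
    integral_map hpair.aemeasurable hφ.aestronglyMeasurable]

/-- By Fubini everything but the fresh sample is frozen, and the inner integral is an inner product
with a zero mean. This replaces conditional expectations. -/
theorem IsRandomInput.integral_inner_fresh_eq_zero (hI : IsRandomInput Q σx σy P z nx ny)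
    (hW : Q.WellPosed) [IsProbabilityMeasure P] {α : Type*} [MeasurableSpace α] {d t : ℕ}
    {i : Fin m} {k : ℕ} {a : Ω → Vec d} {H : Ω → α} (ha : Measurable[others z nx ny t i k] a)
    (hH : Measurable[others z nx ny t i k] H) {ψ : α × Z → Vec d} (hψ : Measurable ψ)
    (hψi : ∀ h, Integrable (fun ζ => ψ (h, ζ)) (Q.D i)) (hψ0 : ∀ h, ∫ ζ, ψ (h, ζ) ∂(Q.D i) = 0)
    (ha2 : MemLp a 2 P) (hψ2 : MemLp (fun ω => ψ (H ω, z t i k ω)) 2 P) :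
    ∫ ω, inner ℝ (a ω) (ψ (H ω, z t i k ω)) ∂P = 0 := by
  have h := hI.integral_fresh hW (t := t) (i := i) (k := k) (H := fun ω => (a ω, H ω))
    (ha.prodMk hH) (φ := fun p : (Vec d × α) × Z => inner ℝ p.1.1 (ψ (p.1.2, p.2)))
    (by
      have h1 : Measurable fun p : (Vec d × α) × Z => ψ (p.1.2, p.2) :=
        hψ.comp ((measurable_snd.comp measurable_fst).prodMk measurable_snd)
      exact (measurable_fst.comp measurable_fst).inner h1)
    (integrable_inner_of_memLp ha2 hψ2)
  rw [h]
  simp only [integral_inner (hψi _), hψ0, inner_zero_right, integral_zero]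

theorem IsRandomInput.integral_fresh_le (hI : IsRandomInput Q σx σy P z nx ny)
    (hW : Q.WellPosed) [IsProbabilityMeasure P] {α : Type*} [MeasurableSpace α] {t : ℕ}
    {i : Fin m} {k : ℕ} {H : Ω → α} (hH : Measurable[others z nx ny t i k] H) {φ : α × Z → ℝ}
    (hφ : Measurable φ) (hint : Integrable (fun ω => φ (H ω, z t i k ω)) P) {c : ℝ} (hc : 0 ≤ c)
    (h : ∀ a, ∫ ζ, φ (a, ζ) ∂(Q.D i) ≤ c) : ∫ ω, φ (H ω, z t i k ω) ∂P ≤ c := by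
  rw [hI.integral_fresh hW hH hφ hint]
  have hprob : IsProbabilityMeasure (P.map H) :=
    Measure.isProbabilityMeasure_map (hH.mono (hI.others_le t i k) le_rfl).aemeasurable
  -- In the non-integrable case the outer integral is 0 by convention, so c ≥ 0 settles it.
  by_cases hi : Integrable (fun a => ∫ ζ, φ (a, ζ) ∂(Q.D i)) (P.map H)
  · calc _ ≤ ∫ _, c ∂(P.map H) := integral_mono hi (integrable_const c) h
      _ = c := by simp
  · rw [integral_undef hi]; exact hc

end Fresh

/-! ### Second moments of the Gaussian noise -/

section Noise

theorem integral_norm_sq_multivariateGaussian (d : ℕ) (s : ℝ) :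
    ∫ x, ‖x‖ ^ 2 ∂(multivariateGaussian 0 (s ^ 2 • (1 : Matrix (Fin d) (Fin d) ℝ))) = s ^ 2 * d := by
  set ν := multivariateGaussian 0 (s ^ 2 • (1 : Matrix (Fin d) (Fin d) ℝ))
  have hS : (s ^ 2 • (1 : Matrix (Fin d) (Fin d) ℝ)).PosSemidef :=
    Matrix.PosSemidef.one.smul (sq_nonneg s)
  have hL2 : MemLp (id : Vec d → Vec d) 2 ν := IsGaussian.memLp_two_id
  have hk : ∀ k, MemLp (fun x : Vec d => x k) 2 ν := fun k =>
    hL2.norm.mono (by fun_prop) (Filter.Eventually.of_forall fun x => by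
      simpa using PiLp.norm_apply_le x k)
  have h1 : ∀ k, ∫ x, (x k) ^ 2 ∂ν = s ^ 2 := by
    intro k
    have hv := variance_eval_multivariateGaussian (μ := 0) hS k
    have hmean : ∫ x : Vec d, x k ∂ν = 0 := by
      have := ContinuousLinearMap.integral_comp_comm (EuclideanSpace.proj k : Vec d →L[ℝ] ℝ)
        (hL2.integrable one_le_two)
      simpa [ν] using this
    rw [variance_eq_sub (hk k), hmean] at hv
    simpa using hv
  simp only [EuclideanSpace.real_norm_sq_eq]
  rw [integral_finsetSum _ fun k _ => (hk k).integrable_sq]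
  simp [h1, mul_comm]

theorem memLp_of_map_gaussian {Ω : Type*} [MeasurableSpace Ω] {P : Measure Ω} {d : ℕ} {s : ℝ}
    {n : Ω → Vec d} (hn : Measurable n)
    (hlaw : P.map n = multivariateGaussian 0 (s ^ 2 • (1 : Matrix (Fin d) (Fin d) ℝ))) :
    MemLp n 2 P := by
  have : MemLp (id : Vec d → Vec d) 2 (P.map n) := by rw [hlaw]; exact IsGaussian.memLp_two_id
  exact this.comp_of_map hn.aemeasurable

theorem integral_norm_sq_of_map_gaussian {Ω : Type*} [MeasurableSpace Ω] {P : Measure Ω} {d : ℕ}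
    {s : ℝ} {n : Ω → Vec d} (hn : Measurable n)
    (hlaw : P.map n = multivariateGaussian 0 (s ^ 2 • (1 : Matrix (Fin d) (Fin d) ℝ))) :
    ∫ ω, ‖n ω‖ ^ 2 ∂P = s ^ 2 * d := by
  rw [← integral_norm_sq_multivariateGaussian d s, ← hlaw,
    integral_map hn.aemeasurable (by fun_prop)]

end Noise

/-! ### Sampling errors of mini-batches -/

section Residual

variable {m d₁ d₂ : ℕ} {Z : Type*} [MeasurableSpace Z] {Q : Problem m d₁ d₂ Z}
  {Ω : Type*} [mΩ : MeasurableSpace Ω] {P : Measure Ω} {σx σy L σ : ℝ}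
  {z : ℕ → Fin m → ℕ → Ω → Z} {nx : ℕ → Fin m → Ω → Vec d₁} {ny : ℕ → Fin m → Ω → Vec d₂}

/-- `ξ p ζ` is a centred sampling error of agent `i` at the point `p` with variance at most
`σ²`. -/
structure IsResidual (Q : Problem m d₁ d₂ Z) (P : Measure Ω) (i : Fin m) (σ : ℝ) {d : ℕ}
    (ξ : Vec d₁ × Vec d₂ → Z → Vec d) : Prop where
  meas : Measurable fun p : (Vec d₁ × Vec d₂) × Z => ξ p.1 p.2
  int : ∀ p, Integrable (ξ p) (Q.D i)
  mean : ∀ p, ∫ ζ, ξ p ζ ∂(Q.D i) = 0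
  var : ∀ p, ∫ ζ, ‖ξ p ζ‖ ^ 2 ∂(Q.D i) ≤ σ ^ 2
  memLp : ∀ {x : Ω → Vec d₁} {y : Ω → Vec d₂} {ζ : Ω → Z}, Measurable ζ → P.map ζ = Q.D i →
    MemLp x 2 P → MemLp y 2 P → MemLp (fun ω => ξ (x ω, y ω) (ζ ω)) 2 P

/-- The sampling error of `∇ₓ F_i`. -/
noncomputable def Problem.residualX (Q : Problem m d₁ d₂ Z) (i : Fin m) (p : Vec d₁ × Vec d₂)
    (ζ : Z) : Vec d₁ := Q.gradX i p.1 p.2 ζ - Q.fgradX i p.1 p.2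

/-- The sampling error of `∇_y F_i`. -/
noncomputable def Problem.residualY (Q : Problem m d₁ d₂ Z) (i : Fin m) (p : Vec d₁ × Vec d₂)
    (ζ : Z) : Vec d₂ := Q.gradY i p.1 p.2 ζ - Q.fgradY i p.1 p.2

theorem isResidual_residualX [IsProbabilityMeasure P] (hL : 0 < L) (hW : Q.WellPosed)
    (hS : Q.Smooth L) (hV : Q.BoundedVariance σ) (i : Fin m) :
    IsResidual Q P i σ (Q.residualX i) where
  meas := (Q.measurable_gradX_uncurry hW hS hL i).sub
    ((Q.continuous_fgradX hL hW hS hV i).measurable.comp measurable_fst)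
  int p := by
    have := hW.prob i
    exact (Q.memLp_gradX_sub hW hS hV i p.1 p.2).integrable one_le_two
  mean p := by
    have := hW.prob i
    simp only [Problem.residualX]
    rw [integral_sub ((Q.memLp_gradX hW hS hV i p.1 p.2).integrable one_le_two)
      (integrable_const _), hV.unbiasedX]
    simp
  var p := by
    refine le_trans ?_ (hV.var i p.1 p.2)
    exact integral_mono (integrable_sq_of_memLp (Q.memLp_gradX_sub hW hS hV i p.1 p.2))
      (hV.int i p.1 p.2) fun ζ => le_add_of_nonneg_right (sq_nonneg _)
  memLp hζ hlaw hx hy := (memLp_gradX_comp hL hW hS hV i hζ hlaw hx hy).sub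
    (memLp_comp_of_norm_sub_le hL (Q.fgradX_norm_sub_le hL hW hS hV i) hx hy)

theorem isResidual_residualY [IsProbabilityMeasure P] (hL : 0 < L) (hW : Q.WellPosed)
    (hS : Q.Smooth L) (hV : Q.BoundedVariance σ) (i : Fin m) :
    IsResidual Q P i σ (Q.residualY i) where
  meas := (Q.measurable_gradY_uncurry hW hS hL i).sub
    ((Q.continuous_fgradY hL hW hS hV i).measurable.comp measurable_fst)
  int p := by
    have := hW.prob i
    exact (Q.memLp_gradY_sub hW hS hV i p.1 p.2).integrable one_le_two
  mean p := by
    have := hW.prob i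
    simp only [Problem.residualY]
    rw [integral_sub ((Q.memLp_gradY hW hS hV i p.1 p.2).integrable one_le_two)
      (integrable_const _), hV.unbiasedY]
    simp
  var p := by
    refine le_trans ?_ (hV.var i p.1 p.2)
    exact integral_mono (integrable_sq_of_memLp (Q.memLp_gradY_sub hW hS hV i p.1 p.2))
      (hV.int i p.1 p.2) fun ζ => le_add_of_nonneg_left (sq_nonneg _)
  memLp hζ hlaw hx hy := (memLp_gradY_comp hL hW hS hV i hζ hlaw hx hy).sub
    (memLp_comp_of_norm_sub_le hL (Q.fgradY_norm_sub_le hL hW hS hV i) hx hy)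

/-- Batch average of sampling errors. -/
noncomputable def batchRes {d : ℕ} (n : ℕ) (ξ : Vec d₁ × Vec d₂ → Z → Vec d) (ζ : ℕ → Z)
    (p : Vec d₁ × Vec d₂) : Vec d := (1 / (n : ℝ)) • ∑ k ∈ Finset.range n, ξ p (ζ k)

/-- An empty batch would have gradient 0, making the left side −∇ₓ f_i and the right side 0; hence n
≥ 1. -/
theorem resX_eq_batchRes {n : ℕ} (hn : 1 ≤ n) (ζ : Fin m → ℕ → Z) (s : State m d₁ d₂)
    (i : Fin m) : resX Q n ζ s i = batchRes n (Q.residualX i) (ζ i) (s.x i, s.y i) := by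
  have hn' : (n : ℝ) ≠ 0 := by positivity
  simp only [resX, batchX, batchRes, Problem.residualX, Finset.sum_sub_distrib, smul_sub,
    Finset.sum_const, Finset.card_range, ← Nat.cast_smul_eq_nsmul ℝ, smul_smul]
  rw [one_div_mul_cancel hn', one_smul]

theorem resY_eq_batchRes {n : ℕ} (hn : 1 ≤ n) (ζ : Fin m → ℕ → Z) (s : State m d₁ d₂)
    (i : Fin m) : resY Q n ζ s i = batchRes n (Q.residualY i) (ζ i) (s.x i, s.y i) := by
  have hn' : (n : ℝ) ≠ 0 := by positivity
  simp only [resY, batchY, batchRes, Problem.residualY, Finset.sum_sub_distrib, smul_sub,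
    Finset.sum_const, Finset.card_range, ← Nat.cast_smul_eq_nsmul ℝ, smul_smul]
  rw [one_div_mul_cancel hn', one_smul]

variable {i : Fin m} {d : ℕ} {ξ : Vec d₁ × Vec d₂ → Z → Vec d}

theorem integral_inner_residual_eq_zero [IsProbabilityMeasure P]
    (hI : IsRandomInput Q σx σy P z nx ny) (hW : Q.WellPosed) (hξ : IsResidual Q P i σ ξ)
    {t k : ℕ} {a : Ω → Vec d} {x : Ω → Vec d₁} {y : Ω → Vec d₂}
    (ha : Measurable[others z nx ny t i k] a) (hx : Measurable[others z nx ny t i k] x)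
    (hy : Measurable[others z nx ny t i k] y) (ha2 : MemLp a 2 P) (hx2 : MemLp x 2 P)
    (hy2 : MemLp y 2 P) : ∫ ω, inner ℝ (a ω) (ξ (x ω, y ω) (z t i k ω)) ∂P = 0 :=
  hI.integral_inner_fresh_eq_zero hW (H := fun ω => (x ω, y ω)) (ψ := fun p => ξ p.1 p.2)
    ha (hx.prodMk hy) hξ.meas hξ.int hξ.mean ha2 (hξ.memLp (hI.measZ t i k) (hI.lawZ t i k) hx2 hy2)

theorem memLp_batchRes (hI : IsRandomInput Q σx σy P z nx ny) (hξ : IsResidual Q P i σ ξ)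
    (n t : ℕ) {x : Ω → Vec d₁} {y : Ω → Vec d₂} (hx2 : MemLp x 2 P) (hy2 : MemLp y 2 P) :
    MemLp (fun ω => batchRes n ξ (fun k => z t i k ω) (x ω, y ω)) 2 P :=
  (memLp_finsetSum (Finset.range n) fun k _ =>
    hξ.memLp (hI.measZ t i k) (hI.lawZ t i k) hx2 hy2).const_smul (1 / (n : ℝ))

theorem integral_inner_batchRes_eq_zero [IsProbabilityMeasure P]
    (hI : IsRandomInput Q σx σy P z nx ny) (hW : Q.WellPosed) (hξ : IsResidual Q P i σ ξ)
    {t n : ℕ} {a : Ω → Vec d} {x : Ω → Vec d₁} {y : Ω → Vec d₂}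
    (ha : ∀ k, Measurable[others z nx ny t i k] a)
    (hx : ∀ k, Measurable[others z nx ny t i k] x)
    (hy : ∀ k, Measurable[others z nx ny t i k] y) (ha2 : MemLp a 2 P) (hx2 : MemLp x 2 P)
    (hy2 : MemLp y 2 P) :
    ∫ ω, inner ℝ (a ω) (batchRes n ξ (fun k => z t i k ω) (x ω, y ω)) ∂P = 0 := by
  simp only [batchRes, inner_smul_right, inner_sum]
  rw [integral_const_mul, integral_finsetSum _ fun k _ => integrable_inner_of_memLp ha2
    (hξ.memLp (hI.measZ t i k) (hI.lawZ t i k) hx2 hy2), Finset.sum_eq_zero, mul_zero]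
  exact fun k _ => integral_inner_residual_eq_zero hI hW hξ (ha k) (hx k) (hy k) ha2 hx2 hy2

theorem integral_residual_sq_le [IsProbabilityMeasure P]
    (hI : IsRandomInput Q σx σy P z nx ny) (hW : Q.WellPosed) (hξ : IsResidual Q P i σ ξ)
    {t k : ℕ} {x : Ω → Vec d₁} {y : Ω → Vec d₂} (hx : Measurable[others z nx ny t i k] x)
    (hy : Measurable[others z nx ny t i k] y) (hx2 : MemLp x 2 P) (hy2 : MemLp y 2 P) :
    ∫ ω, ‖ξ (x ω, y ω) (z t i k ω)‖ ^ 2 ∂P ≤ σ ^ 2 :=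
  hI.integral_fresh_le hW (H := fun ω => (x ω, y ω)) (φ := fun p => ‖ξ p.1 p.2‖ ^ 2)
    (hx.prodMk hy) (hξ.meas.norm.pow_const 2)
    (integrable_sq_of_memLp (hξ.memLp (hI.measZ t i k) (hI.lawZ t i k) hx2 hy2)) (sq_nonneg σ)
    hξ.var

/-- Convexity alone, without a gain 1/n: these errors carry a factor β², and the bounds must be
uniform in the batch size. -/
theorem integral_batchRes_sq_le [IsProbabilityMeasure P]
    (hI : IsRandomInput Q σx σy P z nx ny) (hW : Q.WellPosed) (hξ : IsResidual Q P i σ ξ)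
    {t n : ℕ} {x : Ω → Vec d₁} {y : Ω → Vec d₂} (hx : ∀ k, Measurable[others z nx ny t i k] x)
    (hy : ∀ k, Measurable[others z nx ny t i k] y) (hx2 : MemLp x 2 P) (hy2 : MemLp y 2 P) :
    ∫ ω, ‖batchRes n ξ (fun k => z t i k ω) (x ω, y ω)‖ ^ 2 ∂P ≤ σ ^ 2 := by
  have hk := fun k => integrable_sq_of_memLp
    (hξ.memLp (hI.measZ t i k) (hI.lawZ t i k) hx2 hy2)
  calc _ ≤ ∫ ω, 1 / (n : ℝ) * ∑ k ∈ Finset.range n, ‖ξ (x ω, y ω) (z t i k ω)‖ ^ 2 ∂P :=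
        integral_mono (integrable_sq_of_memLp (memLp_batchRes hI hξ n t hx2 hy2))
          ((integrable_finsetSum _ fun k _ => hk k).const_mul _)
          fun ω => norm_batch_average_sq_le n _
    _ = 1 / (n : ℝ) * ∑ k ∈ Finset.range n, ∫ ω, ‖ξ (x ω, y ω) (z t i k ω)‖ ^ 2 ∂P := by
        rw [integral_const_mul, integral_finsetSum _ fun k _ => hk k]
    _ ≤ 1 / (n : ℝ) * ∑ _k ∈ Finset.range n, σ ^ 2 := by
        gcongr with k
        exact integral_residual_sq_le hI hW hξ (hx k) (hy k) hx2 hy2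
    _ ≤ σ ^ 2 := by
        rcases Nat.eq_zero_or_pos n with rfl | hn
        · simp [sq_nonneg]
        · have : (n : ℝ) ≠ 0 := by positivity
          simp; field_simp; exact le_rfl

/-- For the initial batch the gain 1/n is needed. At a deterministic point the errors of distinct
samples are orthogonal, so the variance of the mean is divided by n. -/
theorem integral_batchRes_const_sq_le [IsProbabilityMeasure P]
    (hI : IsRandomInput Q σx σy P z nx ny) (hW : Q.WellPosed) (hξ : IsResidual Q P i σ ξ)
    {t n : ℕ} (hn : 1 ≤ n) (x : Vec d₁) (y : Vec d₂) :
    ∫ ω, ‖batchRes n ξ (fun k => z t i k ω) (x, y)‖ ^ 2 ∂P ≤ σ ^ 2 / n := by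
  have hk : ∀ k, MemLp (fun ω => ξ (x, y) (z t i k ω)) 2 P := fun k =>
    hξ.memLp (hI.measZ t i k) (hI.lawZ t i k) (memLp_const x) (memLp_const y)
  have hn' : (n : ℝ) ≠ 0 := by positivity
  have hξ0 : Measurable (ξ (x, y)) := hξ.meas.comp (measurable_const.prodMk measurable_id)
  simp only [batchRes, norm_smul, mul_pow]
  rw [integral_const_mul, integral_norm_sum_sq_of_orthogonal _ (fun k _ => hk k)
    (fun k _ l _ hkl => integral_inner_residual_eq_zero hI hW hξ
      (hξ0.comp (measurable_others_z fun h => hkl (by simpa using h.symm)))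
      measurable_const measurable_const (hk l) (memLp_const x) (memLp_const y))]
  calc _ ≤ ‖1 / (n : ℝ)‖ ^ 2 * ∑ _k ∈ Finset.range n, σ ^ 2 := by
        gcongr with k
        exact integral_residual_sq_le hI hW hξ (x := fun _ => x) (y := fun _ => y)
          measurable_const measurable_const (memLp_const x) (memLp_const y)
    _ = σ ^ 2 / n := by
        rw [Real.norm_of_nonneg (by positivity)]
        simp; field_simp

end Residual

/-! ### Quantities that do not involve a given fresh sample -/

section Others

variable {m d₁ d₂ : ℕ} {Z : Type*} [MeasurableSpace Z] {Q : Problem m d₁ d₂ Z}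
  {A : Params m d₁ d₂} {Ω : Type*} {L σ : ℝ} {z : ℕ → Fin m → ℕ → Ω → Z}
  {nx : ℕ → Fin m → Ω → Vec d₁} {ny : ℕ → Fin m → Ω → Vec d₂}

theorem measState_others (hL : 0 < L) (hW : Q.WellPosed) (hS : Q.Smooth L) (t : ℕ) (i : Fin m)
    (k : ℕ) : MeasState (others z nx ny (t + 1) i k) (randRun Q A z nx ny t) :=
  @measState_randRun _ _ _ _ _ _ _ _ _ _ _ _ (others z nx ny (t + 1) i k) hL hW hS t
    (fun s hs j l => measurable_others_z fun h => by
      have := congrArg Prod.fst h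
      simp only at this
      omega)
    (fun s j => measurable_others_nx s j) (fun s j => measurable_others_ny s j)

theorem measurable_others_next_x (hL : 0 < L) (hW : Q.WellPosed) (hS : Q.Smooth L) (t : ℕ)
    (i : Fin m) (k : ℕ) (j : Fin m) :
    Measurable[others z nx ny (t + 1) i k] fun ω => (randRun Q A z nx ny (t + 1) ω).x j :=
  @MeasState.next_x _ _ _ _ _ _ _ _ (others z nx ny (t + 1) i k) _
    (measState_others hL hW hS t i k) (fun ω i k => z (t + 1) i k ω) (fun ω i => nx (t + 1) i ω)
    (fun ω i => ny (t + 1) i ω) j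

theorem measurable_others_next_y (hL : 0 < L) (hW : Q.WellPosed) (hS : Q.Smooth L) (t : ℕ)
    (i : Fin m) (k : ℕ) (j : Fin m) :
    Measurable[others z nx ny (t + 1) i k] fun ω => (randRun Q A z nx ny (t + 1) ω).y j :=
  @MeasState.next_y _ _ _ _ _ _ _ _ (others z nx ny (t + 1) i k) _
    (measState_others hL hW hS t i k) (fun ω i k => z (t + 1) i k ω) (fun ω i => nx (t + 1) i ω)
    (fun ω i => ny (t + 1) i ω) j

/-- The samples of iteration `t`. -/
abbrev samples (z : ℕ → Fin m → ℕ → Ω → Z) (t : ℕ) (ω : Ω) : Fin m → ℕ → Z :=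
  fun i k => z t i k ω

/-- The innovation of agent j uses its own fresh batch and its positions at times t and t + 1, none
of which involves the fresh samples of another agent. -/
theorem measurable_others_innovX (hL : 0 < L) (hW : Q.WellPosed) (hS : Q.Smooth L)
    (hV : Q.BoundedVariance σ) (t : ℕ) {i j : Fin m} (hij : j ≠ i) (k : ℕ) :
    Measurable[others z nx ny (t + 1) i k] fun ω => innovX Q A (samples z (t + 1) ω)
      (randRun Q A z nx ny t ω) (randRun Q A z nx ny (t + 1) ω) j := by
  have hz : ∀ l, Measurable[others z nx ny (t + 1) i k] (z (t + 1) j l) := fun l =>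
    measurable_others_z fun h => hij (by simpa using congrArg (fun p => p.2.1) h)
  have hs := measState_others (z := z) (nx := nx) (ny := ny) (A := A) hL hW hS t i k
  have h1 := @measurable_resX _ _ _ _ _ Q _ _ _ (others z nx ny (t + 1) i k) hL hW hS hV _ A.b j
    (z (t + 1)) hz (measurable_others_next_x (A := A) hL hW hS t i k j)
    (measurable_others_next_y (A := A) hL hW hS t i k j)
  have h2 := @measurable_resX _ _ _ _ _ Q _ _ _ (others z nx ny (t + 1) i k) hL hW hS hV _ A.b j
    (z (t + 1)) hz (hs.x j) (hs.y j)
  exact h1.sub (h2.const_smul (1 - A.βx))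

theorem measurable_others_innovY (hL : 0 < L) (hW : Q.WellPosed) (hS : Q.Smooth L)
    (hV : Q.BoundedVariance σ) (t : ℕ) {i j : Fin m} (hij : j ≠ i) (k : ℕ) :
    Measurable[others z nx ny (t + 1) i k] fun ω => innovY Q A (samples z (t + 1) ω)
      (randRun Q A z nx ny t ω) (randRun Q A z nx ny (t + 1) ω) j := by
  have hz : ∀ l, Measurable[others z nx ny (t + 1) i k] (z (t + 1) j l) := fun l =>
    measurable_others_z fun h => hij (by simpa using congrArg (fun p => p.2.1) h)
  have hs := measState_others (z := z) (nx := nx) (ny := ny) (A := A) hL hW hS t i k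
  have h1 := @measurable_resY _ _ _ _ _ Q _ _ _ (others z nx ny (t + 1) i k) hL hW hS hV _ A.b j
    (z (t + 1)) hz (measurable_others_next_x (A := A) hL hW hS t i k j)
    (measurable_others_next_y (A := A) hL hW hS t i k j)
  have h2 := @measurable_resY _ _ _ _ _ Q _ _ _ (others z nx ny (t + 1) i k) hL hW hS hV _ A.b j
    (z (t + 1)) hz (hs.x j) (hs.y j)
  exact h1.sub (h2.const_smul (1 - A.βy))

end Others

/-! ### Recursions for the estimator errors in mean square -/

section Momentum

variable {m d₁ d₂ : ℕ} {Z : Type*} [MeasurableSpace Z] {Q : Problem m d₁ d₂ Z}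
  {A : Params m d₁ d₂} {Ω : Type*} [mΩ : MeasurableSpace Ω] {P : Measure Ω} {σx σy L σ : ℝ}
  {z : ℕ → Fin m → ℕ → Ω → Z} {nx : ℕ → Fin m → Ω → Vec d₁} {ny : ℕ → Fin m → Ω → Vec d₂}

theorem IsRandomInput.memLp_nx (hI : IsRandomInput Q σx σy P z nx ny) (t : ℕ) (i : Fin m) :
    MemLp (nx t i) 2 P := memLp_of_map_gaussian (hI.measX t i) (hI.lawX t i)

theorem IsRandomInput.memLp_ny (hI : IsRandomInput Q σx σy P z nx ny) (t : ℕ) (i : Fin m) :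
    MemLp (ny t i) 2 P := memLp_of_map_gaussian (hI.measY t i) (hI.lawY t i)

theorem integral_noiseSq_le (hI : IsRandomInput Q σx σy P z nx ny) (hm : 0 < m) (t : ℕ) :
    ∫ ω, noiseSq (fun i => nx t i ω) (fun i => ny t i ω) ∂P ≤ σx ^ 2 * d₁ + σy ^ 2 * d₂ := by
  simp only [noiseSq]
  rw [integral_add (integrable_msq (hI.memLp_nx t)) (integrable_msq (hI.memLp_ny t))]
  exact add_le_add
    (integral_msq_le hm (hI.memLp_nx t) fun i =>
      (integral_norm_sq_of_map_gaussian (hI.measX t i) (hI.lawX t i)).le)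
    (integral_msq_le hm (hI.memLp_ny t) fun i =>
      (integral_norm_sq_of_map_gaussian (hI.measY t i) (hI.lawY t i)).le)

variable [IsProbabilityMeasure P]

theorem sqIntState_randRun (hI : IsRandomInput Q σx σy P z nx ny) (hL : 0 < L)
    (hW : Q.WellPosed) (hS : Q.Smooth L) (hV : Q.BoundedVariance σ) (t : ℕ) :
    SqIntState P (randRun Q A z nx ny t) := by
  induction t with
  | zero => exact sqIntState_init hL hW hS hV (hI.measZ 0) (hI.lawZ 0) (hI.memLp_nx 0) (hI.memLp_ny 0)
  | succ t ih =>
    exact ih.next hL hW hS hV (hI.measZ (t + 1)) (hI.lawZ (t + 1)) (hI.memLp_nx (t + 1))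
      (hI.memLp_ny (t + 1))

theorem memLp_innovX (hI : IsRandomInput Q σx σy P z nx ny) (hL : 0 < L)
    (hW : Q.WellPosed) (hS : Q.Smooth L) (hV : Q.BoundedVariance σ) (t : ℕ) (i : Fin m) :
    MemLp (fun ω => innovX Q A (samples z (t + 1) ω) (randRun Q A z nx ny t ω)
      (randRun Q A z nx ny (t + 1) ω) i) 2 P :=
  (memLp_resX hL hW hS hV (sqIntState_randRun hI hL hW hS hV (t + 1)) A.b i (hI.measZ (t + 1))
    (hI.lawZ (t + 1))).sub ((memLp_resX hL hW hS hV (sqIntState_randRun hI hL hW hS hV t) A.b i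
      (hI.measZ (t + 1)) (hI.lawZ (t + 1))).const_smul (1 - A.βx))

theorem memLp_innovY (hI : IsRandomInput Q σx σy P z nx ny) (hL : 0 < L)
    (hW : Q.WellPosed) (hS : Q.Smooth L) (hV : Q.BoundedVariance σ) (t : ℕ) (i : Fin m) :
    MemLp (fun ω => innovY Q A (samples z (t + 1) ω) (randRun Q A z nx ny t ω)
      (randRun Q A z nx ny (t + 1) ω) i) 2 P :=
  (memLp_resY hL hW hS hV (sqIntState_randRun hI hL hW hS hV (t + 1)) A.b i (hI.measZ (t + 1))
    (hI.lawZ (t + 1))).sub ((memLp_resY hL hW hS hV (sqIntState_randRun hI hL hW hS hV t) A.b i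
      (hI.measZ (t + 1)) (hI.lawZ (t + 1))).const_smul (1 - A.βy))

/-- Used both with a previous estimator error and with the innovation of another agent in place of
`a`. -/
theorem integral_inner_innovX_eq_zero (hI : IsRandomInput Q σx σy P z nx ny) (hL : 0 < L)
    (hW : Q.WellPosed) (hS : Q.Smooth L) (hV : Q.BoundedVariance σ) (hb : 1 ≤ A.b) (t : ℕ)
    (i : Fin m) {a : Ω → Vec d₁} (ha : ∀ k, Measurable[others z nx ny (t + 1) i k] a)
    (ha2 : MemLp a 2 P) :
    ∫ ω, inner ℝ (a ω) (innovX Q A (samples z (t + 1) ω) (randRun Q A z nx ny t ω)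
      (randRun Q A z nx ny (t + 1) ω) i) ∂P = 0 := by
  have hξ := isResidual_residualX (P := P) hL hW hS hV i
  have hs := fun k => measState_others (z := z) (nx := nx) (ny := ny) (A := A) hL hW hS t i k
  have q0 := sqIntState_randRun (A := A) hI hL hW hS hV t
  have q1 := sqIntState_randRun (A := A) hI hL hW hS hV (t + 1)
  simp only [innovX, inner_sub_right, inner_smul_right, resX_eq_batchRes hb]
  rw [integral_sub (integrable_inner_of_memLp ha2
      (memLp_batchRes hI hξ A.b (t + 1) (q1.x i) (q1.y i)))
    ((integrable_inner_of_memLp ha2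
      (memLp_batchRes hI hξ A.b (t + 1) (q0.x i) (q0.y i))).const_mul _), integral_const_mul,
    integral_inner_batchRes_eq_zero hI hW hξ ha
      (fun k => measurable_others_next_x hL hW hS t i k i)
      (fun k => measurable_others_next_y hL hW hS t i k i) ha2 (q1.x i) (q1.y i),
    integral_inner_batchRes_eq_zero hI hW hξ ha (fun k => (hs k).x i) (fun k => (hs k).y i) ha2
      (q0.x i) (q0.y i), mul_zero, sub_zero]

theorem integral_inner_innovY_eq_zero (hI : IsRandomInput Q σx σy P z nx ny) (hL : 0 < L)
    (hW : Q.WellPosed) (hS : Q.Smooth L) (hV : Q.BoundedVariance σ) (hb : 1 ≤ A.b) (t : ℕ)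
    (i : Fin m) {a : Ω → Vec d₂} (ha : ∀ k, Measurable[others z nx ny (t + 1) i k] a)
    (ha2 : MemLp a 2 P) :
    ∫ ω, inner ℝ (a ω) (innovY Q A (samples z (t + 1) ω) (randRun Q A z nx ny t ω)
      (randRun Q A z nx ny (t + 1) ω) i) ∂P = 0 := by
  have hξ := isResidual_residualY (P := P) hL hW hS hV i
  have hs := fun k => measState_others (z := z) (nx := nx) (ny := ny) (A := A) hL hW hS t i k
  have q0 := sqIntState_randRun (A := A) hI hL hW hS hV t
  have q1 := sqIntState_randRun (A := A) hI hL hW hS hV (t + 1)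
  simp only [innovY, inner_sub_right, inner_smul_right, resY_eq_batchRes hb]
  rw [integral_sub (integrable_inner_of_memLp ha2
      (memLp_batchRes hI hξ A.b (t + 1) (q1.x i) (q1.y i)))
    ((integrable_inner_of_memLp ha2
      (memLp_batchRes hI hξ A.b (t + 1) (q0.x i) (q0.y i))).const_mul _), integral_const_mul,
    integral_inner_batchRes_eq_zero hI hW hξ ha
      (fun k => measurable_others_next_x hL hW hS t i k i)
      (fun k => measurable_others_next_y hL hW hS t i k i) ha2 (q1.x i) (q1.y i),
    integral_inner_batchRes_eq_zero hI hW hξ ha (fun k => (hs k).x i) (fun k => (hs k).y i) ha2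
      (q0.x i) (q0.y i), mul_zero, sub_zero]

theorem integral_msq_resX_le (hI : IsRandomInput Q σx σy P z nx ny) (hm : 0 < m) (hL : 0 < L)
    (hW : Q.WellPosed) (hS : Q.Smooth L) (hV : Q.BoundedVariance σ) (hb : 1 ≤ A.b) (t : ℕ) :
    ∫ ω, msq (resX Q A.b (samples z (t + 1) ω) (randRun Q A z nx ny t ω)) ∂P ≤ σ ^ 2 := by
  have q0 := sqIntState_randRun (A := A) hI hL hW hS hV t
  have hs := fun i k => measState_others (z := z) (nx := nx) (ny := ny) (A := A) hL hW hS t i k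
  refine integral_msq_le hm (fun i => memLp_resX hL hW hS hV q0 A.b i (hI.measZ (t + 1))
    (hI.lawZ (t + 1))) fun i => ?_
  simp only [resX_eq_batchRes hb]
  exact integral_batchRes_sq_le hI hW (isResidual_residualX hL hW hS hV i)
    (fun k => (hs i k).x i) (fun k => (hs i k).y i) (q0.x i) (q0.y i)

theorem integral_msq_resY_le (hI : IsRandomInput Q σx σy P z nx ny) (hm : 0 < m) (hL : 0 < L)
    (hW : Q.WellPosed) (hS : Q.Smooth L) (hV : Q.BoundedVariance σ) (hb : 1 ≤ A.b) (t : ℕ) :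
    ∫ ω, msq (resY Q A.b (samples z (t + 1) ω) (randRun Q A z nx ny t ω)) ∂P ≤ σ ^ 2 := by
  have q0 := sqIntState_randRun (A := A) hI hL hW hS hV t
  have hs := fun i k => measState_others (z := z) (nx := nx) (ny := ny) (A := A) hL hW hS t i k
  refine integral_msq_le hm (fun i => memLp_resY hL hW hS hV q0 A.b i (hI.measZ (t + 1))
    (hI.lawZ (t + 1))) fun i => ?_
  simp only [resY_eq_batchRes hb]
  exact integral_batchRes_sq_le hI hW (isResidual_residualY hL hW hS hV i)
    (fun k => (hs i k).x i) (fun k => (hs i k).y i) (q0.x i) (q0.y i)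

theorem integrable_moveSq (hI : IsRandomInput Q σx σy P z nx ny) (hL : 0 < L)
    (hW : Q.WellPosed) (hS : Q.Smooth L) (hV : Q.BoundedVariance σ) (t : ℕ) :
    Integrable (fun ω => moveSq (randRun Q A z nx ny t ω) (randRun Q A z nx ny (t + 1) ω)) P := by
  have q0 := sqIntState_randRun (A := A) hI hL hW hS hV t
  have q1 := sqIntState_randRun (A := A) hI hL hW hS hV (t + 1)
  exact (integrable_msq fun i => (q1.x i).sub (q0.x i)).add
    (integrable_msq fun i => (q1.y i).sub (q0.y i))

/-- Two recursions from the same orthogonality: the averaged error, with innovations divided by m,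
enters the descent inequality; the mean square error enters the tracking bound. -/
theorem errX_recursion (hI : IsRandomInput Q σx σy P z nx ny) (hm : 0 < m) (hL : 0 < L)
    (hW : Q.WellPosed) (hS : Q.Smooth L) (hV : Q.BoundedVariance σ) (hb : 1 ≤ A.b) (t : ℕ) :
    ∫ ω, ‖avg (errX Q (randRun Q A z nx ny (t + 1) ω))‖ ^ 2 ∂P ≤
      (1 - A.βx) ^ 2 * ∫ ω, ‖avg (errX Q (randRun Q A z nx ny t ω))‖ ^ 2 ∂P
        + 1 / (m : ℝ) * (6 * L ^ 2 * ∫ ω, moveSq (randRun Q A z nx ny t ω)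
          (randRun Q A z nx ny (t + 1) ω) ∂P + 3 * A.βx ^ 2 * σ ^ 2) ∧
    ∫ ω, msq (errX Q (randRun Q A z nx ny (t + 1) ω)) ∂P ≤
      (1 - A.βx) ^ 2 * ∫ ω, msq (errX Q (randRun Q A z nx ny t ω)) ∂P
        + (6 * L ^ 2 * ∫ ω, moveSq (randRun Q A z nx ny t ω)
          (randRun Q A z nx ny (t + 1) ω) ∂P + 3 * A.βx ^ 2 * σ ^ 2) := by
  have q0 := sqIntState_randRun (A := A) hI hL hW hS hV t
  have he := fun i => memLp_errX (Q := Q) hL hW hS hV q0 i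
  have hinn := fun i => memLp_innovX (A := A) hI hL hW hS hV t i
  have hres := fun i => memLp_resX hL hW hS hV q0 A.b i (hI.measZ (t + 1)) (hI.lawZ (t + 1))
  have hstep := integral_momentum_step (P := P) (c := 1 - A.βx)
    (e' := fun i ω => errX Q (randRun Q A z nx ny (t + 1) ω) i) he hinn
    (fun i ω => errX_next (samples z (t + 1) ω) (fun i => nx (t + 1) i ω)
      (fun i => ny (t + 1) i ω) (randRun Q A z nx ny t ω) i)
    (fun i j => integral_inner_innovX_eq_zero hI hL hW hS hV hb t i
      (fun k => measurable_errX (mΩ := others z nx ny (t + 1) i k) hL hW hS hV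
        (measState_others hL hW hS t i k) j) (he j))
    (fun i j hij => integral_inner_innovX_eq_zero hI hL hW hS hV hb t i
      (fun k => measurable_others_innovX hL hW hS hV t hij.symm k) (hinn j))
  have hmove := integrable_moveSq (A := A) hI hL hW hS hV t
  have hbound : ∫ ω, msq (innovX Q A (samples z (t + 1) ω) (randRun Q A z nx ny t ω)
      (randRun Q A z nx ny (t + 1) ω)) ∂P ≤ 6 * L ^ 2 * ∫ ω, moveSq (randRun Q A z nx ny t ω)
          (randRun Q A z nx ny (t + 1) ω) ∂P + 3 * A.βx ^ 2 * σ ^ 2 := by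
    refine (integral_mono (integrable_msq hinn)
      ((hmove.const_mul (6 * L ^ 2)).add ((integrable_msq hres).const_mul (3 * A.βx ^ 2)))
      fun ω => msq_innovX_le hW hS hV hb _ _ _).trans ?_
    rw [integral_add' (hmove.const_mul (6 * L ^ 2)) ((integrable_msq hres).const_mul _),
      integral_const_mul, integral_const_mul]
    have := integral_msq_resX_le (A := A) hI hm hL hW hS hV hb t
    gcongr
  refine ⟨hstep.1.le.trans ?_, hstep.2.le.trans ?_⟩
  · gcongr
  · gcongr

theorem errY_recursion (hI : IsRandomInput Q σx σy P z nx ny) (hm : 0 < m) (hL : 0 < L)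
    (hW : Q.WellPosed) (hS : Q.Smooth L) (hV : Q.BoundedVariance σ) (hb : 1 ≤ A.b) (t : ℕ) :
    ∫ ω, ‖avg (errY Q (randRun Q A z nx ny (t + 1) ω))‖ ^ 2 ∂P ≤
      (1 - A.βy) ^ 2 * ∫ ω, ‖avg (errY Q (randRun Q A z nx ny t ω))‖ ^ 2 ∂P
        + 1 / (m : ℝ) * (6 * L ^ 2 * ∫ ω, moveSq (randRun Q A z nx ny t ω)
          (randRun Q A z nx ny (t + 1) ω) ∂P + 3 * A.βy ^ 2 * σ ^ 2) ∧
    ∫ ω, msq (errY Q (randRun Q A z nx ny (t + 1) ω)) ∂P ≤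
      (1 - A.βy) ^ 2 * ∫ ω, msq (errY Q (randRun Q A z nx ny t ω)) ∂P
        + (6 * L ^ 2 * ∫ ω, moveSq (randRun Q A z nx ny t ω)
          (randRun Q A z nx ny (t + 1) ω) ∂P + 3 * A.βy ^ 2 * σ ^ 2) := by
  have q0 := sqIntState_randRun (A := A) hI hL hW hS hV t
  have he := fun i => memLp_errY (Q := Q) hL hW hS hV q0 i
  have hinn := fun i => memLp_innovY (A := A) hI hL hW hS hV t i
  have hres := fun i => memLp_resY hL hW hS hV q0 A.b i (hI.measZ (t + 1)) (hI.lawZ (t + 1))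
  have hstep := integral_momentum_step (P := P) (c := 1 - A.βy)
    (e' := fun i ω => errY Q (randRun Q A z nx ny (t + 1) ω) i) he hinn
    (fun i ω => errY_next (samples z (t + 1) ω) (fun i => nx (t + 1) i ω)
      (fun i => ny (t + 1) i ω) (randRun Q A z nx ny t ω) i)
    (fun i j => integral_inner_innovY_eq_zero hI hL hW hS hV hb t i
      (fun k => measurable_errY (mΩ := others z nx ny (t + 1) i k) hL hW hS hV
        (measState_others hL hW hS t i k) j) (he j))
    (fun i j hij => integral_inner_innovY_eq_zero hI hL hW hS hV hb t i
      (fun k => measurable_others_innovY hL hW hS hV t hij.symm k) (hinn j))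
  have hmove := integrable_moveSq (A := A) hI hL hW hS hV t
  have hbound : ∫ ω, msq (innovY Q A (samples z (t + 1) ω) (randRun Q A z nx ny t ω)
      (randRun Q A z nx ny (t + 1) ω)) ∂P ≤ 6 * L ^ 2 * ∫ ω, moveSq (randRun Q A z nx ny t ω)
          (randRun Q A z nx ny (t + 1) ω) ∂P + 3 * A.βy ^ 2 * σ ^ 2 := by
    refine (integral_mono (integrable_msq hinn)
      ((hmove.const_mul (6 * L ^ 2)).add ((integrable_msq hres).const_mul (3 * A.βy ^ 2)))
      fun ω => msq_innovY_le hW hS hV hb _ _ _).trans ?_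
    rw [integral_add' (hmove.const_mul (6 * L ^ 2)) ((integrable_msq hres).const_mul _),
      integral_const_mul, integral_const_mul]
    have := integral_msq_resY_le (A := A) hI hm hL hW hS hV hb t
    gcongr
  refine ⟨hstep.1.le.trans ?_, hstep.2.le.trans ?_⟩
  · gcongr
  · gcongr

theorem integral_msq_errX_zero_le (hI : IsRandomInput Q σx σy P z nx ny) (hm : 0 < m)
    (hL : 0 < L) (hW : Q.WellPosed) (hS : Q.Smooth L) (hV : Q.BoundedVariance σ)
    (hb : 1 ≤ A.b₀) : ∫ ω, msq (errX Q (randRun Q A z nx ny 0 ω)) ∂P ≤ σ ^ 2 / A.b₀ := by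
  have q0 := sqIntState_randRun (A := A) hI hL hW hS hV 0
  refine integral_msq_le hm (fun i => memLp_errX hL hW hS hV q0 i) fun i => ?_
  have e : ∀ ω, errX Q (randRun Q A z nx ny 0 ω) i
      = batchRes A.b₀ (Q.residualX i) (fun k => z 0 i k ω) (A.x₀, A.y₀) := fun ω =>
    resX_eq_batchRes hb (samples z 0 ω) (randRun Q A z nx ny 0 ω) i
  simp only [e]
  exact integral_batchRes_const_sq_le hI hW (isResidual_residualX hL hW hS hV i) hb A.x₀ A.y₀

theorem integral_msq_errY_zero_le (hI : IsRandomInput Q σx σy P z nx ny) (hm : 0 < m)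
    (hL : 0 < L) (hW : Q.WellPosed) (hS : Q.Smooth L) (hV : Q.BoundedVariance σ)
    (hb : 1 ≤ A.b₀) : ∫ ω, msq (errY Q (randRun Q A z nx ny 0 ω)) ∂P ≤ σ ^ 2 / A.b₀ := by
  have q0 := sqIntState_randRun (A := A) hI hL hW hS hV 0
  refine integral_msq_le hm (fun i => memLp_errY hL hW hS hV q0 i) fun i => ?_
  have e : ∀ ω, errY Q (randRun Q A z nx ny 0 ω) i
      = batchRes A.b₀ (Q.residualY i) (fun k => z 0 i k ω) (A.x₀, A.y₀) := fun ω =>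
    resY_eq_batchRes hb (samples z 0 ω) (randRun Q A z nx ny 0 ω) i
  simp only [e]
  exact integral_batchRes_const_sq_le hI hW (isResidual_residualY hL hW hS hV i) hb A.x₀ A.y₀

end Momentum

/-! ### Displacement and disagreement along a run -/

section Consensus

variable {m d₁ d₂ : ℕ} {Z : Type*} [MeasurableSpace Z] {Q : Problem m d₁ d₂ Z}
  {A : Params m d₁ d₂} {L : ℝ} (z : ℕ → Fin m → ℕ → Z) (nx : ℕ → Fin m → Vec d₁)
  (ny : ℕ → Fin m → Vec d₂)

theorem sum_moveSq_le (hm : 0 < m) {lam : ℝ} (hmix : IsMixing A.W lam) (n : ℕ) :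
    ∑ t ∈ Finset.range n, moveSq (run Q A z nx ny t) (run Q A z nx ny (t + 1)) ≤
      6 * (∑ t ∈ Finset.range (n + 1), dev (run Q A z nx ny t).x
        + ∑ t ∈ Finset.range (n + 1), dev (run Q A z nx ny t).y)
      + 3 * A.ηx ^ 2 * ∑ t ∈ Finset.range (n + 1), ‖avg (run Q A z nx ny t).gs‖ ^ 2
      + 3 * A.ηy ^ 2 * ∑ t ∈ Finset.range (n + 1), ‖avg (run Q A z nx ny t).hs‖ ^ 2 := by
  have h1 := (isTracking_x (Q := Q) (A := A) z nx ny).sum_increment_le hmix hm n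
  have h2 := (isTracking_y (Q := Q) (A := A) z nx ny).sum_increment_le hmix hm n
  rw [neg_sq] at h2
  simp only [moveSq, Finset.sum_add_distrib]
  linarith

theorem sum_dev_le_of_run (hm : 0 < m) (hS : Q.Smooth L) (hb : 1 ≤ A.b) {lam : ℝ}
    (hmix : IsMixing A.W lam) (hη0 : 0 ≤ A.ηx) (hη : A.ηx ≤ A.ηy) (n : ℕ) :
    ∑ t ∈ Finset.range (n + 1), dev (run Q A z nx ny t).x
      + ∑ t ∈ Finset.range (n + 1), dev (run Q A z nx ny t).y ≤
    A.ηy ^ 2 / (1 - lam) ^ 4 * (msq (run Q A z nx ny 0).gs + msq (run Q A z nx ny 0).hs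
      + 5 * (L ^ 2 * ∑ t ∈ Finset.range n, moveSq (run Q A z nx ny t) (run Q A z nx ny (t + 1))
        + A.βx ^ 2 * (∑ t ∈ Finset.range (n + 1), msq (errX Q (run Q A z nx ny t))
          + ∑ t ∈ Finset.range n, msq (resX Q A.b (z (t + 1)) (run Q A z nx ny t)))
        + A.βy ^ 2 * (∑ t ∈ Finset.range (n + 1), msq (errY Q (run Q A z nx ny t))
          + ∑ t ∈ Finset.range n, msq (resY Q A.b (z (t + 1)) (run Q A z nx ny t)))
        + 2 * ∑ t ∈ Finset.range (n + 1), noiseSq (nx t) (ny t))) := by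
  have h0 : 0 < 1 - lam := sub_pos.2 hmix.lt_one
  have h1 := (isTracking_x (Q := Q) (A := A) z nx ny).sum_dev_le hmix hm n
  have h2 := (isTracking_y (Q := Q) (A := A) z nx ny).sum_dev_le hmix hm n
  rw [neg_sq] at h2
  have h3 := Finset.sum_le_sum fun t (_ : t ∈ Finset.range n) =>
    msq_increment_le (Q := Q) (A := A) z nx ny hS hb t
  simp only [Finset.sum_add_distrib, ← Finset.mul_sum] at h3
  set X := ∑ t ∈ Finset.range n, msq fun i =>
    (run Q A z nx ny (t + 1)).gs i - (run Q A z nx ny t).gs i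
  set Y := ∑ t ∈ Finset.range n, msq fun i =>
    (run Q A z nx ny (t + 1)).hs i - (run Q A z nx ny t).hs i
  have hX : 0 ≤ X := Finset.sum_nonneg fun _ _ => msq_nonneg _
  have hgs := msq_nonneg (run Q A z nx ny 0).gs
  -- Both variables are put under the larger step ηy, since their signal increments are bounded only
  -- jointly.
  have h4 : A.ηx ^ 2 / (1 - lam) ^ 4 * (msq (run Q A z nx ny 0).gs + X)
      ≤ A.ηy ^ 2 / (1 - lam) ^ 4 * (msq (run Q A z nx ny 0).gs + X) :=
    mul_le_mul_of_nonneg_right (div_le_div_of_nonneg_right (pow_le_pow_left₀ hη0 hη 2)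
      (by positivity)) (add_nonneg hgs hX)
  have hn : ∀ t, 0 ≤ noiseSq (nx t) (ny t) := fun t => add_nonneg (msq_nonneg _) (msq_nonneg _)
  have n1 : ∑ t ∈ Finset.range n, noiseSq (nx (t + 1)) (ny (t + 1))
      ≤ ∑ t ∈ Finset.range (n + 1), noiseSq (nx t) (ny t) := by
    rw [Finset.sum_range_succ']; linarith [hn 0]
  have n2 : ∑ t ∈ Finset.range n, noiseSq (nx t) (ny t)
      ≤ ∑ t ∈ Finset.range (n + 1), noiseSq (nx t) (ny t) := by
    rw [Finset.sum_range_succ]; linarith [hn n]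
  have p1 : ∑ t ∈ Finset.range n, msq (errX Q (run Q A z nx ny t))
      ≤ ∑ t ∈ Finset.range (n + 1), msq (errX Q (run Q A z nx ny t)) := by
    rw [Finset.sum_range_succ]; linarith [msq_nonneg (errX Q (run Q A z nx ny n))]
  have p2 : ∑ t ∈ Finset.range n, msq (errY Q (run Q A z nx ny t))
      ≤ ∑ t ∈ Finset.range (n + 1), msq (errY Q (run Q A z nx ny t)) := by
    rw [Finset.sum_range_succ]; linarith [msq_nonneg (errY Q (run Q A z nx ny n))]
  have p3 := mul_le_mul_of_nonneg_left p1 (sq_nonneg A.βx)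
  have p4 := mul_le_mul_of_nonneg_left p2 (sq_nonneg A.βy)
  refine (add_le_add (h1.trans h4) h2).trans ?_
  rw [← mul_add]
  refine mul_le_mul_of_nonneg_left ?_ (by positivity)
  linarith

theorem msq_add_three_le {d : ℕ} (a b c : Fin m → Vec d) :
    msq (fun i => a i + b i + c i) ≤ 3 * (msq a + msq b + msq c) := by
  have e : 3 * (msq a + msq b + msq c)
      = 1 / (m : ℝ) * ∑ i, 3 * (‖a i‖ ^ 2 + ‖b i‖ ^ 2 + ‖c i‖ ^ 2) := by
    simp only [msq, ← Finset.mul_sum, Finset.sum_add_distrib]; ring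
  rw [e, msq]
  gcongr with i
  have := norm_sum_sq_le Finset.univ ![a i, b i, c i]
  simpa [Fin.sum_univ_three] using this

/-- The first tracking variables start from zero, so the whole initial estimator (error, true
gradient and noise) is a source of disagreement; this is where the initial gradients enter the
constant. -/
theorem msq_gs_zero_le :
    msq (run Q A z nx ny 0).gs + msq (run Q A z nx ny 0).hs ≤
      3 * (msq (errX Q (run Q A z nx ny 0)) + msq (errY Q (run Q A z nx ny 0))
        + 1 / (m : ℝ) * ∑ i, (‖Q.fgradX i A.x₀ A.y₀‖ ^ 2 + ‖Q.fgradY i A.x₀ A.y₀‖ ^ 2)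
        + noiseSq (nx 0) (ny 0)) := by
  have h1 := msq_add_three_le (errX Q (run Q A z nx ny 0)) (fun i => Q.fgradX i A.x₀ A.y₀) (nx 0)
  have h2 := msq_add_three_le (errY Q (run Q A z nx ny 0)) (fun i => Q.fgradY i A.x₀ A.y₀) (ny 0)
  have e1 : (fun i => errX Q (run Q A z nx ny 0) i + Q.fgradX i A.x₀ A.y₀ + nx 0 i)
      = (run Q A z nx ny 0).gs := by
    funext i
    rw [run_gs]
    simp only [errX]
    change _ - Q.fgradX i A.x₀ A.y₀ + _ + _ = _
    abel
  have e2 : (fun i => errY Q (run Q A z nx ny 0) i + Q.fgradY i A.x₀ A.y₀ + ny 0 i)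
      = (run Q A z nx ny 0).hs := by
    funext i
    rw [run_hs]
    simp only [errY]
    change _ - Q.fgradY i A.x₀ A.y₀ + _ + _ = _
    abel
  rw [e1] at h1
  rw [e2] at h2
  have e3 : 1 / (m : ℝ) * ∑ i, (‖Q.fgradX i A.x₀ A.y₀‖ ^ 2 + ‖Q.fgradY i A.x₀ A.y₀‖ ^ 2)
      = msq (fun i => Q.fgradX i A.x₀ A.y₀) + msq (fun i => Q.fgradY i A.x₀ A.y₀) := by
    simp only [msq, Finset.sum_add_distrib]; ring
  rw [e3, noiseSq]
  linarith

end Consensus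

/-! ### Integration of the pathwise linear inequalities -/

section IntegralInequality

variable {Ω : Type*} [MeasurableSpace Ω] {P : Measure Ω}

theorem integral_descent_le [IsProbabilityMeasure P] {g V U K E F N : Ω → ℝ} {a b c d l ν : ℝ}
    (hg : Integrable g P) (hV : Integrable V P) (hU : Integrable U P) (hK : Integrable K P)
    (hE : Integrable E P) (hF : Integrable F P) (hN : Integrable N P) (hd : 0 ≤ d)
    (hν : ∫ ω, N ω ∂P ≤ ν)
    (h : ∀ ω, g ω + a * V ω + b * U ω ≤ c + d * (l * K ω + (E ω + F ω) + N ω)) :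
    ∫ ω, g ω ∂P + a * ∫ ω, V ω ∂P + b * ∫ ω, U ω ∂P ≤
      c + d * (l * ∫ ω, K ω ∂P + (∫ ω, E ω ∂P + ∫ ω, F ω ∂P) + ν) := by
  have j1 := hV.const_mul a
  have j2 := hU.const_mul b
  have j3 := hK.const_mul l
  have j4 := hE.add hF
  have key := integral_mono ((hg.add j1).add j2)
    ((integrable_const c).add (((j3.add j4).add hN).const_mul d)) h
  rw [integral_add' (hg.add j1) j2, integral_add' hg j1,
    integral_add' (integrable_const c) (((j3.add j4).add hN).const_mul d), integral_const_mul,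
    integral_const_mul, integral_const_mul, integral_add' (j3.add j4) hN, integral_add' j3 j4,
    integral_add' hE hF, integral_const_mul, integral_const] at key
  simp only [probReal_univ, one_smul] at key
  have := mul_le_mul_of_nonneg_left hν hd
  linarith

theorem integral_le_three {D K V U : Ω → ℝ} {a b c : ℝ} (hD : Integrable D P)
    (hK : Integrable K P) (hV : Integrable V P) (hU : Integrable U P)
    (h : ∀ ω, D ω ≤ a * K ω + b * V ω + c * U ω) :
    ∫ ω, D ω ∂P ≤ a * ∫ ω, K ω ∂P + b * ∫ ω, V ω ∂P + c * ∫ ω, U ω ∂P := by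
  have j1 := hK.const_mul a
  have j2 := hV.const_mul b
  have j3 := hU.const_mul c
  have key := integral_mono hD ((j1.add j2).add j3) h
  rwa [integral_add' (j1.add j2) j3, integral_add' j1 j2, integral_const_mul, integral_const_mul,
    integral_const_mul] at key

theorem integral_consensus_le {K B D E R F S N : Ω → ℝ} {k l a b s t ν : ℝ}
    (hK : Integrable K P) (hB : Integrable B P) (hD : Integrable D P) (hE : Integrable E P)
    (hR : Integrable R P) (hF : Integrable F P) (hS : Integrable S P) (hN : Integrable N P)
    (hk : 0 ≤ k) (ha : 0 ≤ a) (hb : 0 ≤ b) (hs : ∫ ω, R ω ∂P ≤ s) (ht : ∫ ω, S ω ∂P ≤ t)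
    (hν : ∫ ω, N ω ∂P ≤ ν)
    (h : ∀ ω, K ω ≤ k * (B ω + 5 * (l * D ω + a * (E ω + R ω) + b * (F ω + S ω) + 2 * N ω))) :
    ∫ ω, K ω ∂P ≤ k * (∫ ω, B ω ∂P + 5 * (l * ∫ ω, D ω ∂P + a * (∫ ω, E ω ∂P + s)
      + b * (∫ ω, F ω ∂P + t) + 2 * ν)) := by
  have j1 := hD.const_mul l
  have j2 := (hE.add hR).const_mul a
  have j3 := (hF.add hS).const_mul b
  have j4 := hN.const_mul 2
  have j5 := (((j1.add j2).add j3).add j4).const_mul 5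
  have key := integral_mono hK ((hB.add j5).const_mul k) h
  rw [integral_const_mul, integral_add' hB j5, integral_const_mul,
    integral_add' ((j1.add j2).add j3) j4, integral_add' (j1.add j2) j3, integral_add' j1 j2,
    integral_const_mul, integral_const_mul, integral_const_mul, integral_const_mul,
    integral_add' hE hR, integral_add' hF hS] at key
  refine key.trans (mul_le_mul_of_nonneg_left ?_ hk)
  have h1 := mul_le_mul_of_nonneg_left hs ha
  have h2 := mul_le_mul_of_nonneg_left ht hb
  linarith

theorem integral_initial_le [IsProbabilityMeasure P] {B E F N : Ω → ℝ} {c G s ν : ℝ}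
    (hB : Integrable B P) (hE : Integrable E P) (hF : Integrable F P) (hN : Integrable N P)
    (hEs : ∫ ω, E ω ∂P ≤ s) (hFs : ∫ ω, F ω ∂P ≤ s) (hν : ∫ ω, N ω ∂P ≤ ν) (hc : c ≤ G)
    (h : ∀ ω, B ω ≤ 3 * (E ω + F ω + c + N ω)) :
    ∫ ω, B ω ∂P ≤ 3 * (2 * s + G + ν) := by
  have j1 := hE.add hF
  have j2 := j1.add (integrable_const c)
  have key := integral_mono hB ((j2.add hN).const_mul 3) h
  rw [integral_const_mul, integral_add' j2 hN, integral_add' j1 (integrable_const c),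
    integral_add' hE hF, integral_const] at key
  simp only [probReal_univ, one_smul] at key
  linarith

end IntegralInequality

/-! ### The system of inequalities in expectation -/

section Expectation

variable {m d₁ d₂ : ℕ} {Z : Type*} [MeasurableSpace Z] {Q : Problem m d₁ d₂ Z}
  {A : Params m d₁ d₂} {Ω : Type*} [mΩ : MeasurableSpace Ω] {P : Measure Ω} {σx σy L μ σ : ℝ}
  {z : ℕ → Fin m → ℕ → Ω → Z} {nx : ℕ → Fin m → Ω → Vec d₁} {ny : ℕ → Fin m → Ω → Vec d₂}

/-- Uses 1 − (1 − β)² ≥ β on [0, 1]. The constant source is counted n + 1 times instead of n, to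
match the number T of iterations. -/
theorem momentum_sum_le {a D : ℕ → ℝ} {β E c w s : ℝ} (hβ0 : 0 ≤ β) (hβ1 : β ≤ 1) (hw : 0 ≤ w)
    (hs : 0 ≤ s)
    (ha : ∀ t, 0 ≤ a t) (ha0 : a 0 ≤ E)
    (h : ∀ t, a (t + 1) ≤ (1 - β) ^ 2 * a t + w * (c * D t + s)) (n : ℕ) :
    β * ∑ t ∈ Finset.range (n + 1), a t ≤
      E + w * (c * ∑ t ∈ Finset.range n, D t + s * (n + 1)) := by
  have h1 := sum_succ_le_of_contraction (sq_nonneg (1 - β)) ha h n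
  simp only [← Finset.mul_sum, Finset.sum_add_distrib, Finset.sum_const, Finset.card_range,
    nsmul_eq_mul] at h1
  have h2 : β * ∑ t ∈ Finset.range (n + 1), a t
      ≤ (1 - (1 - β) ^ 2) * ∑ t ∈ Finset.range (n + 1), a t := by
    refine mul_le_mul_of_nonneg_right ?_ (Finset.sum_nonneg fun _ _ => ha _)
    nlinarith
  have h3 : 0 ≤ w * s := by positivity
  linarith

theorem measurable_gradient {d : ℕ} (f : Vec d → ℝ) : Measurable (gradient f) :=
  (InnerProductSpace.toDual ℝ (Vec d)).symm.continuous.measurable.comp (measurable_fderiv ℝ f)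

variable [IsProbabilityMeasure P]

/-- The interface between probability and arithmetic. All letters are expectations, summed over time
except for B: V, U of squared average steps, K of disagreement, D of displacement, Ex, Ey of squared
averaged errors, Px, Py of mean square errors, B of the initial estimators. -/
theorem expected_bounds (hI : IsRandomInput Q σx σy P z nx ny) (hm : 0 < m) (hd : 0 < d₂)
    (hL : 0 < L) (hμ : 0 < μ) (hW : Q.WellPosed) (hS : Q.Smooth L) (hV : Q.BoundedVariance σ)
    (hC : Q.StronglyConcave μ) {lam : ℝ} (hmix : IsMixing A.W lam) (hηx : 0 < A.ηx)
    (hηy : A.ηy = 10 * (L / μ) ^ 2 * A.ηx) (hηL : L * A.ηy ≤ 1 / 1000)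
    (hβx0 : 0 ≤ A.βx) (hβx1 : A.βx ≤ 1) (hβy0 : 0 ≤ A.βy) (hβy1 : A.βy ≤ 1)
    (hb : 1 ≤ A.b) (hb₀ : 1 ≤ A.b₀)
    (hbdd : BddBelow (Set.range Q.Phi)) {Δ : ℝ} (hΔ : Q.Phi A.x₀ - ⨅ x, Q.Phi x ≤ Δ)
    {ystar : Vec d₂} (hys : IsMaxOn (Q.fbar A.x₀) Set.univ ystar) {δ₀ : ℝ}
    (hδ : ‖ystar - A.y₀‖ ^ 2 ≤ δ₀) {G : ℝ}
    (hG : (1 / (m : ℝ)) * ∑ i, (‖Q.fgradX i A.x₀ A.y₀‖ ^ 2 + ‖Q.fgradY i A.x₀ A.y₀‖ ^ 2) ≤ G)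
    (n : ℕ) :
    (∀ t < n + 1, Integrable (fun ω => ‖gradient Q.Phi (xbar Q A (fun s i k => z s i k ω)
      (fun s i => nx s i ω) (fun s i => ny s i ω) t)‖ ^ 2) P) ∧
    ∃ V U K D Ex Ey Px Py B : ℝ, (0 ≤ V ∧ 0 ≤ U ∧ 0 ≤ D) ∧
      ∑ t ∈ Finset.range (n + 1), ∫ ω, ‖gradient Q.Phi (xbar Q A (fun s i k => z s i k ω)
          (fun s i => nx s i ω) (fun s i => ny s i ω) t)‖ ^ 2 ∂P
        + 9 / 10 * V + 39 / 10 * (L / μ) ^ 2 * U ≤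
        2 * Δ / A.ηx + 8 * (L / μ) ^ 2 * (L / 2 * δ₀) / A.ηy + 123 / 10 * (L / μ) ^ 2 *
          (L ^ 2 * K + (Ex + Ey) + (n + 1) * (σx ^ 2 * d₁ + σy ^ 2 * d₂)) ∧
      D ≤ 6 * K + 3 * A.ηx ^ 2 * V + 3 * A.ηy ^ 2 * U ∧
      K ≤ A.ηy ^ 2 / (1 - lam) ^ 4 * (B + 5 * (L ^ 2 * D + A.βx ^ 2 * (Px + (n + 1) * σ ^ 2)
        + A.βy ^ 2 * (Py + (n + 1) * σ ^ 2) + 2 * ((n + 1) * (σx ^ 2 * d₁ + σy ^ 2 * d₂)))) ∧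
      A.βx * Ex ≤ σ ^ 2 / A.b₀
        + 1 / (m : ℝ) * (6 * L ^ 2 * D + 3 * A.βx ^ 2 * σ ^ 2 * (n + 1)) ∧
      A.βy * Ey ≤ σ ^ 2 / A.b₀
        + 1 / (m : ℝ) * (6 * L ^ 2 * D + 3 * A.βy ^ 2 * σ ^ 2 * (n + 1)) ∧
      A.βx * Px ≤ σ ^ 2 / A.b₀ + (6 * L ^ 2 * D + 3 * A.βx ^ 2 * σ ^ 2 * (n + 1)) ∧
      A.βy * Py ≤ σ ^ 2 / A.b₀ + (6 * L ^ 2 * D + 3 * A.βy ^ 2 * σ ^ 2 * (n + 1)) ∧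
      B ≤ 3 * (2 * (σ ^ 2 / A.b₀) + G + (σx ^ 2 * d₁ + σy ^ 2 * d₂)) := by
  have h := Q.smoothConcave hm hL hμ hW hS hV hC
  have hκ : 1 ≤ L / μ := (one_le_div hμ).2 (h.mu_le hd)
  have hη : A.ηx ≤ A.ηy := by
    rw [hηy]
    have : 1 ≤ (L / μ) ^ 2 := one_le_pow₀ hκ
    nlinarith
  have h1lam : 0 < 1 - lam := sub_pos.2 hmix.lt_one
  have q := fun t => sqIntState_randRun (A := A) hI hL hW hS hV t
  set r := randRun Q A z nx ny with hr
  set ν := σx ^ 2 * (d₁ : ℝ) + σy ^ 2 * d₂ with hν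
  have heX := fun t i => memLp_errX (Q := Q) hL hW hS hV (q t) i
  have heY := fun t i => memLp_errY (Q := Q) hL hW hS hV (q t) i
  have hrX := fun t i => memLp_resX hL hW hS hV (q t) A.b i (hI.measZ (t + 1)) (hI.lawZ (t + 1))
  have hrY := fun t i => memLp_resY hL hW hS hV (q t) A.b i (hI.measZ (t + 1)) (hI.lawZ (t + 1))
  have iVt : ∀ t, Integrable (fun ω => ‖avg (r t ω).gs‖ ^ 2) P := fun t =>
    integrable_sq_of_memLp (memLp_avg (q t).gs)
  have iUt : ∀ t, Integrable (fun ω => ‖avg (r t ω).hs‖ ^ 2) P := fun t =>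
    integrable_sq_of_memLp (memLp_avg (q t).hs)
  have iXt : ∀ t, Integrable (fun ω => dev (r t ω).x) P := fun t =>
    integrable_msq fun i => ((q t).x i).sub (memLp_avg (q t).x)
  have iYt : ∀ t, Integrable (fun ω => dev (r t ω).y) P := fun t =>
    integrable_msq fun i => ((q t).y i).sub (memLp_avg (q t).y)
  have iExt : ∀ t, Integrable (fun ω => ‖avg (errX Q (r t ω))‖ ^ 2) P := fun t =>
    integrable_sq_of_memLp (memLp_avg (heX t))
  have iEyt : ∀ t, Integrable (fun ω => ‖avg (errY Q (r t ω))‖ ^ 2) P := fun t =>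
    integrable_sq_of_memLp (memLp_avg (heY t))
  have iPxt : ∀ t, Integrable (fun ω => msq (errX Q (r t ω))) P := fun t => integrable_msq (heX t)
  have iPyt : ∀ t, Integrable (fun ω => msq (errY Q (r t ω))) P := fun t => integrable_msq (heY t)
  have iRxt : ∀ t, Integrable (fun ω => msq (resX Q A.b (samples z (t + 1) ω) (r t ω))) P :=
    fun t => integrable_msq (hrX t)
  have iRyt : ∀ t, Integrable (fun ω => msq (resY Q A.b (samples z (t + 1) ω) (r t ω))) P :=
    fun t => integrable_msq (hrY t)
  have iNt : ∀ t, Integrable (fun ω => noiseSq (fun i => nx t i ω) (fun i => ny t i ω)) P :=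
    fun t => (integrable_msq (hI.memLp_nx t)).add (integrable_msq (hI.memLp_ny t))
  have iDt : ∀ t, Integrable (fun ω => moveSq (r t ω) (r (t + 1) ω)) P := fun t =>
    integrable_moveSq (A := A) hI hL hW hS hV t
  have isum : ∀ {f : ℕ → Ω → ℝ} (_ : ∀ t, Integrable (f t) P) (k : ℕ),
      Integrable (fun ω => ∑ t ∈ Finset.range k, f t ω) P := fun hf k =>
    integrable_finsetSum _ fun t _ => hf t
  have esum : ∀ {f : ℕ → Ω → ℝ} (_ : ∀ t, Integrable (f t) P) (k : ℕ),
      ∫ ω, ∑ t ∈ Finset.range k, f t ω ∂P = ∑ t ∈ Finset.range k, ∫ ω, f t ω ∂P := fun hf k =>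
    integral_finsetSum _ fun t _ => hf t
  have ibound : ∀ k, Integrable (fun ω => 2 * Δ / A.ηx + 8 * (L / μ) ^ 2 * (L / 2 * δ₀) / A.ηy
      + 123 / 10 * (L / μ) ^ 2 *
        (L ^ 2 * (∑ t ∈ Finset.range k, dev (r t ω).x + ∑ t ∈ Finset.range k, dev (r t ω).y)
        + (∑ t ∈ Finset.range k, ‖avg (errX Q (r t ω))‖ ^ 2
          + ∑ t ∈ Finset.range k, ‖avg (errY Q (r t ω))‖ ^ 2)
        + ∑ t ∈ Finset.range k, noiseSq (fun i => nx t i ω) (fun i => ny t i ω))) P := fun k =>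
    (integrable_const _).add ((((((isum iXt k).add (isum iYt k)).const_mul (L ^ 2)).add
      ((isum iExt k).add (isum iEyt k))).add (isum iNt k)).const_mul _)
  have hpath := fun (k : ℕ) (ω : Ω) => sum_gradient_sq_le_of_run (A := A) (fun s i k => z s i k ω)
    (fun s i => nx s i ω) (fun s i => ny s i ω) hm hd hL hμ hW hS hV hC hmix hηx hηy hηL hbdd hΔ
    hys hδ k
  -- The pathwise descent inequality dominates ‖∇Φ‖² by an integrable function, so no growth bound
  -- for ∇Φ is required.
  have igrad : ∀ t, Integrable (fun ω => ‖gradient Q.Phi (xbar Q A (fun s i k => z s i k ω)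
      (fun s i => nx s i ω) (fun s i => ny s i ω) t)‖ ^ 2) P := by
    intro t
    refine (ibound (t + 1)).mono' (((measurable_gradient Q.Phi).comp_aemeasurable
      (memLp_avg (q t).x).aestronglyMeasurable.aemeasurable).norm.pow_const
      2).aestronglyMeasurable (Filter.Eventually.of_forall fun ω => ?_)
    rw [Real.norm_of_nonneg (by positivity)]
    refine le_trans ?_ (hpath (t + 1) ω)
    have k1 := Finset.single_le_sum (f := fun t => ‖gradient Q.Phi (xbar Q A
      (fun s i k => z s i k ω) (fun s i => nx s i ω) (fun s i => ny s i ω) t)‖ ^ 2)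
      (fun _ _ => by positivity) (Finset.self_mem_range_succ t)
    have k2 : 0 ≤ 9 / 10 * ∑ s ∈ Finset.range (t + 1), ‖avg (r s ω).gs‖ ^ 2 := by positivity
    have k3 : 0 ≤ 39 / 10 * (L / μ) ^ 2 * ∑ s ∈ Finset.range (t + 1), ‖avg (r s ω).hs‖ ^ 2 := by
      positivity
    exact (k1.trans (le_add_of_nonneg_right k2)).trans (le_add_of_nonneg_right k3)
  refine ⟨fun t _ => igrad t, ?_⟩
  have hN : ∫ ω, ∑ t ∈ Finset.range (n + 1), noiseSq (fun i => nx t i ω) (fun i => ny t i ω) ∂P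
      ≤ (n + 1) * ν := by
    rw [esum iNt]
    calc _ ≤ ∑ _t ∈ Finset.range (n + 1), ν :=
          Finset.sum_le_sum fun t _ => integral_noiseSq_le hI hm t
      _ = _ := by simp
  have hRx : ∫ ω, ∑ t ∈ Finset.range n, msq (resX Q A.b (samples z (t + 1) ω) (r t ω)) ∂P
      ≤ (n + 1) * σ ^ 2 := by
    rw [esum iRxt]
    calc _ ≤ ∑ _t ∈ Finset.range n, σ ^ 2 :=
          Finset.sum_le_sum fun t _ => integral_msq_resX_le (A := A) hI hm hL hW hS hV hb t
      _ ≤ _ := by simp; nlinarith [sq_nonneg σ]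
  have hRy : ∫ ω, ∑ t ∈ Finset.range n, msq (resY Q A.b (samples z (t + 1) ω) (r t ω)) ∂P
      ≤ (n + 1) * σ ^ 2 := by
    rw [esum iRyt]
    calc _ ≤ ∑ _t ∈ Finset.range n, σ ^ 2 :=
          Finset.sum_le_sum fun t _ => integral_msq_resY_le (A := A) hI hm hL hW hS hV hb t
      _ ≤ _ := by simp; nlinarith [sq_nonneg σ]
  have recX := fun t => errX_recursion (A := A) hI hm hL hW hS hV hb t
  have recY := fun t => errY_recursion (A := A) hI hm hL hW hS hV hb t
  have zX := integral_msq_errX_zero_le (A := A) hI hm hL hW hS hV hb₀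
  have zY := integral_msq_errY_zero_le (A := A) hI hm hL hW hS hV hb₀
  have zX' : ∫ ω, ‖avg (errX Q (r 0 ω))‖ ^ 2 ∂P ≤ σ ^ 2 / A.b₀ :=
    (integral_mono (iExt 0) (iPxt 0) fun ω => norm_avg_sq_le _).trans zX
  have zY' : ∫ ω, ‖avg (errY Q (r 0 ω))‖ ^ 2 ∂P ≤ σ ^ 2 / A.b₀ :=
    (integral_mono (iEyt 0) (iPyt 0) fun ω => norm_avg_sq_le _).trans zY
  have hD0 : 0 ≤ ∫ ω, ∑ t ∈ Finset.range n, moveSq (r t ω) (r (t + 1) ω) ∂P :=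
    integral_nonneg fun ω => Finset.sum_nonneg fun t _ =>
      add_nonneg (msq_nonneg _) (msq_nonneg _)
  refine ⟨∫ ω, ∑ t ∈ Finset.range (n + 1), ‖avg (r t ω).gs‖ ^ 2 ∂P,
    ∫ ω, ∑ t ∈ Finset.range (n + 1), ‖avg (r t ω).hs‖ ^ 2 ∂P,
    ∫ ω, (∑ t ∈ Finset.range (n + 1), dev (r t ω).x
      + ∑ t ∈ Finset.range (n + 1), dev (r t ω).y) ∂P,
    ∫ ω, ∑ t ∈ Finset.range n, moveSq (r t ω) (r (t + 1) ω) ∂P,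
    ∫ ω, ∑ t ∈ Finset.range (n + 1), ‖avg (errX Q (r t ω))‖ ^ 2 ∂P,
    ∫ ω, ∑ t ∈ Finset.range (n + 1), ‖avg (errY Q (r t ω))‖ ^ 2 ∂P,
    ∫ ω, ∑ t ∈ Finset.range (n + 1), msq (errX Q (r t ω)) ∂P,
    ∫ ω, ∑ t ∈ Finset.range (n + 1), msq (errY Q (r t ω)) ∂P,
    ∫ ω, (msq (r 0 ω).gs + msq (r 0 ω).hs) ∂P,
    ⟨integral_nonneg fun ω => Finset.sum_nonneg fun _ _ => by positivity,
      integral_nonneg fun ω => Finset.sum_nonneg fun _ _ => by positivity, hD0⟩,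
    ?_, ?_, ?_, ?_, ?_, ?_, ?_, ?_⟩
  · rw [← esum igrad]
    exact integral_descent_le (isum igrad _) (isum iVt _) (isum iUt _)
      ((isum iXt _).add (isum iYt _)) (isum iExt _) (isum iEyt _) (isum iNt _) (by positivity) hN
      (hpath (n + 1))
  · exact integral_le_three (isum iDt _) ((isum iXt _).add (isum iYt _)) (isum iVt _) (isum iUt _)
      fun ω => sum_moveSq_le (Q := Q) (A := A) (fun s i k => z s i k ω) (fun s i => nx s i ω)
        (fun s i => ny s i ω) hm hmix n
  · exact integral_consensus_le ((isum iXt _).add (isum iYt _))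
      ((integrable_msq (q 0).gs).add (integrable_msq (q 0).hs)) (isum iDt _) (isum iPxt _)
      (isum iRxt _) (isum iPyt _) (isum iRyt _) (isum iNt _) (by positivity) (sq_nonneg _)
      (sq_nonneg _) hRx hRy hN fun ω =>
      sum_dev_le_of_run (Q := Q) (A := A) (fun s i k => z s i k ω) (fun s i => nx s i ω)
        (fun s i => ny s i ω) hm hS hb hmix hηx.le hη n
  · rw [esum iExt, esum iDt]
    exact momentum_sum_le hβx0 hβx1 (by positivity) (by positivity)
      (fun t => integral_nonneg fun ω => by positivity) zX' (fun t => (recX t).1) n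
  · rw [esum iEyt, esum iDt]
    exact momentum_sum_le hβy0 hβy1 (by positivity) (by positivity)
      (fun t => integral_nonneg fun ω => by positivity) zY' (fun t => (recY t).1) n
  · rw [esum iPxt, esum iDt]
    have := momentum_sum_le (a := fun t => ∫ ω, msq (errX Q (r t ω)) ∂P)
      (D := fun t => ∫ ω, moveSq (r t ω) (r (t + 1) ω) ∂P) (w := 1)
      (c := 6 * L ^ 2) (s := 3 * A.βx ^ 2 * σ ^ 2) hβx0 hβx1 (by positivity) (by positivity)
      (fun t => integral_nonneg fun ω => msq_nonneg _) zX
      (fun t => by rw [one_mul]; exact (recX t).2) n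
    rwa [one_mul] at this
  · rw [esum iPyt, esum iDt]
    have := momentum_sum_le (a := fun t => ∫ ω, msq (errY Q (r t ω)) ∂P)
      (D := fun t => ∫ ω, moveSq (r t ω) (r (t + 1) ω) ∂P) (w := 1)
      (c := 6 * L ^ 2) (s := 3 * A.βy ^ 2 * σ ^ 2) hβy0 hβy1 (by positivity) (by positivity)
      (fun t => integral_nonneg fun ω => msq_nonneg _) zY
      (fun t => by rw [one_mul]; exact (recY t).2) n
    rwa [one_mul] at this
  · exact integral_initial_le ((integrable_msq (q 0).gs).add (integrable_msq (q 0).hs)) (iPxt 0)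
      (iPyt 0) (iNt 0) zX zY (integral_noiseSq_le hI hm 0) hG fun ω =>
      msq_gs_zero_le (Q := Q) (A := A) (fun s i k => z s i k ω) (fun s i => nx s i ω)
        (fun s i => ny s i ω)

end Expectation

/-! ### Solving the system and inserting the parameters -/

section Parameters

/-- Here k and δ are L² times disagreement and displacement, and r is the feedback coefficient
between them. As r is tiny, δ can be solved for in terms of sources, V and U; the last two return
with small coefficients and are absorbed on the left of `h1`. -/
theorem gradient_sum_le_of_system {κ r β β' M k δ V U Ex Ey Px Py B E₀ G s T ν N a b S X : ℝ}
    (hκ : 1 ≤ κ) (hM : 1 ≤ M) (hβ0 : 0 < β) (hβ : β ≤ 1 / 20) (hβ' : β' = β / (25 * κ ^ 2))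
    (hr0 : 0 ≤ r) (hr : r ≤ 1 / 1000000) (hq : κ ^ 4 * r ≤ κ ^ 2 / 112500 * (M * β))
    (hV : 0 ≤ V) (hU : 0 ≤ U) (hδ : 0 ≤ δ) (hE : 0 ≤ E₀) (hG : 0 ≤ G) (hs : 0 ≤ s) (hT : 0 ≤ T)
    (hν : 0 ≤ ν) (hN : 0 ≤ N) (ha : a * (100 * κ ^ 4) ≤ r) (hb : b ≤ r)
    (h1 : S + 9 / 10 * V + 39 / 10 * κ ^ 2 * U ≤ X + 123 / 10 * κ ^ 2 * (k + (Ex + Ey) + N))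
    (h2 : δ ≤ 6 * k + 3 * a * V + 3 * b * U)
    (h3 : k ≤ r * (B + 5 * (δ + β ^ 2 * (Px + T * s) + β' ^ 2 * (Py + T * s) + 2 * N)))
    (h4 : β * Ex ≤ E₀ + 1 / M * (6 * δ + 3 * β ^ 2 * s * T))
    (h5 : β' * Ey ≤ E₀ + 1 / M * (6 * δ + 3 * β' ^ 2 * s * T))
    (h6 : β * Px ≤ E₀ + (6 * δ + 3 * β ^ 2 * s * T))
    (h7 : β' * Py ≤ E₀ + (6 * δ + 3 * β' ^ 2 * s * T))
    (h8 : B ≤ 3 * (2 * E₀ + G + ν)) :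
    S ≤ X + 320 * κ ^ 4 * (E₀ / β) + 74 * κ ^ 2 * (β * s * T)
      + κ ^ 2 / 2 * (7 * E₀ + 3 * G + 3 * ν + 12 * (β ^ 2 * s * T) + 10 * N)
      + 13 * κ ^ 2 * N := by
  have hκ0 : 0 < κ := by linarith
  have hκ2 : 1 ≤ κ ^ 2 := one_le_pow₀ hκ
  have hβ'0 : 0 < β' := by rw [hβ']; positivity
  have hβ'β : β' ≤ β := by rw [hβ']; exact div_le_self hβ0.le (by linarith)
  have e25 : 25 * κ ^ 2 * β' = β := by rw [hβ']; field_simp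
  have hsT : 0 ≤ s * T := mul_nonneg hs hT
  set w := β ^ 2 * s * T with hw
  have hw0 : 0 ≤ w := by positivity
  have hw' : β' ^ 2 * s * T ≤ w := by
    rw [hw, mul_assoc, mul_assoc]
    exact mul_le_mul_of_nonneg_right (pow_le_pow_left₀ hβ'0.le hβ'β 2) hsT
  have hw'' : 25 * κ ^ 2 * (β' ^ 2 * s * T) ≤ w := by
    have e : 25 * κ ^ 2 * (β' ^ 2 * s * T) = β' * β * (s * T) := by rw [← e25]; ring
    rw [e, hw, mul_assoc (β ^ 2), sq]
    exact mul_le_mul_of_nonneg_right (mul_le_mul_of_nonneg_right hβ'β hβ0.le) hsT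
  set src := 7 * E₀ + 3 * G + 3 * ν + 12 * w + 10 * N with hsrc
  have hsrc0 : 0 ≤ src := by positivity
  have p1 : β ^ 2 * Px ≤ 1 / 20 * (E₀ + 6 * δ + 3 * w) := by
    have c1 := mul_le_mul_of_nonneg_left h6 hβ0.le
    have c2 := mul_le_mul_of_nonneg_right hβ (by positivity : 0 ≤ E₀ + 6 * δ + 3 * w)
    linarith
  have p2 : β' ^ 2 * Py ≤ 1 / 20 * (E₀ + 6 * δ + 3 * w) := by
    have c1 := mul_le_mul_of_nonneg_left h7 hβ'0.le
    have c3 := mul_le_mul_of_nonneg_left hw' hβ'0.le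
    have c2 := mul_le_mul_of_nonneg_right (hβ'β.trans hβ)
      (by positivity : 0 ≤ E₀ + 6 * δ + 3 * w)
    linarith
  -- The 8 is 5 from the displacement itself plus 3/2 from each of the two mean square errors.
  have hk : k ≤ r * (8 * δ + src) := h3.trans <| mul_le_mul_of_nonneg_left (by linarith) hr0
  -- The ratio of step sizes makes a at most r/(100κ⁴), so V enters only through V'.
  set V' := V / (100 * κ ^ 4) with hV'
  have hV'0 : 0 ≤ V' := by positivity
  have eV : V = 100 * κ ^ 4 * V' := by rw [hV']; field_simp
  have hκV' : κ ^ 2 * V' ≤ V / 100 := by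
    have : κ ^ 2 * V' ≤ κ ^ 2 * (κ ^ 2 * V') :=
      le_mul_of_one_le_left (by positivity) hκ2
    rw [eV]; linarith
  have haV : a * V ≤ r * V' := by
    have c := mul_le_mul_of_nonneg_right ha hV'0
    rw [eV]; linarith
  have hbU : b * U ≤ r * U := mul_le_mul_of_nonneg_right hb hU
  have hrδ := mul_le_mul_of_nonneg_right hr hδ
  set R := 601 / 100 * src + 301 / 100 * V' + 301 / 100 * U with hR
  have hR0 : 0 ≤ R := by positivity
  have hrs : 0 ≤ r * src := by positivity
  have hrV : 0 ≤ r * V' := by positivity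
  have hrU : 0 ≤ r * U := by positivity
  -- The feedback 48 r δ is moved to the left; the surplus hundredths in R pay for it.
  have hδR : δ ≤ r * R := by rw [hR]; linarith
  have hrR := mul_le_mul_of_nonneg_right hr hR0
  have hk' : k ≤ 1 / 1000000 * (R + src) :=
    hk.trans (mul_le_mul hr (by linarith) (by positivity) (by norm_num))
  have hM0 : 0 < M := by linarith
  have hM1 : 1 / M ≤ 1 := (div_le_one hM0).2 hM
  have hwM : 1 / M * w ≤ w := mul_le_of_le_one_left hw0 hM1
  -- The y-momentum is slower by 25κ², so its inequality is multiplied by that factor to match β.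
  have h5' : β * Ey ≤ 25 * κ ^ 2 * E₀ + 1 / M * (150 * κ ^ 2 * δ) + 3 * w := by
    have c := mul_le_mul_of_nonneg_left h5 (by positivity : 0 ≤ 25 * κ ^ 2)
    have c2 := mul_le_mul_of_nonneg_left hw'' (by positivity : 0 ≤ 1 / M)
    rw [← mul_assoc, e25] at c
    linarith
  have hE1 : E₀ ≤ κ ^ 2 * E₀ := le_mul_of_one_le_left hE hκ2
  have hδ1 : 1 / M * δ ≤ 1 / M * (κ ^ 2 * δ) :=
    mul_le_mul_of_nonneg_left (le_mul_of_one_le_left hδ hκ2) (by positivity)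
  have hsum : β * (Ex + Ey) ≤ 26 * κ ^ 2 * E₀ + 156 * (1 / M * (κ ^ 2 * δ)) + 6 * w := by
    linarith
  -- The factor 1/M of the averaged error cancels the M in `hq`, and the remaining β compensates the
  -- later division by β.
  have hδM : κ ^ 2 * (1 / M * (κ ^ 2 * δ)) ≤ κ ^ 2 / 112500 * β * R := by
    have c1 := mul_le_mul_of_nonneg_left hδR (by positivity : 0 ≤ 1 / M * κ ^ 4)
    have c2 := mul_le_mul_of_nonneg_right hq (by positivity : 0 ≤ 1 / M * R)
    have e : κ ^ 2 / 112500 * (M * β) * (1 / M * R) = κ ^ 2 / 112500 * β * R := by field_simp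
    rw [e] at c2
    linarith
  have hEE : κ ^ 2 * (Ex + Ey) ≤ 26 * κ ^ 4 * (E₀ / β) + 6 * κ ^ 2 * (β * s * T)
      + 156 / 112500 * (κ ^ 2 * R) := by
    refine le_of_mul_le_mul_left ?_ hβ0
    have c := mul_le_mul_of_nonneg_left hsum (sq_nonneg κ)
    have e : β * (26 * κ ^ 4 * (E₀ / β) + 6 * κ ^ 2 * (β * s * T)
      + 156 / 112500 * (κ ^ 2 * R)) = 26 * κ ^ 4 * E₀ + 6 * κ ^ 2 * w
      + 156 * (κ ^ 2 / 112500 * β * R) := by rw [hw]; field_simp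
    rw [e]
    linarith
  have hκk := mul_le_mul_of_nonneg_left hk' (sq_nonneg κ)
  have eR : κ ^ 2 * R = 601 / 100 * (κ ^ 2 * src) + 301 / 100 * (κ ^ 2 * V')
      + 301 / 100 * (κ ^ 2 * U) := by rw [hR]; ring
  have hκs : 0 ≤ κ ^ 2 * src := by positivity
  have hκU : 0 ≤ κ ^ 2 * U := by positivity
  have hκN : 0 ≤ κ ^ 2 * N := by positivity
  have hκE : 0 ≤ κ ^ 4 * (E₀ / β) := by positivity
  have hκβ : 0 ≤ κ ^ 2 * (β * s * T) := by positivity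
  linarith

theorem average_le_of_sum_le {κ L ε β c M T b₀ ηx ηy Δ δ₀ G ν σ S : ℝ} (hκ : 1 ≤ κ)
    (hL : 0 < L) (hε0 : 0 < ε) (hε1 : ε ≤ 1) (hM : 0 < M) (hβ0 : 0 < β) (hβ1 : β ≤ ε / 20)
    (hβ2 : β ≤ M * ε ^ 2 / 20) (hc0 : 0 < c) (hc1 : c ≤ 1) (hG : 0 ≤ G) (hν : 0 ≤ ν)
    (hδ₀ : 0 ≤ δ₀) (hηx : ηx = c * β / (750 * κ ^ 3 * L * ε))
    (hηy : ηy = c * β / (75 * κ * L * ε)) (hb₀ : 20 * κ * ε / β ≤ b₀)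
    (hT : 1500 * κ ^ 3 / (c * ε * β) ≤ T) (hT1 : 1 ≤ T)
    (h : S ≤ 2 * Δ / ηx + 8 * κ ^ 2 * (L / 2 * δ₀) / ηy + 320 * κ ^ 4 * (σ ^ 2 / b₀ / β)
      + 74 * κ ^ 2 * (β * σ ^ 2 * T) + κ ^ 2 / 2 * (7 * (σ ^ 2 / b₀) + 3 * G + 3 * ν
        + 12 * (β ^ 2 * σ ^ 2 * T) + 10 * (T * ν)) + 13 * κ ^ 2 * (T * ν)) :
    1 / T * S ≤ (L * |Δ| + L ^ 2 * |δ₀| + 100 * κ ^ 2 * σ ^ 2 + 3 * κ ^ 2 * |G| + 30 * κ ^ 2)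
      * (ε ^ 2 + M * ε ^ 2 + ν) := by
  have hκ0 : 0 < κ := by linarith
  have hκ2 : 1 ≤ κ ^ 2 := one_le_pow₀ hκ
  have hκ3 : 1 ≤ κ ^ 3 := one_le_pow₀ hκ
  have hT0 : 0 < T := by linarith
  have hηx0 : 0 < ηx := by rw [hηx]; positivity
  have hηy0 : 0 < ηy := by rw [hηy]; positivity
  have hb₀0 : 0 < b₀ := lt_of_lt_of_le (by positivity) hb₀
  have hβle : β ≤ 1 := by linarith
  have hβε : ε * β ≤ ε ^ 2 := by nlinarith
  -- The factor 1/c in T is needed only against the step sizes; elsewhere c ≤ 1 discards it.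
  have t1 : 1 / T ≤ ε * β / (1500 * κ ^ 3) := by
    rw [div_le_iff₀ hT0]
    have e : ε * β / (1500 * κ ^ 3) * (1500 * κ ^ 3 / (c * ε * β)) = 1 / c := by field_simp
    calc (1 : ℝ) ≤ 1 / c := (one_le_div hc0).2 hc1
      _ = ε * β / (1500 * κ ^ 3) * (1500 * κ ^ 3 / (c * ε * β)) := e.symm
      _ ≤ _ := mul_le_mul_of_nonneg_left hT (by positivity)
  have tx : 2 / (T * ηx) ≤ L * ε ^ 2 := by
    rw [div_le_iff₀ (by positivity)]
    have e : L * ε ^ 2 * (1500 * κ ^ 3 / (c * ε * β) * ηx) = 2 := by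
      rw [hηx]; field_simp; norm_num
    have := mul_le_mul_of_nonneg_left (mul_le_mul_of_nonneg_right hT hηx0.le)
      (by positivity : 0 ≤ L * ε ^ 2)
    linarith
  have ty : 4 * κ ^ 2 * L / (T * ηy) ≤ L ^ 2 * ε ^ 2 := by
    rw [div_le_iff₀ (by positivity)]
    have e : L ^ 2 * ε ^ 2 * (1500 * κ ^ 3 / (c * ε * β) * ηy) = 20 * κ ^ 2 * L := by
      rw [hηy]; field_simp; norm_num
    have := mul_le_mul_of_nonneg_left (mul_le_mul_of_nonneg_right hT hηy0.le)
      (by positivity : 0 ≤ L ^ 2 * ε ^ 2)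
    have : 0 ≤ κ ^ 2 * L := by positivity
    linarith
  have hE : σ ^ 2 / b₀ ≤ σ ^ 2 * β / (20 * κ * ε) := by
    rw [div_le_iff₀ hb₀0]
    have e : σ ^ 2 * β / (20 * κ * ε) * (20 * κ * ε / β) = σ ^ 2 := by field_simp
    have := mul_le_mul_of_nonneg_left hb₀ (by positivity : 0 ≤ σ ^ 2 * β / (20 * κ * ε))
    linarith
  have hE0 : 0 ≤ σ ^ 2 / b₀ := by positivity
  -- Together T and b₀ supply β²/κ⁴, which cancels the amplification κ⁴/β of the initial estimator
  -- error.
  have hET : 1 / T * (σ ^ 2 / b₀) ≤ σ ^ 2 * β ^ 2 / (30000 * κ ^ 4) := by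
    refine (mul_le_mul t1 hE hE0 (by positivity)).trans_eq ?_
    field_simp; ring
  have q1 : 1 / T * (2 * Δ / ηx) ≤ L * |Δ| * ε ^ 2 := by
    have e : 1 / T * (2 * Δ / ηx) = 2 / (T * ηx) * Δ := by field_simp
    rw [e]
    calc _ ≤ 2 / (T * ηx) * |Δ| := mul_le_mul_of_nonneg_left (le_abs_self _) (by positivity)
      _ ≤ L * ε ^ 2 * |Δ| := mul_le_mul_of_nonneg_right tx (abs_nonneg _)
      _ = _ := by ring
  have q2 : 1 / T * (8 * κ ^ 2 * (L / 2 * δ₀) / ηy) ≤ L ^ 2 * δ₀ * ε ^ 2 := by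
    have e : 1 / T * (8 * κ ^ 2 * (L / 2 * δ₀) / ηy) = 4 * κ ^ 2 * L / (T * ηy) * δ₀ := by
      field_simp; ring
    rw [e]
    have := mul_le_mul_of_nonneg_right ty hδ₀
    linarith
  have q3 : 1 / T * (320 * κ ^ 4 * (σ ^ 2 / b₀ / β)) ≤ σ ^ 2 * β := by
    have c1 := mul_le_mul_of_nonneg_left hET (by positivity : 0 ≤ 320 * κ ^ 4 / β)
    have e : 320 * κ ^ 4 / β * (σ ^ 2 * β ^ 2 / (30000 * κ ^ 4)) = 320 / 30000 * (σ ^ 2 * β) := by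
      field_simp
    have e2 : 1 / T * (320 * κ ^ 4 * (σ ^ 2 / b₀ / β))
        = 320 * κ ^ 4 / β * (1 / T * (σ ^ 2 / b₀)) := by ring
    have : 0 ≤ σ ^ 2 * β := by positivity
    linarith
  have hσβ : σ ^ 2 * β ^ 2 ≤ σ ^ 2 * β :=
    mul_le_mul_of_nonneg_left (by nlinarith) (sq_nonneg σ)
  have q4 : 1 / T * (σ ^ 2 / b₀) ≤ σ ^ 2 * β := by
    refine hET.trans ((div_le_self (by positivity) ?_).trans hσβ)
    have : 1 ≤ κ ^ 4 := one_le_pow₀ hκ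
    linarith
  have q5 : 1 / T * G ≤ G * ε ^ 2 := by
    have c1 : ε * β / (1500 * κ ^ 3) ≤ ε ^ 2 :=
      (div_le_self (by positivity) (by linarith)).trans hβε
    have := mul_le_mul_of_nonneg_right (t1.trans c1) hG
    linarith
  have q6 : 1 / T * ν ≤ ν := mul_le_of_le_one_left hν ((div_le_one hT0).2 hT1)
  have e1 : 1 / T * T = 1 := by field_simp
  -- Sampling variance contributes σ²β to the average; this is the origin of the term mε².
  have hσM : σ ^ 2 * β ≤ σ ^ 2 * (M * ε ^ 2 / 20) := mul_le_mul_of_nonneg_left hβ2 (sq_nonneg σ)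
  have main : 1 / T * S ≤ (L * |Δ| + L ^ 2 * δ₀ + 3 / 2 * κ ^ 2 * G) * ε ^ 2
      + 100 * κ ^ 2 * (σ ^ 2 * (M * ε ^ 2 / 20)) + 20 * κ ^ 2 * ν := by
    have c := mul_le_mul_of_nonneg_left h (by positivity : 0 ≤ 1 / T)
    have e : 1 / T * (2 * Δ / ηx + 8 * κ ^ 2 * (L / 2 * δ₀) / ηy
        + 320 * κ ^ 4 * (σ ^ 2 / b₀ / β) + 74 * κ ^ 2 * (β * σ ^ 2 * T)
        + κ ^ 2 / 2 * (7 * (σ ^ 2 / b₀) + 3 * G + 3 * ν + 12 * (β ^ 2 * σ ^ 2 * T)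
          + 10 * (T * ν)) + 13 * κ ^ 2 * (T * ν)) =
        1 / T * (2 * Δ / ηx) + 1 / T * (8 * κ ^ 2 * (L / 2 * δ₀) / ηy)
        + 1 / T * (320 * κ ^ 4 * (σ ^ 2 / b₀ / β)) + 74 * (κ ^ 2 * (σ ^ 2 * β)) * (1 / T * T)
        + (7 / 2 * (κ ^ 2 * (1 / T * (σ ^ 2 / b₀))) + 3 / 2 * (κ ^ 2 * (1 / T * G))
          + 3 / 2 * (κ ^ 2 * (1 / T * ν)) + 6 * (κ ^ 2 * (σ ^ 2 * β ^ 2)) * (1 / T * T)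
          + 5 * (κ ^ 2 * ν) * (1 / T * T)) + 13 * (κ ^ 2 * ν) * (1 / T * T) := by ring
    rw [e, e1] at c
    have r1 := mul_le_mul_of_nonneg_left q4 (sq_nonneg κ)
    have r2 := mul_le_mul_of_nonneg_left q5 (sq_nonneg κ)
    have r3 := mul_le_mul_of_nonneg_left q6 (sq_nonneg κ)
    have r4 := mul_le_mul_of_nonneg_left hσβ (sq_nonneg κ)
    have r5 := mul_le_mul_of_nonneg_left hσM (sq_nonneg κ)
    have r6 : σ ^ 2 * β ≤ κ ^ 2 * (σ ^ 2 * β) := le_mul_of_one_le_left (by positivity) hκ2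
    have r7 : 0 ≤ κ ^ 2 * (σ ^ 2 * β) := by positivity
    have r8 : 0 ≤ κ ^ 2 * ν := by positivity
    linarith
  refine main.trans ?_
  rw [abs_of_nonneg hδ₀, abs_of_nonneg hG]
  set a := L * |Δ| + L ^ 2 * δ₀
  have ha : 0 ≤ a := by positivity
  have w1 : 0 ≤ a * (M * ε ^ 2 + ν) := by positivity
  have w2 : 0 ≤ κ ^ 2 * G * (ε ^ 2 + M * ε ^ 2 + ν) := by positivity
  have w3 : 0 ≤ κ ^ 2 * G * (M * ε ^ 2 + ν) := by positivity
  have w4 : 0 ≤ κ ^ 2 * σ ^ 2 * (ε ^ 2 + M * ε ^ 2 + ν) := by positivity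
  have w5 : 0 ≤ κ ^ 2 * σ ^ 2 * (ε ^ 2 + ν) := by positivity
  have w6 : 0 ≤ κ ^ 2 * (ε ^ 2 + M * ε ^ 2) := by positivity
  have w7 : 0 ≤ κ ^ 2 * ν := by positivity
  linarith

end Parameters

/-! ### The bound for the prescribed step sizes -/

section Bound

variable {m d₁ d₂ : ℕ} {Z : Type*} [MeasurableSpace Z] {Q : Problem m d₁ d₂ Z}
  {A : Params m d₁ d₂} {Ω : Type*} [MeasurableSpace Ω] {P : Measure Ω} {σx σy L μ σ : ℝ}
  {z : ℕ → Fin m → ℕ → Ω → Z} {nx : ℕ → Fin m → Ω → Vec d₁} {ny : ℕ → Fin m → Ω → Vec d₂}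

theorem avgGradBound_of_stepSizes [IsProbabilityMeasure P]
    (hI : IsRandomInput Q σx σy P z nx ny) (hm : 0 < m) (hd : 0 < d₂)
    (hL : 0 < L) (hμ : 0 < μ) (hW : Q.WellPosed) (hS : Q.Smooth L) (hV : Q.BoundedVariance σ)
    (hC : Q.StronglyConcave μ) {lam : ℝ} (hmix : IsMixing A.W lam)
    (hbdd : BddBelow (Set.range Q.Phi)) {Δ : ℝ} (hΔ : Q.Phi A.x₀ - ⨅ x, Q.Phi x ≤ Δ)
    {ystar : Vec d₂} (hys : IsMaxOn (Q.fbar A.x₀) Set.univ ystar) {δ₀ : ℝ}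
    (hδ : ‖ystar - A.y₀‖ ^ 2 ≤ δ₀) {G : ℝ}
    (hG : (1 / (m : ℝ)) * ∑ i, (‖Q.fgradX i A.x₀ A.y₀‖ ^ 2 + ‖Q.fgradY i A.x₀ A.y₀‖ ^ 2) ≤ G)
    (hb : 1 ≤ A.b) {ε : ℝ} (hε0 : 0 < ε) (hε1 : ε ≤ 1) (hβx : A.βx = ε * min 1 (m * ε) / 20)
    (hβy : A.βy = A.βx / (25 * (L / μ) ^ 2))
    (hηx : A.ηx = (1 - lam) ^ 2 * A.βx / (750 * (L / μ) ^ 3 * L * ε))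
    (hηy : A.ηy = (1 - lam) ^ 2 * A.βx / (75 * (L / μ) * L * ε))
    (hb₀ : A.b₀ = ⌈20 * (L / μ) * ε / A.βx⌉₊) {T : ℕ}
    (hT : T = ⌈1500 * (L / μ) ^ 3 / ((1 - lam) ^ 2 * ε * A.βx)⌉₊) :
    AvgGradBound Q A P z nx ny T
      ((L * |Δ| + L ^ 2 * |δ₀| + 100 * (L / μ) ^ 2 * σ ^ 2 + 3 * (L / μ) ^ 2 * |G|
        + 30 * (L / μ) ^ 2) * (ε ^ 2 + m * ε ^ 2 + (σx ^ 2 * d₁ + σy ^ 2 * d₂))) := by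
  have h := Q.smoothConcave hm hL hμ hW hS hV hC
  have hκ : 1 ≤ L / μ := (one_le_div hμ).2 (h.mu_le hd)
  have hM : (1 : ℝ) ≤ m := by exact_mod_cast hm
  have hM0 : (0 : ℝ) < m := by linarith
  have h1 : 0 < 1 - lam := sub_pos.2 hmix.lt_one
  have h1' : 1 - lam ≤ 1 := by linarith [hmix.lam_nonneg]
  have hc0 : 0 < (1 - lam) ^ 2 := by positivity
  have hc1 : (1 - lam) ^ 2 ≤ 1 := pow_le_one₀ h1.le h1'
  have hβ0 : 0 < A.βx := by
    have : 0 < min 1 (m * ε) := lt_min one_pos (by positivity)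
    rw [hβx]; positivity
  have hβ1 : A.βx ≤ ε / 20 := by
    have := mul_le_mul_of_nonneg_left (min_le_left 1 (m * ε)) hε0.le
    linarith
  have hβ2 : A.βx ≤ m * ε ^ 2 / 20 := by
    have := mul_le_mul_of_nonneg_left (min_le_right 1 (m * ε)) hε0.le
    linarith
  have hβ20 : A.βx ≤ 1 / 20 := by linarith
  have hT' : 1500 * (L / μ) ^ 3 / ((1 - lam) ^ 2 * ε * A.βx) ≤ T := hT ▸ Nat.le_ceil _
  have hb₀' : 20 * (L / μ) * ε / A.βx ≤ A.b₀ := hb₀ ▸ Nat.le_ceil _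
  have hb₀1 : 1 ≤ A.b₀ := by rw [hb₀]; exact Nat.one_le_ceil_iff.2 (by positivity)
  have hT1 : 1 ≤ T := by rw [hT]; exact Nat.one_le_ceil_iff.2 (by positivity)
  have hE := expected_bounds (A := A) (P := P) (z := z) (nx := nx) (ny := ny) (σx := σx)
    (σy := σy) hI hm hd hL hμ hW hS hV hC hmix
  set κ := L / μ with hκdef
  have hκ0 : 0 < κ := by linarith
  have hηx0 : 0 < A.ηx := by rw [hηx]; positivity
  have hηxy : A.ηy = 10 * κ ^ 2 * A.ηx := by rw [hηx, hηy]; field_simp; norm_num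
  -- The factor (1 − λ)² cancels the tracking constant (1 − λ)⁻⁴ after squaring, leaving ρ²
  -- independent of the network.
  have hρ : L * A.ηy = (1 - lam) ^ 2 * (A.βx / (75 * κ * ε)) := by rw [hηy]; field_simp
  set ρ := A.βx / (75 * κ * ε) with hρdef
  have hρ0 : 0 ≤ ρ := by positivity
  have hρ1 : ρ ≤ 1 / 1500 := by
    rw [hρdef, div_le_iff₀ (by positivity)]
    have := le_mul_of_one_le_left hε0.le hκ
    linarith
  have hLη : L * A.ηy ≤ ρ := by rw [hρ]; exact mul_le_of_le_one_left hρ0 hc1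
  have hκ2 : 1 ≤ κ ^ 2 := one_le_pow₀ hκ
  have hβy0 : 0 ≤ A.βy := by rw [hβy]; positivity
  have hβyx : A.βy ≤ A.βx := by rw [hβy]; exact div_le_self hβ0.le (by linarith)
  -- T iterates are linked by T − 1 transitions.
  obtain ⟨n, rfl⟩ : ∃ n, T = n + 1 := ⟨T - 1, by omega⟩
  obtain ⟨hint, V, U, K, D, Ex, Ey, Px, Py, B, ⟨hV0, hU0, hD0⟩, b1, b2, b3, b4, b5, b6, b7, b8⟩ :=
    hE hηx0 hηxy (by linarith) hβ0.le (by linarith) hβy0 (by linarith) hb hb₀1 hbdd hΔ hys hδ hG n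
  refine ⟨fun x => (h.hasGradientAt_max x).differentiableAt, hint, ?_⟩
  push_cast at hT' ⊢
  have hG0 : 0 ≤ G := le_trans (by positivity) hG
  have hδ0 : 0 ≤ δ₀ := le_trans (by positivity) hδ
  have hν : 0 ≤ σx ^ 2 * (d₁ : ℝ) + σy ^ 2 * d₂ := by positivity
  have hn : (0 : ℝ) ≤ n := n.cast_nonneg
  refine average_le_of_sum_le hκ hL hε0 hε1 hM0 hβ0 hβ1 hβ2 hc0 hc1 hG0 hν hδ0 hηx hηy hb₀' hT'
    (by linarith) ?_
  have hηy2 : (L * A.ηy) ^ 2 ≤ ρ ^ 2 :=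
    pow_le_pow_left₀ (mul_nonneg hL.le (hηxy ▸ by positivity)) hLη 2
  have hLr : L ^ 2 * (A.ηy ^ 2 / (1 - lam) ^ 4) = ρ ^ 2 := by
    have e : L ^ 2 * (A.ηy ^ 2 / (1 - lam) ^ 4) = (L * A.ηy) ^ 2 / (1 - lam) ^ 4 := by ring
    rw [e, hρ]; field_simp
  refine gradient_sum_le_of_system (k := L ^ 2 * K) (δ := L ^ 2 * D) (r := ρ ^ 2)
    (a := L ^ 2 * A.ηx ^ 2) (b := L ^ 2 * A.ηy ^ 2) (Px := Px) (Py := Py) (B := B) hκ hM hβ0 hβ20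
    hβy (sq_nonneg ρ) ?_ ?_ hV0 hU0 (by positivity) (by positivity) hG0 (sq_nonneg σ)
    (by positivity) hν (by positivity) ?_ ?_ b1 ?_ ?_ ?_ ?_ ?_ ?_ b8
  · exact (pow_le_pow_left₀ hρ0 hρ1 2).trans (by norm_num)
  -- With βx ≤ mε²/20 the constant is 5625 · 20 = 112500.
  · have e : κ ^ 4 * ρ ^ 2 = κ ^ 2 / 5625 * (A.βx / ε ^ 2) * A.βx := by
      rw [hρdef]; field_simp; norm_num
    have h2 : A.βx / ε ^ 2 ≤ m / 20 := by
      rw [div_le_iff₀ (by positivity)]; linarith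
    have h3 := mul_le_mul_of_nonneg_right h2 (by positivity : 0 ≤ κ ^ 2 / 5625 * A.βx)
    rw [e]; linarith
  · have e : L ^ 2 * A.ηx ^ 2 * (100 * κ ^ 4) = (L * A.ηy) ^ 2 := by rw [hηxy]; ring
    rwa [e]
  · rwa [← mul_pow]
  · have := mul_le_mul_of_nonneg_left b2 (sq_nonneg L)
    linarith
  · have := mul_le_mul_of_nonneg_left b3 (sq_nonneg L)
    rwa [← mul_assoc, hLr] at this
  · rwa [← mul_assoc 6]
  · rwa [← mul_assoc 6]
  · rwa [← mul_assoc 6]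
  · rwa [← mul_assoc 6]

end Bound
end DPMix

/-! ### The two parameter choices -/

theorem theorem1 (L μ σ Δ δ₀ G : ℝ) (hL : 0 < L) (hμ : 0 < μ) :
    ∃ C : ℝ, 0 < C ∧
      ∀ (m d₁ d₂ : ℕ) (_ : 0 < m) (_ : 0 < d₂)
        (Z : Type*) [MeasurableSpace Z] (Q : DPMix.Problem m d₁ d₂ Z)
        (_ : Q.WellPosed) (_ : Q.Smooth L) (_ : Q.BoundedVariance σ)
        (_ : BddBelow (Set.range Q.Phi)) (_ : Q.StronglyConcave μ)
        (W : Matrix (Fin m) (Fin m) ℝ) (lam : ℝ) (_ : DPMix.IsMixing W lam)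
        -- the starting point, and the quantities at it on which the constant may depend
        (x₀ : DPMix.Vec d₁) (y₀ ystar : DPMix.Vec d₂)
        (_ : Q.Phi x₀ - ⨅ x, Q.Phi x ≤ Δ)
        (_ : IsMaxOn (Q.fbar x₀) Set.univ ystar) (_ : ‖ystar - y₀‖ ^ 2 ≤ δ₀)
        (_ : (1 / (m : ℝ)) * ∑ i, (‖Q.fgradX i x₀ y₀‖ ^ 2 + ‖Q.fgradY i x₀ y₀‖ ^ 2) ≤ G)
        -- the samples and the privacy noise
        (σx σy : ℝ) (_ : 0 ≤ σx) (_ : 0 ≤ σy)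
        (Ω : Type*) [MeasurableSpace Ω] (P : MeasureTheory.Measure Ω)
        [MeasureTheory.IsProbabilityMeasure P]
        (z : ℕ → Fin m → ℕ → Ω → Z) (nx : ℕ → Fin m → Ω → DPMix.Vec d₁)
        (ny : ℕ → Fin m → Ω → DPMix.Vec d₂) (_ : DPMix.IsRandomInput Q σx σy P z nx ny)
        (b : ℕ) (_ : 1 ≤ b),
        -- first choice of parameters
        (∀ (ε βx βy ηx ηy : ℝ) (T b₀ : ℕ), 0 < ε → ε ≤ 1 →
          βx = ε * min 1 (m * ε) / 20 →
          βy = βx / (25 * (L / μ) ^ 2) →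
          ηx = (1 - lam) ^ 2 * βx / (750 * (L / μ) ^ 3 * L * ε) →
          ηy = (1 - lam) ^ 2 * βx / (75 * (L / μ) * L * ε) →
          b₀ = ⌈20 * (L / μ) * ε / βx⌉₊ →
          T = ⌈1500 * (L / μ) ^ 3 / ((1 - lam) ^ 2 * ε * βx)⌉₊ →
          DPMix.AvgGradBound Q ⟨W, x₀, y₀, ηx, ηy, βx, βy, b₀, b⟩ P z nx ny T
            (C * (ε ^ 2 + m * ε ^ 2 + (σx ^ 2 * d₁ + σy ^ 2 * d₂)))) ∧
        -- second choice of parameters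
        (∀ (T₀ ε βx βy ηx ηy : ℝ) (T b₀ : ℕ), 10 * (m : ℝ) ^ 2 ≤ T₀ →
          ε = 1 / (m * T₀) ^ (1 / 3 : ℝ) →
          βx = (m : ℝ) ^ (1 / 3 : ℝ) / (20 * T₀ ^ (2 / 3 : ℝ)) →
          βy = βx / (25 * (L / μ) ^ 2) →
          ηx = (1 - lam) ^ 2 * βx / (750 * (L / μ) ^ 3 * L * ε) →
          ηy = (1 - lam) ^ 2 * βx / (75 * (L / μ) * L * ε) →
          b₀ = ⌈20 * (L / μ) * ε / βx⌉₊ →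
          T = ⌈30000 * (L / μ) ^ 3 * T₀ / (1 - lam) ^ 2⌉₊ →
          DPMix.AvgGradBound Q ⟨W, x₀, y₀, ηx, ηy, βx, βy, b₀, b⟩ P z nx ny T
            (C * (1 / (m * T₀) ^ (2 / 3 : ℝ) + 1 / T₀
              + (m : ℝ) ^ (1 / 3 : ℝ) / T₀ ^ (2 / 3 : ℝ)
              + (σx ^ 2 * d₁ + σy ^ 2 * d₂)))) := by
  -- Absolute values keep the constant positive for arbitrary real Δ, δ₀, G, as it is fixed before
  -- the problem is given.
  refine ⟨L * |Δ| + L ^ 2 * |δ₀| + 100 * (L / μ) ^ 2 * σ ^ 2 + 3 * (L / μ) ^ 2 * |G|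
    + 30 * (L / μ) ^ 2, by positivity, ?_⟩
  intro m d₁ d₂ hm hd Z _ Q hW hS hV hbdd hC W lam hmix x₀ y₀ ystar hΔ hys hδ hG σx σy _ _ Ω _ P _
    z nx ny hI b hb
  have key := fun (ε βx βy ηx ηy : ℝ) (T b₀ : ℕ) =>
    DPMix.avgGradBound_of_stepSizes (A := ⟨W, x₀, y₀, ηx, ηy, βx, βy, b₀, b⟩) (T := T) (ε := ε)
      hI hm hd hL hμ hW hS hV hC hmix hbdd hΔ hys hδ hG hb
  refine ⟨fun ε βx βy ηx ηy T b₀ hε0 hε1 h1 h2 h3 h4 h5 h6 =>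
    key ε βx βy ηx ηy T b₀ hε0 hε1 h1 h2 h3 h4 h5 h6, ?_⟩
  intro T₀ ε βx βy ηx ηy T b₀ hT₀ hε h1 h2 h3 h4 h5 h6
  have hM : (1 : ℝ) ≤ m := by exact_mod_cast hm
  have hM0 : (0 : ℝ) < m := by linarith
  have hT0 : 10 ≤ T₀ := by nlinarith
  have hT00 : 0 < T₀ := by linarith
  -- In terms of the cube roots p and q every fractional power becomes a monomial.
  set p := (m : ℝ) ^ (1 / 3 : ℝ) with hp
  set q := T₀ ^ (1 / 3 : ℝ) with hq
  have hp0 : 0 < p := Real.rpow_pos_of_pos hM0 _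
  have hq0 : 0 < q := Real.rpow_pos_of_pos hT00 _
  have hp3 : p ^ 3 = m := by
    rw [hp, ← Real.rpow_natCast, ← Real.rpow_mul hM0.le]; norm_num
  have hq3 : q ^ 3 = T₀ := by
    rw [hq, ← Real.rpow_natCast, ← Real.rpow_mul hT00.le]; norm_num
  have hq2 : T₀ ^ (2 / 3 : ℝ) = q ^ 2 := by
    rw [hq, ← Real.rpow_natCast, ← Real.rpow_mul hT00.le]; norm_num
  have hp2 : (m : ℝ) ^ (2 / 3 : ℝ) = p ^ 2 := by
    rw [hp, ← Real.rpow_natCast, ← Real.rpow_mul hM0.le]; norm_num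
  have hε' : ε = 1 / (p * q) := by rw [hε, Real.mul_rpow hM0.le hT00.le]
  have hp1 : 1 ≤ p := Real.one_le_rpow hM (by norm_num)
  -- After cubing this is m² ≤ T₀; it says mε ≤ 1, so the minimum in the first choice is mε.
  have hpq : p ^ 2 ≤ q := by
    refine le_of_pow_le_pow_left₀ three_ne_zero hq0.le ?_
    have e : (p ^ 2) ^ 3 = (m : ℝ) ^ 2 := by rw [← hp3]; ring
    rw [e, hq3]
    nlinarith
  have hq1 : 1 ≤ q := le_trans (one_le_pow₀ hp1) hpq
  have hε0 : 0 < ε := by rw [hε']; positivity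
  have hε1 : ε ≤ 1 := by
    rw [hε', div_le_one (by positivity)]
    exact one_le_mul_of_one_le_of_one_le hp1 hq1
  have hmε : m * ε = p ^ 2 / q := by rw [hε', ← hp3]; field_simp
  have hβ : βx = ε * min 1 (m * ε) / 20 := by
    rw [min_eq_right (by rw [hmε]; exact (div_le_one hq0).2 hpq), hmε, hε', h1, hq2]
    field_simp
  -- Here ε βx = 1/(20 T₀), so the two formulas for T agree.
  have hTe : 1500 * (L / μ) ^ 3 / ((1 - lam) ^ 2 * ε * βx)
      = 30000 * (L / μ) ^ 3 * T₀ / (1 - lam) ^ 2 := by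
    have : 0 < 1 - lam := sub_pos.2 hmix.lt_one
    rw [h1, hε', hq2, ← hq3]
    field_simp
    norm_num
  obtain ⟨k1, k2, k3⟩ := key ε βx βy ηx ηy T b₀ hε0 hε1 hβ h2 h3 h4 h5 (h6.trans (by rw [hTe]))
  refine ⟨k1, k2, k3.trans (mul_le_mul_of_nonneg_left ?_ (by positivity))⟩
  have e1 : ε ^ 2 = 1 / (m * T₀) ^ (2 / 3 : ℝ) := by
    rw [Real.mul_rpow hM0.le hT00.le, hp2, hq2, hε']; field_simp
  have e2 : m * ε ^ 2 = p / T₀ ^ (2 / 3 : ℝ) := by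
    rw [hq2, hε', ← hp3]; field_simp
  -- The term 1/T₀ is slack: the bound already holds without it.
  have : 0 < 1 / T₀ := by positivity
  rw [e2, e1]
  linarith
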